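/- **Theorem 1.3.** Let $1\le r\le\infty$ or $r=\omega$, let $\mathcal G\rightrightarrows M$ be a Lie groupoid of class $C^r$ with source map $\alpha$, target map $\beta$ and unit inclusion $\iota_M:M\to\mathcal G$ (through which $M$ is identified with the units), and let $\Gamma$ be a subgroup of the group $\mathrm{Bis}^r(\mathcal G)$ of $C^r$ bisections, that is, of $C^r$ maps $\sigma:M\to\mathcal G$ such that $\alpha\circ\sigma=\mathrm{id}_M$ and $\beta\circ\sigma$ is a $C^r$ diffeomorphism of $M$, with product $(\sigma\star\tau)(x)=\sigma(\beta(\tau(x))).\tau(x)$. *Notation.* $I\Gamma$ is the set of $C^r$ maps $\mathbb R\times M\to\mathcal G$, $(t,x)\mapsto\sigma_t(x)$, with $\sigma_0=\iota_M$ and $\sigma_t\in\Gamma$ for all $t$. Put $\mathrm{supp}(\sigma)=\overline{\{x:\sigma(x)\ne x\}}$ for a bisection $\sigma$, and likewise $\mathrm{supp}(f)=\overline{\{x: f(x)\neq x\}}$ for $f:M\to M$. $\mathcal G_x^o$ is the connected component of the unit at $x$ in $\mathcal G_x=\alpha^{-1}(x)$, and $L(x)=\beta(\mathcal G_x^o)$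 is the leaf through $x$ of the foliation $\mathcal F_{\mathcal G}$ of $M$. $C^1$ closeness on a set $A\subseteq M$ is meant in the $C^1$ compact-open topology: values and first derivatives are uniformly close on compact subsets of $A$. For two isotopies it means that the values and the first derivatives along $M$ are uniformly close on compact subsets of $\mathbb R\times A$. *Hypotheses.* (L) For all relatively compact open $U,V\subseteq M$ with $\overline U\subseteq V$ there is a $C^1$ neighbourhood $W$ of $\iota_M$ such that for every $\sigma\in I\Gamma$ with $\sigma_t\in W$ for all $t$: if $r\le\infty$, there is $\tau\in I\Gamma$ with $\tau_t=\sigma_t$ on $U$ and $\mathrm{supp}(\tau_t)\subseteq V$ for all $t$; if $r=\omega$, there are $\tau\in I\Gamma$ that are arbitrarily $C^1$ close to $\sigma$ on $U$ and, at the same time, arbitrarily $C^1$ close to the constant isotopy $\iota_M$ on $M\setminus V$. $\Gamma$ is fiberwise transitive: for every $x\in M$ there are $\sigma^1,\dots,\sigma^k\in I\Gamma$, $k=\dim\mathcal G_x$, such that $\frac{\partial\sigma^1_t(x)}{\partial t}\big|_{t=0},\dots,\frac{\partial\sigma^k_t(x)}{\partial t}\big|_{t=0}$ are linearly independent. *Conclusion.*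 Let $x_1,\dots,x_n\in M$ be pairwise distinct and $L_i=L(x_i)$. Assume that for each $i$ either $\dim L_i\ge2$, or $x_j\notin L_i$ for all $j\ne i$. Let $\gamma_i\in\mathcal G_{x_i}^o$ $(1\le i\le n)$ be arrows with $\beta(\gamma_i)\ne\beta(\gamma_j)$ for $i\ne j$, and let $V_i\subseteq M$ be an open neighbourhood of $L_i$ for each $i$. - If $r\le\infty$, there is $\sigma\in\Gamma$ with $\sigma(x_i)=\gamma_i$ for all $i$ and $\mathrm{supp}(\beta\circ\sigma)\subseteq V_1\cup\dots\cup V_n$. - If $r=\omega$, then for every $C^1$ neighbourhood of $\mathrm{id}_M$ on $M\setminus(V_1\cup\dots\cup V_n)$ there is $\sigma\in\Gamma$ with $\sigma(x_i)=\gamma_i$ for all $i$ and with $\beta\circ\sigma$ in that neighbourhood. -/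

import Mathlib

open Set Topology
open scoped Manifold ContDiff

noncomputable section

/-- A Lie groupoid `G ⇉ M` of class `C^r`, with source `src` (`α`), target `tgt` (`β`), units `unit`,
inversion `inv` and multiplication `mul`. The product `mul a b` is meaningful only if
`src a = tgt b`; no condition is put on the value of `mul` at other pairs. -/
structure LieGroupoid (E F : Type*) [NormedAddCommGroup E] [NormedSpace ℝ E]
    [NormedAddCommGroup F] [NormedSpace ℝ F] (r : WithTop ℕ∞)
    (M : Type*) [TopologicalSpace M] [ChartedSpace E M]
    (G : Type*) [TopologicalSpace G] [ChartedSpace F G] where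
  src : G → M
  tgt : G → M
  unit : M → G
  inv : G → G
  mul : G → G → G
  src_unit : ∀ x, src (unit x) = x
  tgt_unit : ∀ x, tgt (unit x) = x
  src_inv : ∀ a, src (inv a) = tgt a
  tgt_inv : ∀ a, tgt (inv a) = src a
  src_mul : ∀ a b, src a = tgt b → src (mul a b) = src b
  tgt_mul : ∀ a b, src a = tgt b → tgt (mul a b) = tgt a
  mul_assoc : ∀ a b c, src a = tgt b → src b = tgt c → mul (mul a b) c = mul a (mul b c)
  mul_unit : ∀ a, mul a (unit (src a)) = a
  unit_mul : ∀ a, mul (unit (tgt a)) a = a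
  inv_mul : ∀ a, mul (inv a) a = unit (src a)
  mul_inv : ∀ a, mul a (inv a) = unit (tgt a)
  contMDiff_src : ContMDiff 𝓘(ℝ, F) 𝓘(ℝ, E) r src
  contMDiff_tgt : ContMDiff 𝓘(ℝ, F) 𝓘(ℝ, E) r tgt
  /-- the source map is a submersion -/
  submersion_src : ∀ a, Function.Surjective (mfderiv 𝓘(ℝ, F) 𝓘(ℝ, E) src a)
  /-- the target map is a submersion -/
  submersion_tgt : ∀ a, Function.Surjective (mfderiv 𝓘(ℝ, F) 𝓘(ℝ, E) tgt a)
  contMDiff_unit : ContMDiff 𝓘(ℝ, E) 𝓘(ℝ, F) r unit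
  contMDiff_inv : ContMDiff 𝓘(ℝ, F) 𝓘(ℝ, F) r inv
  /-- multiplication is `C^r` on the submanifold of composable pairs -/
  contMDiffOn_mul : ContMDiffOn (𝓘(ℝ, F).prod 𝓘(ℝ, F)) 𝓘(ℝ, F) r
    (fun p : G × G => mul p.1 p.2) {p : G × G | src p.1 = tgt p.2}

section C1Topology

variable {E F : Type*} [NormedAddCommGroup E] [NormedSpace ℝ E]
  [NormedAddCommGroup F] [NormedSpace ℝ F]
  {M : Type*} [TopologicalSpace M] [ChartedSpace E M] [IsManifold 𝓘(ℝ, E) 1 M]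
  {N : Type*} [TopologicalSpace N] [ChartedSpace F N] [IsManifold 𝓘(ℝ, F) 1 N]

variable (E F M N) in
/-- The (compact-open) `C^1` topology over a subset `A` of `M`: the compact-open topology of the
tangent maps `Tf : TM → TN` over `A`, with subbasic sets `{f | Tf (K) ⊆ O}` for `O ⊆ TN` open and
`K ⊆ TM` compact with base points in `A`. It is only used at `C^1` maps, and says that values and
first derivatives are uniformly close on the compact subsets of `A`. -/
abbrev c1Topology (A : Set M) : TopologicalSpace (M → N) :=
  TopologicalSpace.generateFrom
    {S | ∃ (K : Set (TangentBundle 𝓘(ℝ, E) M)) (O : Set (TangentBundle 𝓘(ℝ, F) N)),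
      IsCompact K ∧ (∀ v ∈ K, v.proj ∈ A) ∧ IsOpen O ∧
      S = {f : M → N | ∀ v ∈ K, tangentMap 𝓘(ℝ, E) 𝓘(ℝ, F) f v ∈ O}}

variable (E F M N) in
/-- The same topology for families of maps `f_t : M → N`, `t ∈ ℝ`: closeness of `f_t` and its first
derivatives along `M`, uniformly on the compact subsets of `ℝ × A`. -/
abbrev c1FamilyTopology (A : Set M) : TopologicalSpace (ℝ → M → N) :=
  TopologicalSpace.generateFrom
    {S | ∃ (K : Set (ℝ × TangentBundle 𝓘(ℝ, E) M)) (O : Set (TangentBundle 𝓘(ℝ, F) N)),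
      IsCompact K ∧ (∀ p ∈ K, p.2.proj ∈ A) ∧ IsOpen O ∧
      S = {f : ℝ → M → N | ∀ p ∈ K, tangentMap 𝓘(ℝ, E) 𝓘(ℝ, F) (f p.1) p.2 ∈ O}}

end C1Topology

namespace LieGroupoid

variable {E F : Type*} [NormedAddCommGroup E] [NormedSpace ℝ E]
  [NormedAddCommGroup F] [NormedSpace ℝ F] {r : WithTop ℕ∞}
  {M : Type*} [TopologicalSpace M] [ChartedSpace E M]
  {G : Type*} [TopologicalSpace G] [ChartedSpace F G]

/-- A `C^r` bisection: a `C^r` section of the source map whose composition with the target map is a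
`C^r` diffeomorphism of `M`. -/
@[ext]
structure Bisection (𝒢 : LieGroupoid E F r M G) where
  toFun : M → G
  contMDiff : ContMDiff 𝓘(ℝ, E) 𝓘(ℝ, F) r toFun
  src_apply : ∀ x, 𝒢.src (toFun x) = x
  exists_diffeo : ∃ φ : M ≃ₘ^r⟮𝓘(ℝ, E), 𝓘(ℝ, E)⟯ M, ∀ x, φ x = 𝒢.tgt (toFun x)

namespace Bisection

variable {𝒢 : LieGroupoid E F r M G}

instance : CoeFun 𝒢.Bisection (fun _ => M → G) := ⟨toFun⟩

/-- The diffeomorphism `β ∘ σ` of `M`. -/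
def diffeo (σ : 𝒢.Bisection) : M ≃ₘ^r⟮𝓘(ℝ, E), 𝓘(ℝ, E)⟯ M := σ.exists_diffeo.choose

theorem diffeo_apply (σ : 𝒢.Bisection) (x : M) : σ.diffeo x = 𝒢.tgt (σ x) :=
  σ.exists_diffeo.choose_spec x

/-- The unit bisection `ι_M`. -/
instance : One 𝒢.Bisection where
  one :=
    { toFun := 𝒢.unit
      contMDiff := 𝒢.contMDiff_unit
      src_apply := 𝒢.src_unit
      exists_diffeo := ⟨Diffeomorph.refl _ _ _, fun x => (𝒢.tgt_unit x).symm⟩ }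

/-- The product `(σ ⋆ τ)(x) = σ(β(τ(x))).τ(x)`. -/
instance : Mul 𝒢.Bisection where
  mul σ τ :=
    { toFun := fun x => 𝒢.mul (σ (𝒢.tgt (τ x))) (τ x)
      contMDiff := by
        have h : ContMDiff 𝓘(ℝ, E) (𝓘(ℝ, F).prod 𝓘(ℝ, F)) r
            (fun x => ((σ (𝒢.tgt (τ x)), τ x) : G × G)) :=
          ((σ.contMDiff.comp 𝒢.contMDiff_tgt).comp τ.contMDiff).prodMk τ.contMDiff
        exact 𝒢.contMDiffOn_mul.comp_contMDiff h fun x => σ.src_apply _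
      src_apply := fun x => by rw [𝒢.src_mul _ _ (σ.src_apply _), τ.src_apply]
      exists_diffeo := ⟨τ.diffeo.trans σ.diffeo, fun x => by
        rw [𝒢.tgt_mul _ _ (σ.src_apply _), Diffeomorph.coe_trans, Function.comp_apply, diffeo_apply,
          diffeo_apply]⟩ }

/-- The inverse `σ⁻¹(x) = σ((β ∘ σ)⁻¹(x))⁻¹`. -/
instance : Inv 𝒢.Bisection where
  inv σ :=
    { toFun := fun x => 𝒢.inv (σ (σ.diffeo.symm x))
      contMDiff := (𝒢.contMDiff_inv.comp σ.contMDiff).comp σ.diffeo.symm.contMDiff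
      src_apply := fun x => by
        rw [𝒢.src_inv, ← diffeo_apply, Diffeomorph.apply_symm_apply]
      exists_diffeo := ⟨σ.diffeo.symm, fun x => by rw [𝒢.tgt_inv, σ.src_apply]⟩ }

theorem one_apply (x : M) : (1 : 𝒢.Bisection) x = 𝒢.unit x := rfl

theorem mul_apply (σ τ : 𝒢.Bisection) (x : M) :
    (σ * τ) x = 𝒢.mul (σ (𝒢.tgt (τ x))) (τ x) := rfl

theorem inv_apply (σ : 𝒢.Bisection) (x : M) : (σ⁻¹) x = 𝒢.inv (σ (σ.diffeo.symm x)) := rfl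

/-- The group `Bis^r(𝒢)` of bisections. -/
instance : Group 𝒢.Bisection :=
  Group.ofLeftAxioms
    (fun σ τ ρ => by
      ext x
      rw [mul_apply, mul_apply, mul_apply, mul_apply, 𝒢.tgt_mul _ _ (τ.src_apply _)]
      exact 𝒢.mul_assoc _ _ _ (by rw [σ.src_apply]) (by rw [τ.src_apply]))
    (fun σ => by
      ext x
      rw [mul_apply, one_apply, 𝒢.unit_mul])
    (fun σ => by
      ext x
      rw [mul_apply, inv_apply, one_apply, ← diffeo_apply, Diffeomorph.symm_apply_apply,
        𝒢.inv_mul, σ.src_apply])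

/-- The support of a bisection: the closure of the set where it differs from `ι_M`. -/
def supp (σ : 𝒢.Bisection) : Set M := closure {x | σ x ≠ 𝒢.unit x}

/-- The support of the diffeomorphism `β ∘ σ` of `M`. -/
def baseSupp (σ : 𝒢.Bisection) : Set M := closure {x | 𝒢.tgt (σ x) ≠ x}

end Bisection

variable (𝒢 : LieGroupoid E F r M G)

/-- The component of the unit at `x` in the source fibre over `x` (written `𝒢_x^o`). -/
def fiberComponent (x : M) : Set G := connectedComponentIn (𝒢.src ⁻¹' {x}) (𝒢.unit x)

/-- The leaf `β(𝒢_x^o)` through `x` of the foliation of `M` determined by the groupoid. -/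
def leaf (x : M) : Set M := 𝒢.tgt '' 𝒢.fiberComponent x

/-- The tangent space at the unit of `x` to the source fibre over `x`. -/
def fiberTangent (x : M) : Submodule ℝ (TangentSpace 𝓘(ℝ, F) (𝒢.unit x)) :=
  (mfderiv 𝓘(ℝ, F) 𝓘(ℝ, E) 𝒢.src (𝒢.unit x)).ker

/-- The dimension of the source fibre over `x`. -/
def fiberDim (x : M) : ℕ := Module.finrank ℝ (𝒢.fiberTangent x)

/-- The dimension of the leaf through `x` as an immersed submanifold of `M`. The target map is a
submersion of the source fibre onto the leaf, so that the tangent space of the leaf at `x` is the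
image under `Tβ` of the tangent space of the fibre. -/
def leafDim (x : M) : ℕ :=
  Module.finrank ℝ ((𝒢.fiberTangent x).map
    (mfderiv 𝓘(ℝ, F) 𝓘(ℝ, E) 𝒢.tgt (𝒢.unit x)).toLinearMap)

/-- The set `R(x_1, …, x_n)` of the tuples of arrows in the components `𝒢_{x_i}^o` with pairwise
distinct targets. -/
def arrowTuples {n : ℕ} (x : Fin n → M) : Set (Fin n → G) :=
  {γ | (∀ i, γ i ∈ 𝒢.fiberComponent (x i)) ∧ ∀ i j, i ≠ j → 𝒢.tgt (γ i) ≠ 𝒢.tgt (γ j)}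

variable {𝒢}

/-- The `C^r` isotopies in a group of bisections, starting at `ι_M` (the set `IΓ`). -/
structure IsIsotopyIn (Γ : Subgroup 𝒢.Bisection) (σ : ℝ → 𝒢.Bisection) : Prop where
  contMDiff : ContMDiff (𝓘(ℝ, ℝ).prod 𝓘(ℝ, E)) 𝓘(ℝ, F) r (fun p : ℝ × M => σ p.1 p.2)
  mem : ∀ t, σ t ∈ Γ
  zero : σ 0 = 1

/-- The velocity at `t = 0` of the curve `t ↦ σ_t(x)`, for `σ_0 = ι_M`. (All the tangent spaces
`TangentSpace 𝓘(ℝ, F) a` are `F`, and `σ 0 x` is `𝒢.unit x` here.) -/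
def velocity (σ : ℝ → 𝒢.Bisection) (x : M) : TangentSpace 𝓘(ℝ, F) (𝒢.unit x) :=
  (mfderiv 𝓘(ℝ, ℝ) 𝓘(ℝ, F) (fun t : ℝ => σ t x) 0 (1 : ℝ) : F)

/-- Fiberwise transitivity: at every `x` there are as many isotopies in `Γ` with linearly
independent initial velocities as the source fibre over `x` has dimensions. -/
def FiberwiseTransitive (Γ : Subgroup 𝒢.Bisection) : Prop :=
  ∀ x : M, ∃ σ : Fin (𝒢.fiberDim x) → ℝ → 𝒢.Bisection,
    (∀ j, IsIsotopyIn Γ (σ j)) ∧ LinearIndependent ℝ (fun j => velocity (σ j) x)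

variable [IsManifold 𝓘(ℝ, E) 1 M] [IsManifold 𝓘(ℝ, F) 1 G]

/-- The locality condition (L). For relatively compact open `U`, `V` with `closure U ⊆ V` there is a
`C^1` neighbourhood `W` of `ι_M` such that for every isotopy `σ` in `Γ` that stays in `W`:
* if `r ≤ ∞`, some isotopy `τ` in `Γ` agrees with `σ` on `U` and has its support in `V`;
* if `r = ω`, some isotopy `τ` in `Γ` is as `C^1` close as one likes to `σ` on `U` and to `ι_M`
  outside `V`. -/
def LCondition (Γ : Subgroup 𝒢.Bisection) : Prop :=
  ∀ U V : Set M, IsOpen U → IsOpen V → IsCompact (closure U) → IsCompact (closure V) →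
    closure U ⊆ V →
    ∃ W ∈ @nhds (M → G) (c1Topology E F M G univ) 𝒢.unit,
      ∀ σ : ℝ → 𝒢.Bisection, IsIsotopyIn Γ σ → (∀ t, (σ t).toFun ∈ W) →
        (r ≠ ω → ∃ τ : ℝ → 𝒢.Bisection, IsIsotopyIn Γ τ ∧
          ∀ t, (∀ x ∈ U, τ t x = σ t x) ∧ (τ t).supp ⊆ V) ∧
        (r = ω →
          ∀ P ∈ @nhds (ℝ → M → G) (c1FamilyTopology E F M G U) (fun t => (σ t).toFun),
          ∀ Q ∈ @nhds (ℝ → M → G) (c1FamilyTopology E F M G Vᶜ) (fun _ => 𝒢.unit),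
          ∃ τ : ℝ → 𝒢.Bisection, IsIsotopyIn Γ τ ∧
            (fun t => (τ t).toFun) ∈ P ∧ (fun t => (τ t).toFun) ∈ Q)

end LieGroupoid

end

noncomputable section

/-! Bisections act on arrows by left translation, `act σ h` = σ(β(h)).h. This preserves sources, and
σ(x) is the image of the unit at x. So the tuple of units at the x_i has to be carried to γ by an
element of Γ that does little outside the V_i.

Connectedness. Isotopies with independent velocities give charts of the source fibres
(`exists_isFiberChart`), so the tuples of arrows in the components of the units form a locally
Euclidean, connected space. Components i and l can have equal targets only if x_l lies in L_i, and
then the leaf has dimension at least two. Near such a collision the colliding tuples lie in the zero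
set of a submersion onto a space of dimension at least two, and removing them disconnects nothing.
Hence a path of tuples with distinct targets joins the units to γ (`joinedIn_arrowTuples`).

Approximate transitivity. Along the path the targets stay in a relatively compact open O whose
closure lies in the union of the V_i. By (L), a small isotopy can be localized near one target: one
component of the tuple is moved as prescribed, the others stay put, exactly or up to a small error.
The tuples in the closure of what controlled elements reach therefore form an open and closed part
of the path, and γ is in this closure (`reachable_mem_nhdsWithin`).

From approximate to exact. The velocities at γ of the controlled isotopies span the whole tangent
space (`velocitySpan_eq_top`). Their span has constant dimension along orbits. If it were proper at
γ, a transversal coordinate would be constant along every short controlled isotopy that starts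
there, yet these isotopies approximate the motions along all coordinate axes. So a
finite-dimensional family in the group is submersive at γ, and its small members carry all nearby
tuples exactly to γ (`exists_family_exact`). One such member corrects the approximate solution.

Both regularity cases are the same argument (`exists_mem_apply_eq`) for a subgroup Γ' and a filter 𝓕
of bisections that measures the control. For r ≠ ω, Γ' consists of the elements with base support in
O and 𝓕 is trivial. For r = ω, Γ' is Γ and 𝓕 consists of `C^1` closeness to the identity off the
closure of O. -/

namespace LieGroupoid

variable {E F : Type*} [NormedAddCommGroup E] [NormedSpace ℝ E]
  [NormedAddCommGroup F] [NormedSpace ℝ F] {r : WithTop ℕ∞}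
  {M : Type*} [TopologicalSpace M] [ChartedSpace E M]
  {G : Type*} [TopologicalSpace G] [ChartedSpace F G]
  {𝒢 : LieGroupoid E F r M G}

/-! ### The left action of bisections on arrows -/

/-- The action of a bisection on arrows by left translation. -/
def act (σ : 𝒢.Bisection) (h : G) : G := 𝒢.mul (σ (𝒢.tgt h)) h

theorem src_act (σ : 𝒢.Bisection) (h : G) : 𝒢.src (act σ h) = 𝒢.src h :=
  𝒢.src_mul _ _ (σ.src_apply _)

theorem tgt_act (σ : 𝒢.Bisection) (h : G) : 𝒢.tgt (act σ h) = 𝒢.tgt (σ (𝒢.tgt h)) :=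
  𝒢.tgt_mul _ _ (σ.src_apply _)

theorem act_one (h : G) : act (1 : 𝒢.Bisection) h = h := 𝒢.unit_mul h

theorem act_mul (σ τ : 𝒢.Bisection) (h : G) : act (σ * τ) h = act σ (act τ h) := by
  change 𝒢.mul (𝒢.mul (σ (𝒢.tgt (τ (𝒢.tgt h)))) (τ (𝒢.tgt h))) h = _
  rw [𝒢.mul_assoc _ _ _ (σ.src_apply _) (τ.src_apply _)]
  change _ = 𝒢.mul (σ (𝒢.tgt (act τ h))) (act τ h)
  rw [tgt_act]; rfl

theorem act_unit (σ : 𝒢.Bisection) (z : M) : act σ (𝒢.unit z) = σ z := by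
  have h := 𝒢.mul_unit (σ z)
  rw [σ.src_apply] at h
  rw [act, 𝒢.tgt_unit, h]

theorem act_mul_right (σ : 𝒢.Bisection) {a b : G} (h : 𝒢.src a = 𝒢.tgt b) :
    act σ (𝒢.mul a b) = 𝒢.mul (act σ a) b := by
  rw [act, act, 𝒢.tgt_mul _ _ h, 𝒢.mul_assoc _ _ _ (σ.src_apply _) h]

theorem act_inv_act (σ : 𝒢.Bisection) (h : G) : act σ⁻¹ (act σ h) = h := by
  rw [← act_mul, inv_mul_cancel, act_one]

/-! ### Smooth families of bisections -/

section Families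

variable {V V' : Type*} [NormedAddCommGroup V] [NormedSpace ℝ V]
  [NormedAddCommGroup V'] [NormedSpace ℝ V']

/-- A family of bisections, parametrized by a normed space, that is jointly `C^r`. -/
def IsSmoothFamily (P : V → 𝒢.Bisection) : Prop :=
  ContMDiff (𝓘(ℝ, V).prod 𝓘(ℝ, E)) 𝓘(ℝ, F) r (fun p : V × M => P p.1 p.2)

theorem isSmoothFamily_const (σ : 𝒢.Bisection) : IsSmoothFamily (fun _ : V => σ) :=
  σ.contMDiff.comp contMDiff_snd

/-- Multiplication is smooth on composable pairs only, but σ(β(h)) and h are always composable, so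
the action is smooth on all of `G`. -/
theorem IsSmoothFamily.contMDiff_act {P : V → 𝒢.Bisection} (hP : IsSmoothFamily P) :
    ContMDiff (𝓘(ℝ, V).prod 𝓘(ℝ, F)) 𝓘(ℝ, F) r (fun p : V × G => act (P p.1) p.2) := by
  have h : ContMDiff (𝓘(ℝ, V).prod 𝓘(ℝ, F)) (𝓘(ℝ, F).prod 𝓘(ℝ, F)) r
      (fun p : V × G => ((P p.1 (𝒢.tgt p.2), p.2) : G × G)) := by
    have h1 : ContMDiff (𝓘(ℝ, V).prod 𝓘(ℝ, F)) (𝓘(ℝ, V).prod 𝓘(ℝ, E)) r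
      (fun p : V × G => ((p.1, 𝒢.tgt p.2) : V × M)) :=
      contMDiff_fst.prodMk (𝒢.contMDiff_tgt.comp contMDiff_snd)
    exact (hP.comp h1).prodMk contMDiff_snd
  exact 𝒢.contMDiffOn_mul.comp_contMDiff h fun p => (P p.1).src_apply _

theorem IsSmoothFamily.mul {P Q : V → 𝒢.Bisection} (hP : IsSmoothFamily P)
    (hQ : IsSmoothFamily Q) : IsSmoothFamily (fun v => P v * Q v) := by
  have h : ContMDiff (𝓘(ℝ, V).prod 𝓘(ℝ, E)) (𝓘(ℝ, V).prod 𝓘(ℝ, F)) r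
      (fun p : V × M => ((p.1, Q p.1 p.2) : V × G)) := contMDiff_fst.prodMk hQ
  exact hP.contMDiff_act.comp h

theorem IsSmoothFamily.comp {P : V → 𝒢.Bisection} (hP : IsSmoothFamily P) {f : V' → V}
    (hf : ContDiff ℝ r f) : IsSmoothFamily (fun v => P (f v)) := by
  have h : ContMDiff (𝓘(ℝ, V').prod 𝓘(ℝ, E)) (𝓘(ℝ, V).prod 𝓘(ℝ, E)) r
      (fun p : V' × M => ((f p.1, p.2) : V × M)) :=
    (hf.contMDiff.comp contMDiff_fst).prodMk contMDiff_snd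
  exact ContMDiff.comp hP h

/-- A jointly `C^r` family in `Γ` that passes through `1` at the parameter `0`. -/
structure IsFamilyIn (Γ : Subgroup 𝒢.Bisection) (P : V → 𝒢.Bisection) : Prop where
  smooth : IsSmoothFamily P
  mem : ∀ v, P v ∈ Γ
  zero : P 0 = 1

theorem isIsotopyIn_iff {Γ : Subgroup 𝒢.Bisection} {ρ : ℝ → 𝒢.Bisection} :
    IsIsotopyIn Γ ρ ↔ IsFamilyIn Γ ρ :=
  ⟨fun h => ⟨h.contMDiff, h.mem, h.zero⟩, fun h => ⟨h.smooth, h.mem, h.zero⟩⟩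

/-- The isotopy that follows a family along a line. -/
theorem IsFamilyIn.line {Γ : Subgroup 𝒢.Bisection} {P : V → 𝒢.Bisection} (hP : IsFamilyIn Γ P)
    (v w : V) : IsIsotopyIn Γ (fun s : ℝ => P (v + s • w) * (P v)⁻¹) :=
  isIsotopyIn_iff.2
    { smooth := (hP.smooth.comp (by fun_prop)).mul (isSmoothFamily_const _)
      mem := fun _ => Γ.mul_mem (hP.mem _) (Γ.inv_mem (hP.mem _))
      zero := by simp }

theorem IsIsotopyIn.conj {Γ : Subgroup 𝒢.Bisection} {ρ : ℝ → 𝒢.Bisection}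
    (hρ : IsIsotopyIn Γ ρ) {σ : 𝒢.Bisection} (hσ : σ ∈ Γ) :
    IsIsotopyIn Γ (fun s : ℝ => σ * ρ s * σ⁻¹) :=
  isIsotopyIn_iff.2
    { smooth := ((isSmoothFamily_const _).mul (isIsotopyIn_iff.1 hρ).smooth).mul
        (isSmoothFamily_const _)
      mem := fun _ => Γ.mul_mem (Γ.mul_mem hσ (hρ.mem _)) (Γ.inv_mem hσ)
      zero := by simp [hρ.zero] }

/-- A reparametrization of an isotopy is an isotopy. -/
theorem IsIsotopyIn.reparam {Γ : Subgroup 𝒢.Bisection} {ρ : ℝ → 𝒢.Bisection}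
    (hρ : IsIsotopyIn Γ ρ) {f : ℝ → ℝ} (hf : ContDiff ℝ r f) (h0 : f 0 = 0) :
    IsIsotopyIn Γ (fun s : ℝ => ρ (f s)) :=
  isIsotopyIn_iff.2
    { smooth := (isIsotopyIn_iff.1 hρ).smooth.comp hf
      mem := fun _ => hρ.mem _
      zero := by simp [hρ.zero, h0] }

theorem IsSmoothFamily.continuous {P : V → 𝒢.Bisection} (hP : IsSmoothFamily P) :
    Continuous (fun p : V × M => P p.1 p.2) := ContMDiff.continuous hP

theorem IsSmoothFamily.continuous_act {P : V → 𝒢.Bisection} (hP : IsSmoothFamily P) :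
    Continuous (fun p : V × G => act (P p.1) p.2) := hP.contMDiff_act.continuous

theorem continuous_act (σ : 𝒢.Bisection) : Continuous (act σ) :=
  (isSmoothFamily_const (V := ℝ) σ).continuous_act.comp (Continuous.prodMk_right (0 : ℝ))

/-- One move of an arrow with target in `U` by a member of the isotopies `ρ`. -/
def MoveIn {m : ℕ} (ρ : Fin m → ℝ → 𝒢.Bisection) (U : Set M) (a b : G) : Prop :=
  𝒢.tgt a ∈ U ∧ ∃ j t, b = act (ρ j t) a

/-- Finitely many isotopies are the restrictions to the axes of a family of bisections, the members
of which near `1` act as chains of small moves by the isotopies. -/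
theorem exists_family (Γ : Subgroup 𝒢.Bisection) {m : ℕ} (ρ : Fin m → ℝ → 𝒢.Bisection)
    (hρ : ∀ j, IsIsotopyIn Γ (ρ j)) :
    ∃ P : (Fin m → ℝ) → 𝒢.Bisection, IsFamilyIn Γ P ∧
      (∀ j s, P (Pi.single j s) = ρ j s) ∧
      ∀ U : Set M, IsOpen U → ∀ z ∈ U, ∀ᶠ t in 𝓝 (0 : Fin m → ℝ), ∀ a : G, 𝒢.tgt a = z →
        Relation.ReflTransGen (MoveIn ρ U) a (act (P t) a) := by
  induction m with
  | zero =>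
    refine ⟨fun _ => 1, ⟨isSmoothFamily_const 1, fun _ => Γ.one_mem, rfl⟩, fun j => j.elim0, ?_⟩
    intro U _ z _
    filter_upwards with t a _
    rw [act_one]
  | succ m ih =>
    obtain ⟨P, hP, hPs, hPm⟩ := ih (fun j => ρ j.succ) (fun j => hρ j.succ)
    have hc : ContDiff ℝ r (fun v : Fin (m + 1) → ℝ => Fin.tail v) := by
      unfold Fin.tail; fun_prop
    refine ⟨fun t => ρ 0 (t 0) * P (Fin.tail t), ⟨?_, ?_, ?_⟩, ?_, ?_⟩
    · exact ((isIsotopyIn_iff.1 (hρ 0)).smooth.comp (by fun_prop)).mul (hP.smooth.comp hc)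
    · exact fun v => Γ.mul_mem ((hρ 0).mem _) (hP.mem _)
    · have : Fin.tail (0 : Fin (m + 1) → ℝ) = 0 := rfl
      simp [this, hP.zero, (hρ 0).zero]
    · intro j s
      refine Fin.cases ?_ (fun j => ?_) j
      · have : Fin.tail (Pi.single 0 s : Fin (m + 1) → ℝ) = 0 := by
          ext l; simp [Fin.tail]
        simp [this, hP.zero]
      · have : Fin.tail (Pi.single j.succ s : Fin (m + 1) → ℝ) = Pi.single j s := by
          ext l; simp [Fin.tail, Pi.single_apply]
        have h0 : (Pi.single j.succ s : Fin (m + 1) → ℝ) 0 = 0 := by simp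
        beta_reduce
        rw [this, h0, hPs, (hρ 0).zero, one_mul]
    -- The right factor acts first, so the move by `ρ 0` comes last, and the target must still lie
    -- in `U` at that moment. Targets of translated arrows depend only on the old target, so one
    -- smallness condition on `t` serves all arrows with target `z`.
    · intro U hU z hz
      have ht : Filter.Tendsto (fun v : Fin (m + 1) → ℝ => Fin.tail v) (𝓝 0) (𝓝 0) := by
        have h := hc.continuous.tendsto 0
        exact h
      have hcz : Continuous (fun v : Fin m → ℝ => 𝒢.tgt (P v z)) :=
        𝒢.contMDiff_tgt.continuous.comp (hP.smooth.continuous.comp (Continuous.prodMk_left z))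
      have hU' : ∀ᶠ v in 𝓝 (0 : Fin m → ℝ), 𝒢.tgt (P v z) ∈ U := by
        refine hcz.continuousAt.eventually_mem (hU.mem_nhds ?_)
        rw [hP.zero]
        change 𝒢.tgt (𝒢.unit z) ∈ U
        rwa [𝒢.tgt_unit]
      filter_upwards [ht.eventually (hPm U hU z hz), ht.eventually hU'] with t h1 h2 a ha
      have hmono : Relation.ReflTransGen (MoveIn ρ U) a (act (P (Fin.tail t)) a) :=
        Relation.ReflTransGen.mono (r := MoveIn (fun j : Fin m => ρ j.succ) U)
          (fun _ _ ⟨h, j, s, hs⟩ => ⟨h, j.succ, s, hs⟩) _ _ (h1 a ha)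
      refine hmono.tail ⟨?_, 0, t 0, ?_⟩
      · rw [tgt_act, ha]; exact h2
      · rw [act_mul]

end Families

end LieGroupoid

namespace LieGroupoid

variable {E F : Type*} [NormedAddCommGroup E] [NormedSpace ℝ E]
  [NormedAddCommGroup F] [NormedSpace ℝ F] {r : WithTop ℕ∞}
  {M : Type*} [TopologicalSpace M] [ChartedSpace E M]
  {G : Type*} [TopologicalSpace G] [ChartedSpace F G]
  {𝒢 : LieGroupoid E F r M G}

/-! ### Charts of the source fibres -/

/-- `P` parametrizes a neighbourhood of the unit at `y` in the source fibre over `y`, with the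
inverse `T`, which is of class `C^1` as a function on a neighbourhood in the groupoid. -/
structure IsFiberChart {d : ℕ} (y : M) (P : (Fin d → ℝ) → 𝒢.Bisection) (T : G → Fin d → ℝ)
    (O : Set (Fin d → ℝ)) (Ω : Set G) : Prop where
  isOpen_source : IsOpen O
  zero_mem : 0 ∈ O
  isOpen_target : IsOpen Ω
  smooth : ∀ h ∈ Ω, ContMDiffAt 𝓘(ℝ, F) 𝓘(ℝ, Fin d → ℝ) 1 T h
  mapsTo : ∀ t ∈ O, P t y ∈ Ω
  left_inv : ∀ t ∈ O, T (P t y) = t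
  symm_mapsTo : ∀ h ∈ Ω, 𝒢.src h = y → T h ∈ O
  right_inv : ∀ h ∈ Ω, 𝒢.src h = y → P (T h) y = h

/-- The preferred chart at a point identifies the tangent space with the model space by the
identity, so velocities become ordinary derivatives. -/
theorem velocity_eq_fderiv [IsManifold 𝓘(ℝ, F) 1 G] (hr : 1 ≤ r) {Γ : Subgroup 𝒢.Bisection} {σ : ℝ → 𝒢.Bisection}
    (hσ : IsIsotopyIn Γ σ) (y : M) :
    (velocity σ y : F) = fderiv ℝ (fun s => extChartAt 𝓘(ℝ, F) (𝒢.unit y) (σ s y)) 0 1 := by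
  have hd : MDifferentiableAt 𝓘(ℝ, ℝ) 𝓘(ℝ, F) (fun t : ℝ => σ t y) 0 := by
    have h : ContMDiff 𝓘(ℝ, ℝ) 𝓘(ℝ, F) r (fun t : ℝ => σ t y) :=
      hσ.contMDiff.comp (contMDiff_id.prodMk contMDiff_const)
    exact (h.of_le hr).mdifferentiable one_ne_zero 0
  have h0 : (fun t : ℝ => σ t y) 0 = 𝒢.unit y := by
    simp only [hσ.zero]; rfl
  have h1 := hd.hasMFDerivAt.2
  simp only [writtenInExtChartAt, h0] at h1
  simp only [mfld_simps] at h1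
  let L : ℝ →L[ℝ] F := mfderiv 𝓘(ℝ, ℝ) 𝓘(ℝ, F) (fun t : ℝ => σ t y) 0
  have h2 : HasFDerivAt (fun s => extChartAt 𝓘(ℝ, F) (𝒢.unit y) (σ s y)) L 0 :=
    hasFDerivWithinAt_univ.1 h1
  rw [h2.fderiv]
  rfl

/-- Rank-nullity for the submersion α. The fibre dimension is thus the same everywhere, and the
charts at all components of a tuple can share one parameter space. -/
theorem finrank_add_fiberDim [FiniteDimensional ℝ F] (𝒢 : LieGroupoid E F r M G) (y : M) :
    Module.finrank ℝ E + 𝒢.fiberDim y = Module.finrank ℝ F := by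
  let f : F →L[ℝ] E := mfderiv 𝓘(ℝ, F) 𝓘(ℝ, E) 𝒢.src (𝒢.unit y)
  have h := LinearMap.finrank_range_add_finrank_ker f.toLinearMap
  have hf : Function.Surjective f.toLinearMap := 𝒢.submersion_src (𝒢.unit y)
  rw [LinearMap.range_eq_top.2 hf, finrank_top] at h
  exact h

variable [IsManifold 𝓘(ℝ, E) 1 M] [IsManifold 𝓘(ℝ, F) 1 G]

/-- The inverse function theorem is applied not to the fibre but to (t, w) ↦ P_t(w), with w running
over a neighbourhood of `y`, as a map into the whole of `G`. The fibre over `y` is then the slice w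
= y, and no manifold structure on it is needed. -/
theorem exists_isFiberChart [FiniteDimensional ℝ E] [FiniteDimensional ℝ F] (hr : 1 ≤ r)
    {Γ : Subgroup 𝒢.Bisection} {d : ℕ} {y : M} (hd : 𝒢.fiberDim y = d)
    {σ : Fin d → ℝ → 𝒢.Bisection} (hσ : ∀ j, IsIsotopyIn Γ (σ j))
    (hli : LinearIndependent ℝ (fun j => velocity (σ j) y))
    {P : (Fin d → ℝ) → 𝒢.Bisection} (hP : IsSmoothFamily P) (hP0 : P 0 = 1)
    (hPs : ∀ j s, P (Pi.single j s) = σ j s) :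
    ∃ T O Ω, IsFiberChart y P T O Ω := by
  classical
  set κ := extChartAt 𝓘(ℝ, F) (𝒢.unit y) with hκ
  set χ := extChartAt 𝓘(ℝ, E) y with hχ
  let ψ : (Fin d → ℝ) × E → F := fun q => κ (P q.1 (χ.symm q.2))
  have hχy : χ.symm (χ y) = y := extChartAt_to_inv y
  have hP0y : P 0 (χ.symm (χ y)) = 𝒢.unit y := by rw [hP0, hχy]; rfl
  have hχs : ContMDiffAt 𝓘(ℝ, E) 𝓘(ℝ, E) 1 χ.symm (χ y) :=
    (contMDiffOn_extChartAt_symm y).contMDiffAt (extChartAt_target_mem_nhds y)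
  have hκs : ContMDiffAt 𝓘(ℝ, F) 𝓘(ℝ, F) 1 κ.symm (κ (𝒢.unit y)) :=
    (contMDiffOn_extChartAt_symm _).contMDiffAt (extChartAt_target_mem_nhds _)
  have hinner : ContMDiffAt 𝓘(ℝ, (Fin d → ℝ) × E) 𝓘(ℝ, F) 1
      (fun q : (Fin d → ℝ) × E => P q.1 (χ.symm q.2)) (0, χ y) := by
    have h1 : ContMDiffAt 𝓘(ℝ, (Fin d → ℝ) × E) (𝓘(ℝ, Fin d → ℝ).prod 𝓘(ℝ, E)) 1
        (fun q : (Fin d → ℝ) × E => ((q.1, χ.symm q.2) : (Fin d → ℝ) × M)) (0, χ y) := by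
      refine ContMDiffAt.prodMk contDiff_fst.contMDiff.contMDiffAt ?_
      exact ContMDiffAt.comp (x := ((0, χ y) : (Fin d → ℝ) × E)) (g := χ.symm) hχs
        contDiff_snd.contMDiff.contMDiffAt
    exact ContMDiffAt.comp (x := ((0, χ y) : (Fin d → ℝ) × E))
      (ContMDiff.contMDiffAt (ContMDiff.of_le hP hr)) h1
  have hψc : ContDiffAt ℝ 1 ψ (0, χ y) := by
    refine ContMDiffAt.contDiffAt ?_
    refine ContMDiffAt.comp (x := ((0, χ y) : (Fin d → ℝ) × E)) (g := κ) ?_ hinner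
    simp only [hP0y]
    exact contMDiffAt_extChartAt
  let s : F → E := fun v => χ (𝒢.src (κ.symm v))
  have hψ0 : ψ (0, χ y) = κ (𝒢.unit y) := by simp only [ψ, hP0y]
  have hs : ContDiffAt ℝ 1 s (ψ (0, χ y)) := by
    rw [hψ0]
    refine ContMDiffAt.contDiffAt ?_
    have h1 : ContMDiffAt 𝓘(ℝ, F) 𝓘(ℝ, E) 1 (fun v => 𝒢.src (κ.symm v)) (κ (𝒢.unit y)) :=
      ContMDiffAt.comp (g := 𝒢.src) _ (𝒢.contMDiff_src.of_le hr).contMDiffAt hκs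
    refine ContMDiffAt.comp (x := κ (𝒢.unit y)) (g := χ) ?_ h1
    simp only [extChartAt_to_inv, hκ, 𝒢.src_unit]
    exact contMDiffAt_extChartAt
  have hin : ∀ᶠ q in 𝓝 ((0, χ y) : (Fin d → ℝ) × E), P q.1 (χ.symm q.2) ∈ κ.source :=
    hinner.continuousAt.eventually_mem (by
      simp only [hP0y]; exact extChartAt_source_mem_nhds _)
  have htar : ∀ᶠ q in 𝓝 ((0, χ y) : (Fin d → ℝ) × E), q.2 ∈ χ.target :=
    by
    have h : Filter.Tendsto Prod.snd (𝓝 ((0, χ y) : (Fin d → ℝ) × E)) (𝓝 (χ y)) :=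
      continuousAt_snd
    exact h.eventually (extChartAt_target_mem_nhds y)
  -- The members of `P` are sections of α, so α reads off the second coordinate.
  have hsψ : (fun q => s (ψ q)) =ᶠ[𝓝 ((0, χ y) : (Fin d → ℝ) × E)] Prod.snd := by
    filter_upwards [hin, htar] with q h1 h2
    simp only [s, ψ, κ.left_inv h1, (P q.1).src_apply, χ.right_inv h2]
  set ψ' := fderiv ℝ ψ (0, χ y) with hψ'
  have hψd : HasFDerivAt ψ ψ' (0, χ y) := (hψc.differentiableAt one_ne_zero).hasFDerivAt
  have hcomp : (fderiv ℝ s (ψ (0, χ y))).comp ψ' = ContinuousLinearMap.snd ℝ _ _ := by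
    have h1 : HasFDerivAt (fun q => s (ψ q)) ((fderiv ℝ s (ψ (0, χ y))).comp ψ') (0, χ y) :=
      (hs.differentiableAt one_ne_zero).hasFDerivAt.comp _ hψd
    exact (h1.congr_of_eventuallyEq hsψ.symm).unique hasFDerivAt_snd
  have hvel : ∀ j, ψ' (Pi.single j 1, 0) = (velocity (σ j) y : F) := by
    intro j
    rw [velocity_eq_fderiv hr (hσ j) y]
    have h1 : HasFDerivAt (fun t : ℝ => ((Pi.single j t, χ y) : (Fin d → ℝ) × E))
        ((ContinuousLinearMap.single ℝ (fun _ : Fin d => ℝ) j).prod 0) 0 :=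
      (ContinuousLinearMap.single ℝ (fun _ : Fin d => ℝ) j).hasFDerivAt.prodMk
        (hasFDerivAt_const _ _)
    have h0 : ((Pi.single j (0 : ℝ), χ y) : (Fin d → ℝ) × E) = (0, χ y) := by simp
    have h2 : HasFDerivAt (fun t : ℝ => ψ (Pi.single j t, χ y))
        (ψ'.comp ((ContinuousLinearMap.single ℝ (fun _ : Fin d => ℝ) j).prod 0)) 0 := by
      refine HasFDerivAt.comp (g := ψ) 0 ?_ h1
      rw [h0]; exact hψd
    have h3 : (fun t : ℝ => ψ (Pi.single j t, χ y)) = fun t => κ (σ j t y) := by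
      ext t; simp only [ψ, hχy, hPs]
    rw [h3] at h2
    rw [h2.fderiv]
    simp
  -- A vector in the kernel has no `E` component, by `hcomp`; the rest is a linear relation between
  -- the independent velocities. Equality of dimensions then makes the derivative invertible.
  have hinj : Function.Injective ψ' := by
    rw [injective_iff_map_eq_zero]
    rintro ⟨t, w⟩ h
    have hw : w = 0 := by
      have h1 := DFunLike.congr_fun hcomp (t, w)
      simp only [ContinuousLinearMap.comp_apply, h, map_zero, ContinuousLinearMap.coe_snd'] at h1
      exact h1.symm
    subst hw
    have h2 : ((t, 0) : (Fin d → ℝ) × E) = ∑ j, t j • ((Pi.single j 1, 0) : (Fin d → ℝ) × E) := by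
      refine Prod.ext ?_ ?_
      · simp only [Prod.fst_sum, Prod.smul_fst]
        exact pi_eq_sum_univ' t
      · simp [Prod.snd_sum]
    rw [h2, map_sum] at h
    simp only [map_smul, hvel] at h
    have h3 := Fintype.linearIndependent_iff.1 hli t h
    ext j <;> simp [h3]
  have hfin : Module.finrank ℝ ((Fin d → ℝ) × E) = Module.finrank ℝ F := by
    rw [Module.finrank_prod, Module.finrank_fin_fun, ← finrank_add_fiberDim 𝒢 y, hd, add_comm]
  let A : ((Fin d → ℝ) × E) ≃L[ℝ] F :=
    (LinearEquiv.ofInjectiveOfFinrankEq ψ'.toLinearMap hinj hfin).toContinuousLinearEquiv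
  have hA : (A : ((Fin d → ℝ) × E) →L[ℝ] F) = ψ' := by ext <;> rfl
  have hψA : HasFDerivAt ψ (A : ((Fin d → ℝ) × E) →L[ℝ] F) (0, χ y) := by rw [hA]; exact hψd
  let Φ := hψc.toOpenPartialHomeomorph ψ hψA one_ne_zero
  have hΦ : ∀ q, Φ q = ψ q := fun q => rfl
  have hΦs : ContDiffAt ℝ 1 Φ.symm (κ (𝒢.unit y)) := by
    have := hψc.to_localInverse hψA one_ne_zero
    rw [hψ0] at this
    exact this
  have h0Φ : ((0, χ y) : (Fin d → ℝ) × E) ∈ Φ.source :=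
    hψc.mem_toOpenPartialHomeomorph_source hψA one_ne_zero
  have hΦsymm0 : Φ.symm (κ (𝒢.unit y)) = (0, χ y) := by
    rw [← hψ0, ← hΦ]; exact Φ.left_inv h0Φ
  let T : G → Fin d → ℝ := fun h => (Φ.symm (κ h)).1
  have hu0 : κ (𝒢.unit y) ∈ Φ.target := by rw [← hψ0, ← hΦ]; exact Φ.map_source h0Φ
  have hκc : ContinuousAt κ (𝒢.unit y) := continuousAt_extChartAt _
  -- smoothness near the unit
  have hTs : ∀ᶠ h in 𝓝 (𝒢.unit y), ContMDiffAt 𝓘(ℝ, F) 𝓘(ℝ, Fin d → ℝ) 1 T h := by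
    filter_upwards [hκc.eventually (hΦs.eventually (by simp)), extChartAt_source_mem_nhds (I := 𝓘(ℝ, F)) (𝒢.unit y)]
      with h h1 h2
    have h3 : ContMDiffAt 𝓘(ℝ, F) 𝓘(ℝ, F) 1 κ h :=
      contMDiffAt_extChartAt' (by simpa [hκ] using h2)
    exact ContMDiffAt.comp (g := fun v => (Φ.symm v).1) h
      (contDiff_fst.contDiffAt.comp _ h1).contMDiffAt h3
  -- the right inverse property near the unit
  have hTr : ∀ᶠ h in 𝓝 (𝒢.unit y), 𝒢.src h = y → P (T h) y = h := by
    have hc1 : Filter.Tendsto (fun h => Φ.symm (κ h)) (𝓝 (𝒢.unit y)) (𝓝 (0, χ y)) := by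
      have := hΦs.continuousAt.tendsto.comp hκc.tendsto
      rwa [hΦsymm0] at this
    filter_upwards [hκc.eventually (Φ.open_target.mem_nhds hu0), hc1.eventually hin,
      hc1.eventually htar, extChartAt_source_mem_nhds (I := 𝓘(ℝ, F)) (𝒢.unit y)] with h h1 h2 h3 h4 hy
    have e1 : ψ (Φ.symm (κ h)) = κ h := Φ.right_inv h1
    have e2 : P (Φ.symm (κ h)).1 (χ.symm (Φ.symm (κ h)).2) = h := κ.injOn h2 h4 e1
    -- Comparing sources shows that the second coordinate of an arrow in the fibre over `y` is `y`
    -- itself.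
    have e3 : χ.symm (Φ.symm (κ h)).2 = y := by
      rw [← hy, ← (P (Φ.symm (κ h)).1).src_apply (χ.symm (Φ.symm (κ h)).2)]
      exact congrArg 𝒢.src e2
    rwa [e3] at e2
  have hTl : ∀ᶠ t in 𝓝 (0 : Fin d → ℝ), T (P t y) = t := by
    have hc2 : Filter.Tendsto (fun t : Fin d → ℝ => ((t, χ y) : (Fin d → ℝ) × E)) (𝓝 0)
      (𝓝 (0, χ y)) := (Continuous.prodMk_left (χ y)).tendsto 0
    filter_upwards [hc2.eventually (Φ.open_source.mem_nhds h0Φ)] with t ht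
    have := Φ.left_inv ht
    have h2 : Φ (t, χ y) = κ (P t y) := by rw [hΦ]; simp only [ψ, hχy]
    rw [h2] at this
    simp only [T, this]
  obtain ⟨Ω₀, hΩ₀, hΩ₀o, hΩ₀u⟩ := eventually_nhds_iff.1 (hTs.and hTr)
  obtain ⟨O₀, hO₀, hO₀o, hO₀u⟩ := eventually_nhds_iff.1 hTl
  have hPc : Continuous (fun t => P t y) := hP.continuous.comp (Continuous.prodMk_left y)
  have hO : IsOpen (O₀ ∩ (fun t => P t y) ⁻¹' Ω₀) := hO₀o.inter (hΩ₀o.preimage hPc)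
  have hTc : ContinuousOn T Ω₀ := fun h hh => (hΩ₀ h hh).1.continuousAt.continuousWithinAt
  -- Both sets are shrunk so that the two maps are mutually inverse between the parameter set and
  -- the part of the target set in the fibre.
  refine ⟨T, O₀ ∩ (fun t => P t y) ⁻¹' Ω₀, Ω₀ ∩ T ⁻¹' (O₀ ∩ (fun t => P t y) ⁻¹' Ω₀),
    hO, ⟨hO₀u, ?_⟩, hTc.isOpen_inter_preimage hΩ₀o hO, fun h hh => (hΩ₀ h hh.1).1,
    fun t ht => ⟨ht.2, ?_⟩, fun t ht => hO₀ t ht.1, fun h hh _ => hh.2,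
    fun h hh => (hΩ₀ h hh.1).2⟩
  · simp only [mem_preimage, hP0]; exact hΩ₀u
  · simp only [mem_preimage, hO₀ t ht.1]; exact ht

end LieGroupoid

namespace LieGroupoid

variable {E F : Type*} [NormedAddCommGroup E] [NormedSpace ℝ E]
  [NormedAddCommGroup F] [NormedSpace ℝ F] {r : WithTop ℕ∞}
  {M : Type*} [TopologicalSpace M] [ChartedSpace E M]
  {G : Type*} [TopologicalSpace G] [ChartedSpace F G]
  {𝒢 : LieGroupoid E F r M G}

/-! ### Fibre charts near arbitrary arrows, by right translation -/

theorem act_eq_mul_of_tgt (σ : 𝒢.Bisection) {h : G} {y : M} (hy : 𝒢.tgt h = y) :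
    act σ h = 𝒢.mul (σ y) h := by rw [act, hy]

theorem IsFiberChart.one_mem {d : ℕ} {y : M} {P : (Fin d → ℝ) → 𝒢.Bisection} {T : G → Fin d → ℝ}
    {O : Set (Fin d → ℝ)} {Ω : Set G} (hC : IsFiberChart y P T O Ω) (h0 : P 0 = 1) :
    𝒢.unit y ∈ Ω := by
  have := hC.mapsTo 0 hC.zero_mem
  rwa [h0] at this

theorem IsFiberChart.map_unit {d : ℕ} {y : M} {P : (Fin d → ℝ) → 𝒢.Bisection} {T : G → Fin d → ℝ}
    {O : Set (Fin d → ℝ)} {Ω : Set G} (hC : IsFiberChart y P T O Ω) (h0 : P 0 = 1) :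
    T (𝒢.unit y) = 0 := by
  have := hC.left_inv 0 hC.zero_mem
  rwa [h0] at this

/-- Right translation of a fibre chart: coordinates near an arrow in its source fibre. -/
theorem IsFiberChart.translate {d : ℕ} {y : M} {P : (Fin d → ℝ) → 𝒢.Bisection} {T : G → Fin d → ℝ}
    {O : Set (Fin d → ℝ)} {Ω : Set G} (hC : IsFiberChart y P T O Ω) (h0 : P 0 = 1) {g : G}
    (hg : 𝒢.tgt g = y) :
    Filter.Tendsto (fun h => T (𝒢.mul h (𝒢.inv g))) (𝓝[𝒢.src ⁻¹' {𝒢.src g}] g) (𝓝 0) ∧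
    ∀ᶠ h in 𝓝[𝒢.src ⁻¹' {𝒢.src g}] g, act (P (T (𝒢.mul h (𝒢.inv g)))) g = h := by
  have hmul : Filter.Tendsto (fun h => 𝒢.mul h (𝒢.inv g)) (𝓝[𝒢.src ⁻¹' {𝒢.src g}] g)
      (𝓝 (𝒢.unit y)) := by
    have h1 : ContinuousOn (fun p : G × G => 𝒢.mul p.1 p.2) {p | 𝒢.src p.1 = 𝒢.tgt p.2} :=
      𝒢.contMDiffOn_mul.continuousOn
    have h2 : ContinuousOn (fun h : G => 𝒢.mul h (𝒢.inv g)) (𝒢.src ⁻¹' {𝒢.src g}) :=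
      h1.comp (f := fun h : G => (h, 𝒢.inv g)) (by fun_prop)
        (fun h hh => by simpa [𝒢.tgt_inv] using hh)
    have h3 := h2 g rfl
    rw [ContinuousWithinAt, 𝒢.mul_inv, hg] at h3
    exact h3
  have hT : ContinuousAt T (𝒢.unit y) := (hC.smooth _ (hC.one_mem h0)).continuousAt
  constructor
  · have := hT.tendsto.comp hmul
    rwa [hC.map_unit h0] at this
  · filter_upwards [hmul.eventually (hC.isOpen_target.mem_nhds (hC.one_mem h0)),
      self_mem_nhdsWithin] with h h1 (h2 : 𝒢.src h = 𝒢.src g)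
    rw [act_eq_mul_of_tgt _ hg, hC.right_inv _ h1, 𝒢.mul_assoc _ _ _ (by rw [𝒢.tgt_inv, h2])
      (by rw [𝒢.src_inv]), 𝒢.inv_mul, ← h2, 𝒢.mul_unit]
    rw [𝒢.src_mul _ _ (by rw [𝒢.tgt_inv, h2]), 𝒢.src_inv, hg]

/-! ### Tuples of arrows -/

section Tuples

variable {n d : ℕ}

/-- The action on tuples of arrows. -/
def tact (σ : 𝒢.Bisection) (h : Fin n → G) : Fin n → G := fun i => act σ (h i)

theorem tact_mul (σ τ : 𝒢.Bisection) (h : Fin n → G) : tact (σ * τ) h = tact σ (tact τ h) :=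
  funext fun _ => act_mul _ _ _

theorem tact_one (h : Fin n → G) : tact (1 : 𝒢.Bisection) h = h :=
  funext fun _ => act_one _

theorem continuous_tact (σ : 𝒢.Bisection) : Continuous (tact σ : (Fin n → G) → Fin n → G) :=
  continuous_pi fun i => (continuous_act σ).comp (continuous_apply i)

/-- The tuples of arrows with given sources. -/
def fiberTuples (𝒢 : LieGroupoid E F r M G) (x : Fin n → M) : Set (Fin n → G) :=
  {h | ∀ i, 𝒢.src (h i) = x i}

/-- The product of the translated charts is a local parametrization of the space of tuples. As an
equality of filters, this lets neighbourhoods within the fibres be tested in coordinates. One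
inclusion is continuity; the other holds because the coordinates T_i(h_i g_i⁻¹) tend to 0 and
reproduce h. -/
theorem map_tuple_chart {P : Fin n → (Fin d → ℝ) → 𝒢.Bisection} {T : Fin n → G → Fin d → ℝ}
    {O : Fin n → Set (Fin d → ℝ)} {Ω : Fin n → Set G} {x : Fin n → M} {g : Fin n → G}
    (hg : g ∈ fiberTuples 𝒢 x)
    (hC : ∀ i, IsFiberChart (𝒢.tgt (g i)) (P i) (T i) (O i) (Ω i))
    (hP : ∀ i, IsSmoothFamily (P i)) (h0 : ∀ i, P i 0 = 1) :
    Filter.map (fun (p : Fin n → Fin d → ℝ) i => act (P i (p i)) (g i)) (𝓝 0) =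
      𝓝[fiberTuples 𝒢 x] g := by
  apply le_antisymm
  · refine tendsto_nhdsWithin_iff.2 ⟨?_, ?_⟩
    · have hc : Continuous (fun (p : Fin n → Fin d → ℝ) i => act (P i (p i)) (g i)) :=
        continuous_pi fun i => (hP i).continuous_act.comp
          (f := fun p : Fin n → Fin d → ℝ => (p i, g i))
          ((continuous_apply i).prodMk continuous_const)
      have := hc.tendsto 0
      have e : (fun i => act (P i ((0 : Fin n → Fin d → ℝ) i)) (g i)) = g := by
        ext i
        rw [Pi.zero_apply, h0, act_one]
      rwa [e] at this
    · filter_upwards with p i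
      rw [src_act, hg i]
  · intro S hS
    have hS' : ∀ᶠ p in 𝓝 (0 : Fin n → Fin d → ℝ), (fun i => act (P i (p i)) (g i)) ∈ S := hS
    have hproj : ∀ i, Filter.Tendsto (fun h : Fin n → G => h i) (𝓝[fiberTuples 𝒢 x] g)
        (𝓝[𝒢.src ⁻¹' {𝒢.src (g i)}] (g i)) := fun i =>
      tendsto_nhdsWithin_iff.2 ⟨((continuous_apply i).tendsto g).mono_left nhdsWithin_le_nhds, by
        filter_upwards [self_mem_nhdsWithin] with h hh
        exact (hh i).trans (hg i).symm⟩
    have ht : Filter.Tendsto (fun (h : Fin n → G) i => T i (𝒢.mul (h i) (𝒢.inv (g i))))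
        (𝓝[fiberTuples 𝒢 x] g) (𝓝 0) :=
      tendsto_pi_nhds.2 fun i => ((hC i).translate (h0 i) rfl).1.comp (hproj i)
    have he : ∀ᶠ h in 𝓝[fiberTuples 𝒢 x] g, ∀ i,
        act (P i (T i (𝒢.mul (h i) (𝒢.inv (g i))))) (g i) = h i :=
      Filter.eventually_all.2 fun i =>
        (hproj i).eventually ((hC i).translate (h0 i) rfl).2
    filter_upwards [ht.eventually hS', he] with h h1 h2
    rwa [funext h2] at h1

end Tuples

end LieGroupoid

namespace LieGroupoid

variable {E F : Type*} [NormedAddCommGroup E] [NormedSpace ℝ E]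
  [NormedAddCommGroup F] [NormedSpace ℝ F] {r : WithTop ℕ∞}
  {M : Type*} [TopologicalSpace M] [ChartedSpace E M]
  {G : Type*} [TopologicalSpace G] [ChartedSpace F G]
  {𝒢 : LieGroupoid E F r M G}

/-! ### Velocities of isotopies in fibre coordinates -/

section Coordinates

variable {n d : ℕ}

/-- The tuple of arrows with given coordinates. -/
def fibPt (y : Fin n → M) (P : Fin n → (Fin d → ℝ) → 𝒢.Bisection) (p : Fin n → Fin d → ℝ) :
    Fin n → G := fun i => P i (p i) (y i)

/-- The coordinates of the image under `σ` of the tuple with coordinates `p`. -/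
def coordAct (y : Fin n → M) (P : Fin n → (Fin d → ℝ) → 𝒢.Bisection) (T : Fin n → G → Fin d → ℝ)
    (σ : 𝒢.Bisection) (p : Fin n → Fin d → ℝ) : Fin n → Fin d → ℝ :=
  fun i => T i (act σ (P i (p i) (y i)))

/-- The span of the velocities, at the tuple with coordinates `p`, of the isotopies in `Γ`. -/
def velocitySpan (Γ : Subgroup 𝒢.Bisection) (y : Fin n → M)
    (P : Fin n → (Fin d → ℝ) → 𝒢.Bisection) (T : Fin n → G → Fin d → ℝ)
    (p : Fin n → Fin d → ℝ) : Submodule ℝ (Fin n → Fin d → ℝ) :=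
  Submodule.span ℝ {v | ∃ ρ : ℝ → 𝒢.Bisection, IsIsotopyIn Γ ρ ∧
    v = deriv (fun s => coordAct y P T (ρ s) p) 0}

/-- Charts of the source fibres at the points of a tuple. -/
structure IsFiberChartTuple (y : Fin n → M) (P : Fin n → (Fin d → ℝ) → 𝒢.Bisection)
    (T : Fin n → G → Fin d → ℝ) (O : Fin n → Set (Fin d → ℝ)) (Ω : Fin n → Set G) : Prop where
  chart : ∀ i, IsFiberChart (y i) (P i) (T i) (O i) (Ω i)
  smooth : ∀ i, IsSmoothFamily (P i)
  zero : ∀ i, P i 0 = 1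

variable {Γ : Subgroup 𝒢.Bisection} {y : Fin n → M} {P : Fin n → (Fin d → ℝ) → 𝒢.Bisection}
  {T : Fin n → G → Fin d → ℝ} {O : Fin n → Set (Fin d → ℝ)} {Ω : Fin n → Set G}
  {V : Type*} [NormedAddCommGroup V] [NormedSpace ℝ V]

namespace IsFiberChartTuple

/-- If `σ` takes the tuple with coordinates `p` to the one with coordinates `q`, then applying `τ`
to the latter is applying `τ * σ` to the former. -/
theorem coordAct_of_eq {σ τ : 𝒢.Bisection} {p q : Fin n → Fin d → ℝ}
    (h : fibPt y P q = tact σ (fibPt y P p)) :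
    coordAct y P T τ q = coordAct y P T (τ * σ) p := by
  ext1 i
  have h1 : P i (q i) (y i) = act σ (P i (p i) (y i)) := congrFun h i
  rw [coordAct, coordAct, h1, act_mul]

/-- The velocities along a family in `Γ` belong to the spans of velocities. -/
theorem deriv_line_mem {R : V → 𝒢.Bisection} (hR : IsFamilyIn Γ R) {v : V} (w : V)
    {p q : Fin n → Fin d → ℝ} (h : fibPt y P q = tact (R v) (fibPt y P p)) :
    deriv (fun s : ℝ => coordAct y P T (R (v + s • w)) p) 0 ∈ velocitySpan Γ y P T q := by
  refine Submodule.subset_span ⟨_, hR.line v w, ?_⟩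
  congr 1
  ext1 s
  rw [coordAct_of_eq h, inv_mul_cancel_right]

variable (hC : IsFiberChartTuple y P T O Ω)
include hC

theorem coordAct_one {p : Fin n → Fin d → ℝ} (hp : ∀ i, p i ∈ O i) :
    coordAct y P T 1 p = p := by
  ext1 i
  rw [coordAct, act_one, (hC.chart i).left_inv _ (hp i)]

theorem fibPt_coordAct {σ : 𝒢.Bisection} {p : Fin n → Fin d → ℝ}
    (h : ∀ i, act σ (P i (p i) (y i)) ∈ Ω i) :
    fibPt y P (coordAct y P T σ p) = tact σ (fibPt y P p) := by
  ext1 i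
  exact (hC.chart i).right_inv _ (h i) (by rw [src_act, (P i (p i)).src_apply])

theorem fibPt_zero : fibPt y P 0 = fun i => 𝒢.unit (y i) := by
  ext1 i
  change P i 0 (y i) = _
  rw [hC.zero]; rfl

theorem eventually_mem_target {R : V → 𝒢.Bisection} (hR : IsSmoothFamily R) {v : V}
    {p : Fin n → Fin d → ℝ} (h : ∀ i, act (R v) (P i (p i) (y i)) ∈ Ω i) :
    ∀ᶠ q in 𝓝 ((v, p) : V × (Fin n → Fin d → ℝ)), ∀ i, act (R q.1) (P i (q.2 i) (y i)) ∈ Ω i := by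
  refine Filter.eventually_all.2 fun i => ?_
  have h1 : Continuous (fun q : V × (Fin n → Fin d → ℝ) => P i (q.2 i) (y i)) :=
    (hC.smooth i).continuous.comp (f := fun q : V × (Fin n → Fin d → ℝ) => (q.2 i, y i))
      (by fun_prop)
  have h2 : Continuous (fun q : V × (Fin n → Fin d → ℝ) => act (R q.1) (P i (q.2 i) (y i))) :=
    hR.continuous_act.comp (f := fun q : V × (Fin n → Fin d → ℝ) => (q.1, P i (q.2 i) (y i)))
      (continuous_fst.prodMk h1)
  exact h2.continuousAt.eventually_mem ((hC.chart i).isOpen_target.mem_nhds (h i))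

theorem contDiffAt_coordAct (hr : 1 ≤ r) {R : V → 𝒢.Bisection} (hR : IsSmoothFamily R) {v : V}
    {p : Fin n → Fin d → ℝ} (h : ∀ i, act (R v) (P i (p i) (y i)) ∈ Ω i) :
    ContDiffAt ℝ 1 (fun q : V × (Fin n → Fin d → ℝ) => coordAct y P T (R q.1) q.2) (v, p) := by
  refine contDiffAt_pi.2 fun i => ContMDiffAt.contDiffAt ?_
  have h1 : ContMDiff 𝓘(ℝ, V × (Fin n → Fin d → ℝ)) 𝓘(ℝ, F) r
      (fun q : V × (Fin n → Fin d → ℝ) => P i (q.2 i) (y i)) := by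
    have h0 : ContMDiff 𝓘(ℝ, V × (Fin n → Fin d → ℝ)) (𝓘(ℝ, Fin d → ℝ).prod 𝓘(ℝ, E)) r
        (fun q : V × (Fin n → Fin d → ℝ) => ((q.2 i, y i) : (Fin d → ℝ) × M)) :=
      ContMDiff.prodMk (ContDiff.contMDiff (by fun_prop)) contMDiff_const
    exact ContMDiff.comp (hC.smooth i) h0
  have h2 : ContMDiff 𝓘(ℝ, V × (Fin n → Fin d → ℝ)) 𝓘(ℝ, F) r
      (fun q : V × (Fin n → Fin d → ℝ) => act (R q.1) (P i (q.2 i) (y i))) := by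
    have h0 : ContMDiff 𝓘(ℝ, V × (Fin n → Fin d → ℝ)) (𝓘(ℝ, V).prod 𝓘(ℝ, F)) r
        (fun q : V × (Fin n → Fin d → ℝ) => ((q.1, P i (q.2 i) (y i)) : V × G)) :=
      ContMDiff.prodMk contDiff_fst.contMDiff h1
    exact hR.contMDiff_act.comp h0
  exact ContMDiffAt.comp (g := T i) (v, p) ((hC.chart i).smooth _ (h i))
    (h2.of_le hr).contMDiffAt

theorem contDiffAt_coordAct_right (hr : 1 ≤ r) {σ : 𝒢.Bisection}
    {p : Fin n → Fin d → ℝ} (h : ∀ i, act σ (P i (p i) (y i)) ∈ Ω i) :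
    ContDiffAt ℝ 1 (coordAct y P T σ) p := by
  have h1 := hC.contDiffAt_coordAct hr (isSmoothFamily_const (V := ℝ) σ) (v := 0) h
  exact h1.comp p (contDiffAt_const.prodMk contDiffAt_id)

theorem contDiffAt_coordAct_left (hr : 1 ≤ r) {R : V → 𝒢.Bisection} (hR : IsSmoothFamily R) {v : V}
    {p : Fin n → Fin d → ℝ} (h : ∀ i, act (R v) (P i (p i) (y i)) ∈ Ω i) :
    ContDiffAt ℝ 1 (fun v => coordAct y P T (R v) p) v :=
  (hC.contDiffAt_coordAct hr hR h).comp (f := fun v => (v, p)) v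
    (contDiffAt_id.prodMk contDiffAt_const)

theorem act_one_mem {p : Fin n → Fin d → ℝ} (hp : ∀ i, p i ∈ O i) (i : Fin n) :
    act (1 : 𝒢.Bisection) (P i (p i) (y i)) ∈ Ω i := by
  rw [act_one]; exact (hC.chart i).mapsTo _ (hp i)

theorem mem_of_eq {σ : 𝒢.Bisection} {p q : Fin n → Fin d → ℝ} (hq : ∀ i, q i ∈ O i)
    (h : fibPt y P q = tact σ (fibPt y P p)) (i : Fin n) : act σ (P i (p i) (y i)) ∈ Ω i := by
  have h1 : P i (q i) (y i) = act σ (P i (p i) (y i)) := congrFun h i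
  rw [← h1]; exact (hC.chart i).mapsTo _ (hq i)

theorem coordAct_eq {σ : 𝒢.Bisection} {p q : Fin n → Fin d → ℝ} (hq : ∀ i, q i ∈ O i)
    (h : fibPt y P q = tact σ (fibPt y P p)) : coordAct y P T σ p = q := by
  rw [← hC.coordAct_one hq, coordAct_of_eq h, one_mul]

/-- The dimension of the span of the velocities does not decrease along orbits. -/
theorem finrank_velocitySpan_le (hr : 1 ≤ r) {σ : 𝒢.Bisection} (hσ : σ ∈ Γ)
    {p q : Fin n → Fin d → ℝ} (hp : ∀ i, p i ∈ O i) (hq : ∀ i, q i ∈ O i)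
    (h : fibPt y P q = tact σ (fibPt y P p)) :
    Module.finrank ℝ (velocitySpan Γ y P T p) ≤ Module.finrank ℝ (velocitySpan Γ y P T q) := by
  have hmem := hC.mem_of_eq hq h
  have hpq : coordAct y P T σ p = q := hC.coordAct_eq hq h
  have h' : fibPt y P p = tact σ⁻¹ (fibPt y P q) := by
    rw [h, ← tact_mul, inv_mul_cancel, tact_one]
  have hmem' := hC.mem_of_eq hp h'
  set A := fderiv ℝ (coordAct y P T σ) p with hA
  have hAd : HasFDerivAt (coordAct y P T σ) A p :=
    ((hC.contDiffAt_coordAct_right hr hmem).differentiableAt one_ne_zero).hasFDerivAt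
  set B := fderiv ℝ (coordAct y P T σ⁻¹) q with hB
  have hBd : HasFDerivAt (coordAct y P T σ⁻¹) B q :=
    ((hC.contDiffAt_coordAct_right hr hmem').differentiableAt one_ne_zero).hasFDerivAt
  have hnear : ∀ᶠ p' in 𝓝 p, ∀ i, act σ (P i (p' i) (y i)) ∈ Ω i := by
    have h1 := hC.eventually_mem_target (isSmoothFamily_const (V := ℝ) σ) (v := 0) hmem
    have h2 : Filter.Tendsto (fun p' : Fin n → Fin d → ℝ => ((0, p') : ℝ × _)) (𝓝 p)
      (𝓝 (0, p)) := (Continuous.prodMk_right (0 : ℝ)).tendsto p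
    exact h2.eventually h1
  have hO : ∀ᶠ p' in 𝓝 p, ∀ i, p' i ∈ O i := Filter.eventually_all.2 fun i =>
    (continuous_apply i).continuousAt.eventually_mem
      ((hC.chart i).isOpen_source.mem_nhds (hp i))
  -- In coordinates σ⁻¹ undoes σ near `p`, so the derivative of σ is injective.
  have hBA : B.comp A = ContinuousLinearMap.id ℝ _ := by
    have h1 : HasFDerivAt (fun p' => coordAct y P T σ⁻¹ (coordAct y P T σ p')) (B.comp A) p := by
      refine HasFDerivAt.comp (g := coordAct y P T σ⁻¹) p ?_ hAd
      rw [hpq]; exact hBd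
    have h2 : (fun p' => coordAct y P T σ⁻¹ (coordAct y P T σ p')) =ᶠ[𝓝 p] id := by
      filter_upwards [hnear, hO] with p' h3 h4
      rw [coordAct_of_eq (hC.fibPt_coordAct h3), inv_mul_cancel, hC.coordAct_one h4, id]
    exact (h1.congr_of_eventuallyEq h2.symm).unique (hasFDerivAt_id p)
  have hAinj : Function.Injective A.toLinearMap := by
    intro u v huv
    have h1 : B (A u) = B (A v) := congrArg B huv
    have h2 : ∀ w, B (A w) = w := fun w => DFunLike.congr_fun hBA w
    rwa [h2, h2] at h1
  -- The derivative of σ takes the velocity of ρ at `p` to the velocity at `q` of the conjugate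
  -- σρσ⁻¹, which is again an isotopy in Γ.
  have hle : (velocitySpan Γ y P T p).map A.toLinearMap ≤ velocitySpan Γ y P T q := by
    rw [velocitySpan, Submodule.map_span, Submodule.span_le]
    rintro _ ⟨_, ⟨ρ, hρ, rfl⟩, rfl⟩
    refine Submodule.subset_span ⟨fun s => σ * ρ s * σ⁻¹, hρ.conj hσ, ?_⟩
    have hρs := (isIsotopyIn_iff.1 hρ).smooth
    have hρ0 : ∀ i, act (ρ 0) (P i (p i) (y i)) ∈ Ω i := by
      rw [hρ.zero]; exact hC.act_one_mem hp
    have h0 : coordAct y P T (ρ 0) p = p := by rw [hρ.zero, hC.coordAct_one hp]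
    have hd : HasDerivAt (fun s => coordAct y P T (ρ s) p)
        (deriv (fun s => coordAct y P T (ρ s) p) 0) 0 :=
      ((hC.contDiffAt_coordAct_left hr hρs (v := 0) hρ0).differentiableAt one_ne_zero).hasDerivAt
    have h1 : HasDerivAt (fun s => coordAct y P T σ (coordAct y P T (ρ s) p))
        (A (deriv (fun s => coordAct y P T (ρ s) p) 0)) 0 := by
      refine HasFDerivAt.comp_hasDerivAt (l := coordAct y P T σ) 0 ?_ hd
      rw [h0]; exact hAd
    have h2 : (fun s => coordAct y P T σ (coordAct y P T (ρ s) p)) =ᶠ[𝓝 0]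
        fun s => coordAct y P T (σ * ρ s * σ⁻¹) q := by
      have h3 := hC.eventually_mem_target hρs (v := 0) hρ0
      have h4 : Filter.Tendsto (fun s : ℝ => ((s, p) : ℝ × _)) (𝓝 0)
        (𝓝 (0, p)) := (Continuous.prodMk_left p).tendsto 0
      filter_upwards [h4.eventually h3] with s h5
      rw [coordAct_of_eq (hC.fibPt_coordAct h5), coordAct_of_eq h]
      simp
    exact (h1.congr_of_eventuallyEq h2.symm).deriv.symm
  calc Module.finrank ℝ (velocitySpan Γ y P T p)
      = Module.finrank ℝ ((velocitySpan Γ y P T p).map A.toLinearMap) :=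
        (LinearEquiv.finrank_eq (Submodule.equivMapOfInjective A.toLinearMap hAinj _))
    _ ≤ _ := Submodule.finrank_mono hle

end IsFiberChartTuple

end Coordinates

end LieGroupoid

namespace LieGroupoid

variable {E F : Type*} [NormedAddCommGroup E] [NormedSpace ℝ E]
  [NormedAddCommGroup F] [NormedSpace ℝ F] {r : WithTop ℕ∞}
  {M : Type*} [TopologicalSpace M] [ChartedSpace E M]
  {G : Type*} [TopologicalSpace G] [ChartedSpace F G]
  {𝒢 : LieGroupoid E F r M G}

/-! ### Spanning velocities: from approximate motions to exact ones -/

section Coordinates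

variable {n d : ℕ} {Γ : Subgroup 𝒢.Bisection} {y : Fin n → M}
  {P : Fin n → (Fin d → ℝ) → 𝒢.Bisection}
  {T : Fin n → G → Fin d → ℝ} {O : Fin n → Set (Fin d → ℝ)} {Ω : Fin n → Set G}

/-- The isotopies in `Γ` approximate the motions of single components of the tuple of units at `y`
along the coordinate axes of the charts. -/
def ApproximatesAxes (Γ : Subgroup 𝒢.Bisection) (y : Fin n → M)
    (P : Fin n → (Fin d → ℝ) → 𝒢.Bisection) : Prop :=
  ∀ (i : Fin n) (j : Fin d) (t : ℝ), 0 ≤ t → ∀ A B : Fin n → Set G, (∀ l, IsOpen (A l)) →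
    (∀ l, IsOpen (B l)) →
    (∀ s ∈ Icc 0 t, ∀ l, fibPt y P (Pi.single i (Pi.single j s)) l ∈ A l) →
    (∀ l, fibPt y P (Pi.single i (Pi.single j t)) l ∈ B l) →
    ∃ τ : ℝ → 𝒢.Bisection, IsIsotopyIn Γ τ ∧ (∀ s ∈ Icc 0 t, ∀ l, τ s (y l) ∈ A l) ∧
      ∀ l, τ t (y l) ∈ B l

/-- A family whose derivatives at `0` are a basis of a subspace, and a complement of the latter,
give coordinates. -/
theorem exists_slice {Q W : Type*} [NormedAddCommGroup Q] [NormedSpace ℝ Q] [FiniteDimensional ℝ Q]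
    [NormedAddCommGroup W] [NormedSpace ℝ W] [FiniteDimensional ℝ W]
    {f : W × Q → Q} (hf : ContDiffAt ℝ 1 f 0) (hf0 : ∀ᶠ q in 𝓝 (0 : Q), f (0, q) = q)
    {L : W →L[ℝ] Q} (hL : HasFDerivAt (fun w => f (w, 0)) L 0) (hLi : Function.Injective L)
    {U : Submodule ℝ Q} (hU : IsCompl L.toLinearMap.range U) :
    ∃ Φ : OpenPartialHomeomorph (W × U) Q, (∀ z, Φ z = f (z.1, z.2)) ∧ 0 ∈ Φ.source ∧ Φ 0 = 0 ∧
      ContDiffAt ℝ 1 Φ.symm 0 := by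
  let θ : W × U → Q := fun z => f (z.1, z.2)
  have hθ : ContDiffAt ℝ 1 θ 0 := by
    refine ContDiffAt.comp (f := fun z : W × U => ((z.1, (z.2 : Q)) : W × Q)) 0 hf ?_
    exact (contDiff_fst.prodMk (U.subtypeL.contDiff.comp contDiff_snd)).contDiffAt
  have hf00 : f (0, 0) = 0 := hf0.self_of_nhds
  set D := fderiv ℝ f 0
  have hD : HasFDerivAt f D 0 := (hf.differentiableAt one_ne_zero).hasFDerivAt
  have hD1 : ∀ w, D (w, 0) = L w := by
    have h1 : HasFDerivAt (fun w : W => ((w, 0) : W × Q)) (ContinuousLinearMap.inl ℝ W Q) 0 :=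
      (ContinuousLinearMap.inl ℝ W Q).hasFDerivAt
    have h2 : HasFDerivAt (fun w => f (w, 0)) (D.comp (ContinuousLinearMap.inl ℝ W Q)) 0 :=
      HasFDerivAt.comp (g := f) 0 hD h1
    intro w
    rw [hL.unique h2]; rfl
  have hD2 : ∀ q, D (0, q) = q := by
    have h1 : HasFDerivAt (fun q : Q => ((0, q) : W × Q)) (ContinuousLinearMap.inr ℝ W Q) 0 :=
      (ContinuousLinearMap.inr ℝ W Q).hasFDerivAt
    have h2 : HasFDerivAt (fun q => f (0, q)) (D.comp (ContinuousLinearMap.inr ℝ W Q)) 0 :=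
      HasFDerivAt.comp (g := f) 0 hD h1
    have h3 := (h2.congr_of_eventuallyEq (hf0.mono fun q hq => hq.symm)).unique (hasFDerivAt_id 0)
    intro q
    exact DFunLike.congr_fun h3 q
  let ι : (W × U) →L[ℝ] W × Q := (ContinuousLinearMap.fst ℝ W U).prod
    (U.subtypeL.comp (ContinuousLinearMap.snd ℝ W U))
  have hθd : HasFDerivAt θ (D.comp ι) 0 := HasFDerivAt.comp (g := f) 0 hD ι.hasFDerivAt
  -- On the first factor the derivative is `L`; on the second it is the inclusion, because `f (0, q)
  -- = q`. Their ranges are complementary.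
  have hval : ∀ w u, (D.comp ι) (w, u) = L w + u := by
    intro w u
    have : ι (w, u) = (w, 0) + (0, (u : Q)) := by simp [ι]
    rw [ContinuousLinearMap.comp_apply, this, map_add, hD1, hD2]
  have hinj : Function.Injective (D.comp ι) := by
    rw [injective_iff_map_eq_zero]
    rintro ⟨w, u⟩ h
    rw [hval] at h
    have h1 : L w ∈ U := by
      rw [eq_neg_of_add_eq_zero_left h]; exact U.neg_mem u.2
    have h2 : L w = 0 := by
      have := hU.disjoint.le_bot (⟨⟨w, rfl⟩, h1⟩ : L w ∈ L.toLinearMap.range ⊓ U)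
      simpa using this
    have h3 : w = 0 := hLi (by rw [h2, map_zero])
    rw [h2, zero_add] at h
    ext1
    · exact h3
    · exact Subtype.ext h
  have hfin : Module.finrank ℝ (W × U) = Module.finrank ℝ Q := by
    rw [Module.finrank_prod, ← Submodule.finrank_add_eq_of_isCompl hU]
    rw [LinearMap.finrank_range_of_inj hLi]
  let A : (W × U) ≃L[ℝ] Q :=
    (LinearEquiv.ofInjectiveOfFinrankEq (D.comp ι).toLinearMap hinj hfin).toContinuousLinearEquiv
  have hA : (A : (W × U) →L[ℝ] Q) = D.comp ι := by ext <;> rfl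
  have hθA : HasFDerivAt θ (A : (W × U) →L[ℝ] Q) 0 := by rw [hA]; exact hθd
  have h00 : θ 0 = 0 := hf00
  refine ⟨hθ.toOpenPartialHomeomorph θ hθA one_ne_zero, fun _ => rfl,
    hθ.mem_toOpenPartialHomeomorph_source hθA one_ne_zero, h00, ?_⟩
  have := hθ.to_localInverse hθA one_ne_zero
  rw [h00] at this
  exact this

namespace IsFiberChartTuple

/-- A family in `Γ` whose derivative at `0` is an isomorphism onto the span of the velocities. -/
theorem exists_family_velocitySpan (hC : IsFiberChartTuple y P T O Ω) (hr : 1 ≤ r)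
    (Γ : Subgroup 𝒢.Bisection) :
    ∃ (m : ℕ) (R : (Fin m → ℝ) → 𝒢.Bisection) (L : (Fin m → ℝ) →L[ℝ] (Fin n → Fin d → ℝ)),
      m = Module.finrank ℝ (velocitySpan Γ y P T 0) ∧ IsFamilyIn Γ R ∧
      HasFDerivAt (fun t => coordAct y P T (R t) 0) L 0 ∧ Function.Injective L ∧
      L.toLinearMap.range = velocitySpan Γ y P T 0 := by
  obtain ⟨v, hv, hvs, hvi⟩ := Submodule.exists_fun_fin_finrank_span_eq ℝ
    {v | ∃ ρ : ℝ → 𝒢.Bisection, IsIsotopyIn Γ ρ ∧ v = deriv (fun s => coordAct y P T (ρ s) 0) 0}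
  choose ρ hρ hρv using hv
  obtain ⟨R, hR, hRs, -⟩ := exists_family Γ ρ hρ
  have h0 : ∀ i, act (R 0) (P i ((0 : Fin n → Fin d → ℝ) i) (y i)) ∈ Ω i := by
    rw [hR.zero]; exact hC.act_one_mem fun i => (hC.chart i).zero_mem
  set L := fderiv ℝ (fun t => coordAct y P T (R t) 0) 0
  have hL : HasFDerivAt (fun t => coordAct y P T (R t) 0) L 0 :=
    ((hC.contDiffAt_coordAct_left hr hR.smooth h0).differentiableAt one_ne_zero).hasFDerivAt
  -- On the axes the family is the given isotopies, whose velocities were chosen as a basis of the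
  -- span.
  have hLv : ∀ j, L (Pi.single j 1) = v j := by
    intro j
    have h1 : HasDerivAt (fun s : ℝ => (Pi.single j s : Fin _ → ℝ)) (Pi.single j 1) 0 :=
      ((ContinuousLinearMap.single ℝ (fun _ => ℝ) j).hasFDerivAt (x := (0 : ℝ))).hasDerivAt
    have h2 : HasDerivAt (fun s : ℝ => coordAct y P T (R (Pi.single j s)) 0)
        (L (Pi.single j 1)) 0 := by
      refine HasFDerivAt.comp_hasDerivAt (l := fun t => coordAct y P T (R t) 0) 0 ?_ h1
      rw [Pi.single_zero]; exact hL
    simp only [hRs] at h2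
    rw [hρv j, h2.deriv]
  have hLsum : ∀ t, L t = ∑ j, t j • v j := by
    intro t
    conv_lhs => rw [pi_eq_sum_univ' t, map_sum]
    refine Finset.sum_congr rfl fun j _ => ?_
    rw [map_smul]
    have : (fun k => if j = k then (1 : ℝ) else 0) = Pi.single j 1 := by
      ext k; simp [Pi.single_apply, eq_comm]
    rw [← hLv, ← this]
  refine ⟨_, R, L, rfl, hR, hL, ?_, ?_⟩
  · rw [injective_iff_map_eq_zero]
    intro t ht
    rw [hLsum] at ht
    exact funext (Fintype.linearIndependent_iff.1 hvi t ht)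
  · refine Eq.trans ?_ hvs
    apply le_antisymm
    · rintro _ ⟨t, rfl⟩
      change L t ∈ _
      rw [hLsum]
      exact Submodule.sum_mem _ fun j _ => Submodule.smul_mem _ _
        (Submodule.subset_span (mem_range_self j))
    · rw [Submodule.span_le]
      rintro _ ⟨j, rfl⟩
      exact ⟨Pi.single j 1, hLv j⟩

/-- If the isotopies in `Γ` approximate the motions along the coordinate axes, their velocities
span the tangent spaces of the fibres. -/
theorem velocitySpan_eq_top (hC : IsFiberChartTuple y P T O Ω) (hr : 1 ≤ r)
    (happ : ApproximatesAxes Γ y P) : velocitySpan Γ y P T 0 = ⊤ := by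
  obtain ⟨m, R, L, hm, hR, hL, hLi, hLr⟩ := hC.exists_family_velocitySpan hr Γ
  obtain ⟨U, hU⟩ := Submodule.exists_isCompl (velocitySpan Γ y P T 0)
  have hO0 : ∀ i, (0 : Fin n → Fin d → ℝ) i ∈ O i := fun i => (hC.chart i).zero_mem
  have hOev : ∀ᶠ p in 𝓝 (0 : Fin n → Fin d → ℝ), ∀ i, p i ∈ O i := Filter.eventually_all.2 fun i =>
    (continuous_apply i).continuousAt.eventually_mem
      ((hC.chart i).isOpen_source.mem_nhds (hO0 i))
  have hR0 : ∀ i, act (R 0) (P i ((0 : Fin n → Fin d → ℝ) i) (y i)) ∈ Ω i := by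
    rw [hR.zero]; exact hC.act_one_mem hO0
  have hf0 : ∀ᶠ q in 𝓝 (0 : Fin n → Fin d → ℝ), coordAct y P T (R 0) q = q := by
    filter_upwards [hOev] with q hq
    rw [hR.zero, hC.coordAct_one hq]
  have hfc := hC.contDiffAt_coordAct hr hR.smooth hR0
  obtain ⟨Φ, hΦ, hΦs, hΦ0, hΦc⟩ := exists_slice
    (f := fun q : (Fin m → ℝ) × (Fin n → Fin d → ℝ) => coordAct y P T (R q.1) q.2) hfc hf0 hL hLi
    (by rw [hLr]; exact hU)
  have h0t : (0 : Fin n → Fin d → ℝ) ∈ Φ.target := by rw [← hΦ0]; exact Φ.map_source hΦs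
  have hΦsymm0 : Φ.symm 0 = 0 := by conv_lhs => rw [← hΦ0, Φ.left_inv hΦs]
  have htend : Filter.Tendsto Φ.symm (𝓝 0) (𝓝 0) := by
    have := hΦc.continuousAt.tendsto
    rwa [hΦsymm0] at this
  have hinc : Filter.Tendsto (fun z : (Fin m → ℝ) × U => ((z.1, (z.2 : Fin n → Fin d → ℝ)) :
      (Fin m → ℝ) × (Fin n → Fin d → ℝ))) (𝓝 0) (𝓝 (0, 0)) := by
    have : Continuous (fun z : (Fin m → ℝ) × U => ((z.1, (z.2 : Fin n → Fin d → ℝ)) :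
      (Fin m → ℝ) × (Fin n → Fin d → ℝ))) := by fun_prop
    exact this.tendsto 0
  -- The coordinate transversal to the orbit: the level sets of `υ` are swept out by the family `R`.
  let υ : (Fin n → Fin d → ℝ) → U := fun q => (Φ.symm q).2
  -- the good points
  have hgood : ∀ᶠ q in 𝓝 (0 : Fin n → Fin d → ℝ), (∀ i, q i ∈ O i) ∧ q ∈ Φ.target ∧
      ContDiffAt ℝ 1 Φ.symm q ∧ (∀ i, ((Φ.symm q).2 : Fin n → Fin d → ℝ) i ∈ O i) ∧
      (∀ i, act (R (Φ.symm q).1) (P i (((Φ.symm q).2 : Fin n → Fin d → ℝ) i) (y i)) ∈ Ω i) := by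
    refine hOev.and (Filter.Eventually.and (Φ.open_target.mem_nhds h0t)
      ((hΦc.eventually (by simp)).and (Filter.Eventually.and ?_ ?_)))
    · refine (((continuous_subtype_val.comp continuous_snd).tendsto' 0 0 rfl).comp
        htend).eventually hOev
    · exact (hinc.comp htend).eventually (hC.eventually_mem_target hR.smooth hR0)
  -- The family `R` contributes `m` independent velocities at `q`, all tangent to the level of `υ`.
  -- Where the span has dimension at most `m` there are no others, so no isotopy in Γ changes `υ` to
  -- first order.
  have hkill : ∀ q, ((∀ i, q i ∈ O i) ∧ q ∈ Φ.target ∧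
      ContDiffAt ℝ 1 Φ.symm q ∧ (∀ i, ((Φ.symm q).2 : Fin n → Fin d → ℝ) i ∈ O i) ∧
      (∀ i, act (R (Φ.symm q).1) (P i (((Φ.symm q).2 : Fin n → Fin d → ℝ) i) (y i)) ∈ Ω i)) →
      Module.finrank ℝ (velocitySpan Γ y P T q) ≤ m → ∀ w ∈ velocitySpan Γ y P T q,
      fderiv ℝ Φ.symm q w ∈ LinearMap.ker (LinearMap.snd ℝ (Fin m → ℝ) U) := by
    rintro q ⟨hq, hqt, hqc, huO, huΩ⟩ hqm w hw
    set z := Φ.symm q with hz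
    have hzq : Φ z = q := Φ.right_inv hqt
    have hzs : z ∈ Φ.source := Φ.map_target hqt
    have hθc : ContDiffAt ℝ 1 Φ z := by
      have h1 := hC.contDiffAt_coordAct hr hR.smooth huΩ
      have h2 : ContDiffAt ℝ 1 (fun z : (Fin m → ℝ) × U => ((z.1, (z.2 : Fin n → Fin d → ℝ)) :
          (Fin m → ℝ) × (Fin n → Fin d → ℝ))) z :=
        (contDiff_fst.prodMk (U.subtypeL.contDiff.comp contDiff_snd)).contDiffAt
      have h3 := ContDiffAt.comp z h1 h2
      exact h3.congr_of_eventuallyEq (Filter.Eventually.of_forall hΦ)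
    set A := fderiv ℝ Φ z
    have hA : HasFDerivAt Φ A z := (hθc.differentiableAt one_ne_zero).hasFDerivAt
    set B := fderiv ℝ Φ.symm q
    have hB : HasFDerivAt Φ.symm B q := (hqc.differentiableAt one_ne_zero).hasFDerivAt
    have hBA : ∀ w, B (A w) = w := by
      have h1 : HasFDerivAt (fun z => Φ.symm (Φ z)) (B.comp A) z := by
        refine HasFDerivAt.comp (g := Φ.symm) z ?_ hA
        rw [hzq]; exact hB
      have h2 : (fun z => Φ.symm (Φ z)) =ᶠ[𝓝 z] id := by
        filter_upwards [Φ.open_source.mem_nhds hzs] with z' hz'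
        exact Φ.left_inv hz'
      have h3 := (h1.congr_of_eventuallyEq h2.symm).unique (hasFDerivAt_id z)
      exact fun w => DFunLike.congr_fun h3 w
    let J : (Fin m → ℝ) →ₗ[ℝ] (Fin n → Fin d → ℝ) :=
      A.toLinearMap ∘ₗ LinearMap.inl ℝ (Fin m → ℝ) U
    have hJi : Function.Injective J := by
      intro a b hab
      have h1 : B (A (a, 0)) = B (A (b, 0)) := congrArg B hab
      rw [hBA, hBA] at h1
      exact congrArg Prod.fst h1
    have hJle : LinearMap.range J ≤ velocitySpan Γ y P T q := by
      rintro _ ⟨a, rfl⟩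
      have h1 : HasDerivAt (fun s : ℝ => ((z.1 + s • a, z.2) : (Fin m → ℝ) × U)) (a, 0) 0 := by
        refine HasDerivAt.prodMk ?_ (hasDerivAt_const _ _)
        simpa using ((hasDerivAt_id (0 : ℝ)).smul_const a).const_add z.1
      have h2 : HasDerivAt (fun s : ℝ => Φ (z.1 + s • a, z.2)) (A (a, 0)) 0 := by
        refine HasFDerivAt.comp_hasDerivAt (l := Φ) 0 ?_ h1
        simpa using hA
      have h3 : J a = deriv (fun s : ℝ => coordAct y P T (R (z.1 + s • a)) z.2) 0 := by
        simp only [hΦ] at h2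
        exact h2.deriv.symm
      rw [h3]
      refine deriv_line_mem hR a ?_
      have h4 := hC.fibPt_coordAct huΩ
      have h5 : coordAct y P T (R z.1) z.2 = q := by rw [← hzq, hΦ]
      rwa [h5] at h4
    have hJr : LinearMap.range J = velocitySpan Γ y P T q := by
      refine Submodule.eq_of_le_of_finrank_le hJle ?_
      rw [LinearMap.finrank_range_of_inj hJi, Module.finrank_fin_fun]
      exact hqm
    rw [← hJr] at hw
    obtain ⟨a, rfl⟩ := hw
    change (B (A (a, 0))).2 = 0
    rw [hBA]
  obtain ⟨ε, hε, hball⟩ := Metric.eventually_nhds_iff_ball.1 hgood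
  -- An isotopy that keeps the arrows in these sets has its whole coordinate curve in the ball of
  -- good points.
  let Ω' : Fin n → Set G := fun l => Ω l ∩ T l ⁻¹' Metric.ball 0 ε
  have hTc : ∀ l, ContinuousOn (T l) (Ω l) := fun l h hh =>
    ((hC.chart l).smooth h hh).continuousAt.continuousWithinAt
  have hΩ'o : ∀ l, IsOpen (Ω' l) := fun l =>
    (hTc l).isOpen_inter_preimage (hC.chart l).isOpen_target Metric.isOpen_ball
  -- the axes stay in the slice through `0`
  have haxis : ∀ i j, ∀ᶠ t in 𝓝[≥] (0 : ℝ), υ (Pi.single i (Pi.single j t)) = 0 := by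
    intro i j
    have hcont : Continuous (fun t : ℝ => (Pi.single i (Pi.single j t) : Fin n → Fin d → ℝ)) :=
      (continuous_single (A := fun _ : Fin n => Fin d → ℝ) i).comp
        (continuous_single (A := fun _ : Fin d => ℝ) j)
    have h1 : ∀ᶠ t in 𝓝 (0 : ℝ), (Pi.single i (Pi.single j t) : Fin n → Fin d → ℝ) ∈
        Metric.ball 0 ε := by
      refine hcont.continuousAt.eventually_mem ?_
      simpa using Metric.ball_mem_nhds (0 : Fin n → Fin d → ℝ) hε
    obtain ⟨δ, hδ, hδb⟩ := Metric.eventually_nhds_iff_ball.1 h1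
    have h2 : Ico 0 δ ∈ 𝓝[≥] (0 : ℝ) := Ico_mem_nhdsGE hδ
    filter_upwards [h2] with t ht
    by_contra hne
    have hin : ∀ s ∈ Icc 0 t, (Pi.single i (Pi.single j s) : Fin n → Fin d → ℝ) ∈
        Metric.ball 0 ε := by
      intro s hs
      refine hδb s ?_
      rw [Metric.mem_ball, Real.dist_eq, sub_zero, abs_of_nonneg hs.1]
      exact hs.2.trans_lt ht.2
    have hmemball : ∀ q ∈ Metric.ball (0 : Fin n → Fin d → ℝ) ε, ∀ l, q l ∈ Metric.ball 0 ε := by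
      intro q hq l
      rw [ball_pi _ hε] at hq
      exact hq l (mem_univ l)
    have hA : ∀ s ∈ Icc 0 t, ∀ l, fibPt y P (Pi.single i (Pi.single j s)) l ∈ Ω' l := by
      intro s hs l
      have h3 := (hball _ (hin s hs)).1 l
      refine ⟨(hC.chart l).mapsTo _ h3, ?_⟩
      rw [mem_preimage, fibPt, (hC.chart l).left_inv _ h3]
      exact hmemball _ (hin s hs) l
    have hυc : ContinuousAt υ (Pi.single i (Pi.single j t)) :=
      continuous_snd.continuousAt.comp
        (hball _ (hin t (right_mem_Icc.2 ht.1))).2.2.1.continuousAt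
    -- If `υ` is nonzero at the point of the axis, it is nonzero nearby, hence also at the end of an
    -- approximating isotopy. But that isotopy starts at 0, and `υ` will be constant along it.
    obtain ⟨ε', hε', hball'⟩ := Metric.eventually_nhds_iff_ball.1 (hυc.eventually_ne hne)
    let B : Fin n → Set G := fun l => Ω l ∩ T l ⁻¹' Metric.ball
      ((Pi.single i (Pi.single j t) : Fin n → Fin d → ℝ) l) ε'
    obtain ⟨τ, hτ, hτA, hτB⟩ := happ i j t ht.1 Ω' B hΩ'o (fun l =>
      (hTc l).isOpen_inter_preimage (hC.chart l).isOpen_target Metric.isOpen_ball) hA (by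
        intro l
        have h3 := (hball _ (hin t (right_mem_Icc.2 ht.1))).1 l
        refine ⟨(hC.chart l).mapsTo _ h3, ?_⟩
        rw [mem_preimage, fibPt, (hC.chart l).left_inv _ h3]
        exact Metric.mem_ball_self hε')
    have hact : ∀ s l, act (τ s) (P l ((0 : Fin n → Fin d → ℝ) l) (y l)) = τ s (y l) := by
      intro s l
      rw [Pi.zero_apply, hC.zero]
      exact act_unit _ _
    have hτΩ : ∀ s ∈ Icc 0 t, ∀ l, act (τ s) (P l ((0 : Fin n → Fin d → ℝ) l) (y l)) ∈ Ω l := by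
      intro s hs l
      rw [hact]; exact (hτA s hs l).1
    set c : ℝ → Fin n → Fin d → ℝ := fun s => coordAct y P T (τ s) 0 with hc
    have hcball : ∀ s ∈ Icc 0 t, c s ∈ Metric.ball (0 : Fin n → Fin d → ℝ) ε := by
      intro s hs
      rw [ball_pi _ hε]
      intro l _
      simp only [hc, coordAct, hact]
      exact (hτA s hs l).2
    have hτs := (isIsotopyIn_iff.1 hτ).smooth
    have hcd : ∀ s ∈ Icc 0 t, HasDerivAt c (deriv c s) s := fun s hs =>
      ((hC.contDiffAt_coordAct_left hr hτs (hτΩ s hs)).differentiableAt one_ne_zero).hasDerivAt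
    have hfib : ∀ s ∈ Icc 0 t, fibPt y P (c s) = tact (τ s) (fibPt y P 0) := fun s hs =>
      hC.fibPt_coordAct (hτΩ s hs)
    have hcD : ∀ s ∈ Icc 0 t, deriv c s ∈ velocitySpan Γ y P T (c s) := by
      intro s hs
      have h3 := deriv_line_mem (T := T) (isIsotopyIn_iff.1 hτ) (v := s) (1 : ℝ) (hfib s hs)
      have h4 : deriv (fun u : ℝ => coordAct y P T (τ (s + u • 1)) 0) 0 = deriv c s := by
        have := deriv_comp_const_add c s 0
        simpa using this
      rwa [h4] at h3
    -- The inverse of `τ s` brings the tuple back to the units, so the dimension of the span is at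
    -- most its value `m` at 0.
    have hcm : ∀ s ∈ Icc 0 t, Module.finrank ℝ (velocitySpan Γ y P T (c s)) ≤ m := by
      intro s hs
      rw [hm]
      refine hC.finrank_velocitySpan_le hr (Γ.inv_mem (hτ.mem s)) (hball _ (hcball s hs)).1 hO0 ?_
      rw [hfib s hs, ← tact_mul, inv_mul_cancel, tact_one]
    have hυd : ∀ s ∈ Icc 0 t, HasDerivAt (fun s => υ (c s)) 0 s := by
      intro s hs
      have hg := hball _ (hcball s hs)
      have h3 : HasDerivAt (fun s => Φ.symm (c s)) (fderiv ℝ Φ.symm (c s) (deriv c s)) s :=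
        HasFDerivAt.comp_hasDerivAt (l := Φ.symm) s
          (hg.2.2.1.differentiableAt one_ne_zero).hasFDerivAt (hcd s hs)
      have h4 : HasDerivAt (fun s => υ (c s)) (fderiv ℝ Φ.symm (c s) (deriv c s)).2 s :=
        HasFDerivAt.comp_hasDerivAt (l := Prod.snd)
          (l' := ContinuousLinearMap.snd ℝ (Fin m → ℝ) U) s hasFDerivAt_snd h3
      have h5 : (fderiv ℝ Φ.symm (c s) (deriv c s)).2 = 0 :=
        hkill _ hg (hcm s hs) _ (hcD s hs)
      rwa [h5] at h4
    have hconst := constant_of_has_deriv_right_zero (f := fun s => υ (c s)) (a := 0) (b := t)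
      (fun s hs => (hυd s hs).continuousAt.continuousWithinAt)
      (fun s hs => (hυd s ⟨hs.1, hs.2.le⟩).hasDerivWithinAt) t (right_mem_Icc.2 ht.1)
    have hc0 : c 0 = 0 := by
      simp only [hc, hτ.zero]
      exact hC.coordAct_one hO0
    have hυ0 : υ 0 = 0 := by simp only [υ, hΦsymm0]; rfl
    refine hball' (c t) ?_ ?_
    · rw [ball_pi _ hε']
      intro l _
      simp only [hc, coordAct, hact]
      exact (hτB l).2
    · rw [hconst, hc0, hυ0]
  -- hence the derivative of the transversal coordinate vanishes
  set B := fderiv ℝ Φ.symm 0 with hBdef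
  have hB : HasFDerivAt Φ.symm B 0 := (hΦc.differentiableAt one_ne_zero).hasFDerivAt
  have hυd : HasFDerivAt υ ((ContinuousLinearMap.snd ℝ (Fin m → ℝ) U).comp B) 0 :=
    hasFDerivAt_snd.comp (0 : Fin n → Fin d → ℝ) hB
  have hzero : ∀ i j, ((ContinuousLinearMap.snd ℝ (Fin m → ℝ) U).comp B)
      (Pi.single i (Pi.single j 1)) = 0 := by
    intro i j
    have h1 : HasDerivAt (fun s : ℝ => (Pi.single i (Pi.single j s) : Fin n → Fin d → ℝ))
        (Pi.single i (Pi.single j 1)) 0 :=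
      (((ContinuousLinearMap.single ℝ (fun _ : Fin n => Fin d → ℝ) i).comp
        (ContinuousLinearMap.single ℝ (fun _ : Fin d => ℝ) j)).hasFDerivAt
          (x := (0 : ℝ))).hasDerivAt
    have h2 : HasDerivAt (fun s : ℝ => υ (Pi.single i (Pi.single j s)))
        (((ContinuousLinearMap.snd ℝ (Fin m → ℝ) U).comp B) (Pi.single i (Pi.single j 1))) 0 := by
      refine HasFDerivAt.comp_hasDerivAt (l := υ) 0 ?_ h1
      rw [Pi.single_zero, Pi.single_zero]; exact hυd
    -- Only nonnegative times are controlled; a one-sided derivative is enough, since `υ` is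
    -- differentiable at 0.
    have h3 : HasDerivWithinAt (fun s : ℝ => υ (Pi.single i (Pi.single j s))) 0 (Ici 0) 0 := by
      refine (hasDerivWithinAt_const (0 : ℝ) (Ici 0) (0 : U)).congr_of_eventuallyEq
        (haxis i j) ?_
      exact (haxis i j).self_of_nhdsWithin (mem_Ici.2 le_rfl)
    exact (uniqueDiffWithinAt_Ici (0 : ℝ)).eq_deriv _ h2.hasDerivWithinAt h3
  have hall : ∀ q, (B q).2 = 0 := by
    have h1 : ((ContinuousLinearMap.snd ℝ (Fin m → ℝ) U).comp B).toLinearMap = 0 := by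
      refine LinearMap.pi_ext' fun i => LinearMap.pi_ext' fun j => LinearMap.ext_ring ?_
      exact hzero i j
    exact fun q => DFunLike.congr_fun h1 q
  -- On `U` itself the transversal coordinate is the identity near 0, so its vanishing derivative
  -- forces `U = ⊥`.
  have hUbot : U = ⊥ := by
    rw [eq_bot_iff]
    intro u hu
    have h1 : HasDerivAt (fun s : ℝ => υ (s • u)) ((B u).2) 0 := by
      have h2 : HasDerivAt (fun s : ℝ => s • u) u 0 := by
        simpa using (hasDerivAt_id (0 : ℝ)).smul_const u
      refine HasFDerivAt.comp_hasDerivAt (l := υ)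
        (l' := (ContinuousLinearMap.snd ℝ (Fin m → ℝ) U).comp B) 0 ?_ h2
      rw [zero_smul]; exact hυd
    have h3 : (fun s : ℝ => υ (s • u)) =ᶠ[𝓝 0] fun s => s • (⟨u, hu⟩ : U) := by
      have h4 : Continuous (fun s : ℝ => ((0, s • (⟨u, hu⟩ : U)) : (Fin m → ℝ) × U)) := by
        fun_prop
      have h5 : Continuous (fun s : ℝ => s • u) := by fun_prop
      filter_upwards [h4.continuousAt.eventually_mem (x := (0 : ℝ)) (Φ.open_source.mem_nhds
        (by rw [zero_smul]; exact hΦs)), (h5.tendsto' 0 0 (zero_smul _ _)).eventually hf0] with s hs1 hs2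
      have h6 := Φ.left_inv hs1
      rw [hΦ] at h6
      simp only [υ]
      have h7 : ((s • (⟨u, hu⟩ : U) : U) : Fin n → Fin d → ℝ) = s • u := rfl
      simp only [h7, hs2] at h6
      rw [h6]
    have h8 : HasDerivAt (fun s : ℝ => s • (⟨u, hu⟩ : U)) (⟨u, hu⟩ : U) 0 := by
      simpa using (hasDerivAt_id (0 : ℝ)).smul_const (⟨u, hu⟩ : U)
    have h9 := h1.unique (h8.congr_of_eventuallyEq h3)
    rw [hall] at h9
    exact (congrArg Subtype.val h9).symm
  rw [hUbot] at hU
  simpa using hU.codisjoint.eq_top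

/-- Under the same condition, all tuples near the units are taken to the units by small members of
a family in `Γ`. -/
theorem exists_family_exact (hC : IsFiberChartTuple y P T O Ω) (hr : 1 ≤ r)
    (happ : ApproximatesAxes Γ y P) :
    ∃ (m : ℕ) (R : (Fin m → ℝ) → 𝒢.Bisection), IsFamilyIn Γ R ∧
      ∀ η ∈ 𝓝 (0 : Fin m → ℝ), ∀ᶠ p in 𝓝 (0 : Fin n → Fin d → ℝ), ∃ t ∈ η,
        tact (R t) (fibPt y P p) = fun i => 𝒢.unit (y i) := by
  obtain ⟨m, R, L, hm, hR, hL, hLi, hLr⟩ := hC.exists_family_velocitySpan hr Γ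
  rw [hC.velocitySpan_eq_top hr happ] at hLr
  refine ⟨m, R, hR, fun η hη => ?_⟩
  have hO0 : ∀ i, (0 : Fin n → Fin d → ℝ) i ∈ O i := fun i => (hC.chart i).zero_mem
  have hR0 : ∀ i, act (R 0) (P i ((0 : Fin n → Fin d → ℝ) i) (y i)) ∈ Ω i := by
    rw [hR.zero]; exact hC.act_one_mem hO0
  have hfc := hC.contDiffAt_coordAct hr hR.smooth hR0
  -- Keeping `p` as a second component turns solvability in `t`, for each given `p` near 0, into
  -- openness of `f` at the origin.
  let f : (Fin m → ℝ) × (Fin n → Fin d → ℝ) → (Fin n → Fin d → ℝ) × (Fin n → Fin d → ℝ) :=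
    fun q => (coordAct y P T (R q.1) q.2, q.2)
  have hfs : HasStrictFDerivAt f ((fderiv ℝ (fun q : (Fin m → ℝ) × (Fin n → Fin d → ℝ) =>
      coordAct y P T (R q.1) q.2) (0, 0)).prod (ContinuousLinearMap.snd ℝ _ _)) (0, 0) :=
    (hfc.hasStrictFDerivAt one_ne_zero).prodMk hasStrictFDerivAt_snd
  set D := fderiv ℝ (fun q : (Fin m → ℝ) × (Fin n → Fin d → ℝ) =>
      coordAct y P T (R q.1) q.2) (0, 0)
  have hD1 : ∀ w, D (w, 0) = L w := by
    have h1 : HasFDerivAt (fun w : Fin m → ℝ => ((w, 0) : (Fin m → ℝ) × (Fin n → Fin d → ℝ)))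
        (ContinuousLinearMap.inl ℝ _ _) 0 := hasFDerivAt_prodMk_left 0 0
    have h2 : HasFDerivAt (fun w => coordAct y P T (R w) 0)
        (D.comp (ContinuousLinearMap.inl ℝ _ _)) 0 :=
      HasFDerivAt.comp (g := fun q : (Fin m → ℝ) × (Fin n → Fin d → ℝ) =>
        coordAct y P T (R q.1) q.2) (f := fun w => (w, 0)) 0 (hfc.hasStrictFDerivAt one_ne_zero).hasFDerivAt h1
    intro w
    rw [hL.unique h2]; rfl
  have hsurj : LinearMap.range (D.prod (ContinuousLinearMap.snd ℝ (Fin m → ℝ)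
      (Fin n → Fin d → ℝ))).toLinearMap = ⊤ := by
    rw [LinearMap.range_eq_top]
    rintro ⟨a, b⟩
    have h1 : a - D (0, b) ∈ L.toLinearMap.range := by rw [hLr]; trivial
    obtain ⟨w, hw⟩ := h1
    have hw' : L w = a - D (0, b) := hw
    refine ⟨(w, b), ?_⟩
    have h2 : ((w, b) : (Fin m → ℝ) × (Fin n → Fin d → ℝ)) = (w, 0) + (0, b) := by simp
    have h3 : D (w, b) = a := by rw [h2, map_add, hD1, hw', sub_add_cancel]
    exact Prod.ext h3 rfl
  have hmap := hfs.map_nhds_eq_of_surj hsurj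
  have hf0 : f (0, 0) = (0, 0) := by
    simp only [f, hR.zero, hC.coordAct_one hO0]
  rw [hf0] at hmap
  have hset : {q : (Fin m → ℝ) × (Fin n → Fin d → ℝ) | q.1 ∈ η ∧
      ∀ i, act (R q.1) (P i (q.2 i) (y i)) ∈ Ω i} ∈ 𝓝 (0, 0) :=
    Filter.Eventually.and (continuousAt_fst.eventually_mem hη)
      (hC.eventually_mem_target hR.smooth hR0)
  have himg := Filter.image_mem_map (m := f) hset
  rw [hmap] at himg
  have hinc : Filter.Tendsto (fun p : Fin n → Fin d → ℝ =>
      ((0, p) : (Fin n → Fin d → ℝ) × (Fin n → Fin d → ℝ))) (𝓝 0) (𝓝 (0, 0)) :=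
    (Continuous.prodMk_right _).tendsto 0
  filter_upwards [hinc.eventually himg] with p hp
  obtain ⟨⟨t, p'⟩, ⟨ht, hΩ⟩, hq⟩ := hp
  have h1 : coordAct y P T (R t) p' = 0 := congrArg Prod.fst hq
  have h2 : p' = p := congrArg Prod.snd hq
  subst h2
  refine ⟨t, ht, ?_⟩
  rw [← hC.fibPt_coordAct hΩ, h1, hC.fibPt_zero]

end IsFiberChartTuple

end Coordinates

end LieGroupoid

namespace LieGroupoid

/-! ### Connectedness after removing subsets of codimension two -/

/-- Polar coordinates: the punctured ball is the image of an interval times the unit sphere, which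
is connected in dimension at least two. -/
theorem isPreconnected_ball_diff_zero {W : Type*} [NormedAddCommGroup W] [NormedSpace ℝ W]
    (hW : 1 < Module.rank ℝ W) (ε : ℝ) : IsPreconnected (Metric.ball (0 : W) ε \ {0}) := by
  have h1 : Metric.ball (0 : W) ε \ {0} =
      (fun p : ℝ × W => p.1 • p.2) '' (Ioo 0 ε ×ˢ Metric.sphere (0 : W) 1) := by
    ext v
    constructor
    · rintro ⟨hv, hv0⟩
      have hv0' : v ≠ 0 := hv0
      refine ⟨(‖v‖, ‖v‖⁻¹ • v), ⟨⟨norm_pos_iff.2 hv0', by simpa using hv⟩, ?_⟩, ?_⟩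
      · simp [norm_smul, hv0']
      · simp [smul_smul, hv0']
    · rintro ⟨⟨a, w⟩, ⟨⟨h1, h2⟩, h3⟩, rfl⟩
      have h3' : ‖w‖ = 1 := by simpa using h3
      have hw : w ≠ 0 := by rintro rfl; simp at h3'
      refine ⟨?_, ?_⟩
      · simp only [Metric.mem_ball, dist_zero_right, norm_smul, h3', mul_one]
        rwa [Real.norm_of_nonneg h1.le]
      · simp [h1.ne', hw]
  rw [h1]
  exact (isPreconnected_Ioo.prod (isPreconnected_sphere hW 0 1)).image _ (by fun_prop)

/-- Around a zero of a map with surjective derivative onto a space of dimension at least two there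
are small open sets whose connectedness is not affected by removing the zeros. -/
theorem exists_isPreconnected_diff_zeros {V W : Type*} [NormedAddCommGroup V] [NormedSpace ℝ V]
    [FiniteDimensional ℝ V] [NormedAddCommGroup W] [NormedSpace ℝ W] [FiniteDimensional ℝ W]
    {f : V → W} {f' : V →L[ℝ] W} {a : V} (hf : HasStrictFDerivAt f f' a)
    (hsurj : f'.toLinearMap.range = ⊤) (hfa : f a = 0) (hW : 1 < Module.rank ℝ W)
    {N : Set V} (hN : N ∈ 𝓝 a) :
    ∃ U ⊆ N, IsOpen U ∧ a ∈ U ∧ IsPreconnected (U \ f ⁻¹' {0}) ∧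
      U ⊆ closure (U \ f ⁻¹' {0}) := by
  have : CompleteSpace V := FiniteDimensional.complete ℝ V
  have : Nontrivial W := by
    rw [← rank_pos_iff_nontrivial (R := ℝ)]
    exact zero_lt_one.trans hW
  -- The implicit function theorem straightens the zero set to {0} × ker `f'`. Removing it from a
  -- product of balls punctures only the first factor.
  let H := hf.implicitToOpenPartialHomeomorph f f' hsurj
  have hHa : H a = 0 := by
    rw [hf.implicitToOpenPartialHomeomorph_self hsurj, hfa]; rfl
  have hHs : a ∈ H.source := hf.mem_implicitToOpenPartialHomeomorph_source hsurj
  have hHfst : ∀ v, (H v).1 = f v := fun v => hf.implicitToOpenPartialHomeomorph_fst hsurj v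
  have h0t : (0 : W × f'.toLinearMap.ker) ∈ H.target := by rw [← hHa]; exact H.map_source hHs
  have hs0 : H.symm 0 = a := by rw [← hHa]; exact H.left_inv hHs
  have hN' : ∀ᶠ z in 𝓝 (0 : W × f'.toLinearMap.ker), z ∈ H.target ∧ H.symm z ∈ N := by
    refine Filter.Eventually.and (H.open_target.mem_nhds h0t) ?_
    refine (H.continuousAt_symm h0t).eventually_mem ?_
    rwa [hs0]
  obtain ⟨ε, hε, hball⟩ := Metric.eventually_nhds_iff_ball.1 hN'
  set B : Set (W × f'.toLinearMap.ker) := Metric.ball 0 ε with hB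
  have hprod : B = Metric.ball (0 : W) ε ×ˢ Metric.ball (0 : f'.toLinearMap.ker) ε :=
    (ball_prod_same _ _ _).symm
  have hBt : B ⊆ H.target := fun z hz => (hball z hz).1
  have hdiff : H.symm '' B \ f ⁻¹' {0} =
      H.symm '' ((Metric.ball (0 : W) ε \ {0}) ×ˢ Metric.ball (0 : f'.toLinearMap.ker) ε) := by
    have hval : ∀ z ∈ B, f (H.symm z) = z.1 := fun z hz => by
      rw [← hHfst, H.right_inv (hBt hz)]
    ext v
    constructor
    · rintro ⟨⟨z, hz, rfl⟩, hv⟩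
      rw [mem_preimage, hval z hz] at hv
      rw [hprod] at hz
      exact ⟨z, ⟨⟨hz.1, hv⟩, hz.2⟩, rfl⟩
    · rintro ⟨z, hz, rfl⟩
      have hzB : z ∈ B := by rw [hprod]; exact ⟨hz.1.1, hz.2⟩
      refine ⟨⟨z, hzB, rfl⟩, ?_⟩
      rw [mem_preimage, hval z hzB]
      exact hz.1.2
  have hsub : (Metric.ball (0 : W) ε \ {0}) ×ˢ Metric.ball (0 : f'.toLinearMap.ker) ε ⊆ B := by
    rw [hprod]; exact prod_mono sdiff_subset subset_rfl
  refine ⟨H.symm '' B, ?_, ?_, ⟨0, Metric.mem_ball_self hε, hs0⟩, ?_, ?_⟩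
  · rintro _ ⟨z, hz, rfl⟩
    exact (hball z hz).2
  · exact H.symm.isOpen_image_of_subset_source Metric.isOpen_ball hBt
  · rw [hdiff]
    refine ((isPreconnected_ball_diff_zero hW ε).prod (convex_ball _ _).isPreconnected).image _ ?_
    exact H.continuousOn_symm.mono (hsub.trans hBt)
  · rw [hdiff]
    rintro _ ⟨z, hz, rfl⟩
    have hzc : z ∈ closure ((Metric.ball (0 : W) ε \ {0}) ×ˢ
        Metric.ball (0 : f'.toLinearMap.ker) ε) := by
      rw [closure_prod_eq]
      rw [hprod] at hz
      have : Filter.NeBot (𝓝[≠] (0 : W)) := Module.punctured_nhds_neBot ℝ W 0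
      exact ⟨(dense_compl_singleton (0 : W)).open_subset_closure_inter Metric.isOpen_ball hz.1,
        subset_closure hz.2⟩
    exact ((H.continuousAt_symm (hBt hz)).continuousWithinAt).mem_closure_image hzc

/-- Removing `Z` from a preconnected set leaves it preconnected, if this holds locally. -/
theorem isPreconnected_diff_of_locally {X : Type*} [TopologicalSpace X] {A Z : Set X}
    (hA : IsPreconnected A) (hU : ∀ p ∈ A, ∃ U ∈ 𝓝[A] p, U ⊆ A ∧ IsPreconnected (U \ Z))
    (hd : A ⊆ closure (A \ Z)) : IsPreconnected (A \ Z) := by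
  let C : X → X → Prop := fun a b => ∃ t ⊆ A \ Z, a ∈ t ∧ b ∈ t ∧ IsPreconnected t
  have hCt : ∀ a b c, C a b → C b c → C a c := by
    rintro a b c ⟨t, ht, hat, hbt, htp⟩ ⟨u, hu, hbu, hcu, hup⟩
    exact ⟨t ∪ u, union_subset ht hu, Or.inl hat, Or.inr hcu, htp.union b hbt hbu hup⟩
  have hCs : ∀ a b, C a b → C b a := fun a b ⟨t, ht, hat, hbt, htp⟩ => ⟨t, ht, hbt, hat, htp⟩
  -- The chaining relation `Q` has to make sense at points of `Z` as well, so it speaks of the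
  -- points of `A \ Z` near `p` and near `q`.
  let Q : X → X → Prop := fun p q => ∃ U ∈ 𝓝[A] p, ∃ U' ∈ 𝓝[A] q, ∀ a ∈ U \ Z, ∀ b ∈ U' \ Z, C a b
  have hQ : ∀ p ∈ A, ∀ q ∈ A, Q p q := by
    intro p hp q hq
    refine hA.induction₂ Q ?_ ?_ ?_ hp hq
    · intro p hp
      obtain ⟨U, hU, hUA, hUp⟩ := hU p hp
      have h1 : ∀ᶠ q in 𝓝[A] p, ∀ᶠ z in 𝓝[A] q, z ∈ U := eventually_eventually_nhdsWithin.2 hU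
      filter_upwards [h1] with q h2
      exact ⟨U, hU, U, h2, fun a ha b hb => ⟨U \ Z, sdiff_subset_sdiff_left hUA, ha, hb, hUp⟩⟩
    · rintro p q s - hq - ⟨U, hU, U', hU', h⟩ ⟨U₁, hU₁, U₂, hU₂, h'⟩
      refine ⟨U, hU, U₂, hU₂, fun a ha b hb => ?_⟩
      obtain ⟨N, hN, hNs⟩ := mem_nhdsWithin_iff_exists_mem_nhds_inter.1 (Filter.inter_mem hU' hU₁)
      -- Density of `A \ Z` supplies the common point through which the two connected sets are
      -- joined.
      obtain ⟨z, hzN, hzA, hzZ⟩ := mem_closure_iff_nhds.1 (hd hq) N hN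
      have hz := hNs ⟨hzN, hzA⟩
      exact hCt a z b (h a ha z ⟨hz.1, hzZ⟩) (h' z ⟨hz.2, hzZ⟩ b hb)
    · rintro p q - - ⟨U, hU, U', hU', h⟩
      exact ⟨U', hU', U, hU, fun a ha b hb => hCs _ _ (h b hb a ha)⟩
  refine isPreconnected_of_forall_pair fun p hp q hq => ?_
  obtain ⟨U, hU, U', hU', h⟩ := hQ p hp.1 q hq.1
  exact h p ⟨mem_of_mem_nhdsWithin hp.1 hU, hp.2⟩ q ⟨mem_of_mem_nhdsWithin hq.1 hU', hq.2⟩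

/-- Being joined in `A` is an equivalence relation whose classes are open in `A`. -/
theorem joinedIn_of_locally {X : Type*} [TopologicalSpace X] {A : Set X} (hA : IsPreconnected A)
    (h : ∀ p ∈ A, ∀ᶠ q in 𝓝[A] p, JoinedIn A p q) {p q : X} (hp : p ∈ A) (hq : q ∈ A) :
    JoinedIn A p q :=
  hA.induction₂ (JoinedIn A) h (fun _ _ _ _ _ _ h1 h2 => h1.trans h2)
    (fun _ _ _ _ h1 => h1.symm) hp hq

end LieGroupoid

namespace LieGroupoid

variable {E F : Type*} [NormedAddCommGroup E] [NormedSpace ℝ E]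
  [NormedAddCommGroup F] [NormedSpace ℝ F] {r : WithTop ℕ∞}
  {M : Type*} [TopologicalSpace M] [ChartedSpace E M]
  {G : Type*} [TopologicalSpace G] [ChartedSpace F G]
  {𝒢 : LieGroupoid E F r M G}

/-! ### Transitivity on the components of the source fibres -/

theorem FiberwiseTransitive.exists_isotopies {Γ : Subgroup 𝒢.Bisection}
    (hT : FiberwiseTransitive Γ) (y : M) {d : ℕ} (hd : 𝒢.fiberDim y = d) :
    ∃ σ : Fin d → ℝ → 𝒢.Bisection, (∀ j, IsIsotopyIn Γ (σ j)) ∧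
      LinearIndependent ℝ (fun j => velocity (σ j) y) := by
  subst hd; exact hT y

theorem src_eq_of_mem_fiberComponent {x : M} {g : G} (hg : g ∈ 𝒢.fiberComponent x) :
    𝒢.src g = x :=
  connectedComponentIn_subset (𝒢.src ⁻¹' {x}) (𝒢.unit x) hg

theorem unit_mem_fiberComponent (x : M) : 𝒢.unit x ∈ 𝒢.fiberComponent x :=
  mem_connectedComponentIn (𝒢.src_unit x)

/-- If arrows in the components of the units at `x` and `x'` have the same target, then `x'`
belongs to the leaf through `x`. -/
theorem mem_leaf_of_tgt_eq {x x' : M} {g h : G} (hg : g ∈ 𝒢.fiberComponent x)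
    (hh : h ∈ 𝒢.fiberComponent x') (hgh : 𝒢.tgt g = 𝒢.tgt h) : x' ∈ 𝒢.leaf x := by
  have hmul : ContinuousOn (fun p : G × G => 𝒢.mul p.1 p.2) {p | 𝒢.src p.1 = 𝒢.tgt p.2} :=
    𝒢.contMDiffOn_mul.continuousOn
  have hsrc : ∀ a ∈ 𝒢.fiberComponent x', 𝒢.src a = 𝒢.tgt (𝒢.inv h) := fun a ha => by
    rw [𝒢.tgt_inv, src_eq_of_mem_fiberComponent ha, src_eq_of_mem_fiberComponent hh]
  have hsrc' : ∀ a ∈ 𝒢.fiberComponent x', 𝒢.src (𝒢.mul a (𝒢.inv h)) = 𝒢.tgt g := fun a ha => by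
    rw [𝒢.src_mul _ _ (hsrc a ha), 𝒢.src_inv, hgh]
  have hc1 : ContinuousOn (fun a => 𝒢.mul a (𝒢.inv h)) (𝒢.fiberComponent x') :=
    hmul.comp (f := fun a : G => (a, 𝒢.inv h)) (by fun_prop) hsrc
  -- The translation a ↦ a.h⁻¹.g takes the fibre over `x'` to the fibre over `x` and preserves
  -- targets. It sends `h` to `g`, hence the component of the unit at `x'` into that of the unit at
  -- `x`.
  have hc2 : ContinuousOn (fun a => 𝒢.mul (𝒢.mul a (𝒢.inv h)) g) (𝒢.fiberComponent x') :=
    hmul.comp (f := fun a : G => (𝒢.mul a (𝒢.inv h), g)) (hc1.prodMk continuousOn_const) hsrc'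
  have hpre := isPreconnected_connectedComponentIn (x := 𝒢.unit x') (F := 𝒢.src ⁻¹' {x'})
  have hsub := (hpre.image _ hc2).subset_connectedComponentIn (x := g)
    ⟨h, hh, by
      beta_reduce
      rw [𝒢.mul_inv, ← hgh, 𝒢.unit_mul]⟩ (F := 𝒢.src ⁻¹' {x}) (by
        rintro _ ⟨a, ha, rfl⟩
        change 𝒢.src (𝒢.mul (𝒢.mul a (𝒢.inv h)) g) = x
        rw [𝒢.src_mul _ _ (hsrc' a ha), src_eq_of_mem_fiberComponent hg])
  rw [← connectedComponentIn_eq hg] at hsub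
  have hu := unit_mem_fiberComponent (𝒢 := 𝒢) x'
  refine ⟨_, hsub ⟨_, hu, rfl⟩, ?_⟩
  rw [𝒢.tgt_mul _ _ (hsrc' _ hu), 𝒢.tgt_mul _ _ (hsrc _ hu), 𝒢.tgt_unit]

section

variable [IsManifold 𝓘(ℝ, E) 1 M] [IsManifold 𝓘(ℝ, F) 1 G] [FiniteDimensional ℝ E]
  [FiniteDimensional ℝ F]

/-- Isotopies with independent velocities at a point give a fibre chart. -/
theorem exists_chart_of_isotopies (hr : 1 ≤ r) {Γ : Subgroup 𝒢.Bisection} {d : ℕ} {y : M}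
    (hd : 𝒢.fiberDim y = d) {σ : Fin d → ℝ → 𝒢.Bisection} (hσ : ∀ j, IsIsotopyIn Γ (σ j))
    (hli : LinearIndependent ℝ (fun j => velocity (σ j) y)) :
    ∃ (P : (Fin d → ℝ) → 𝒢.Bisection) (T : G → Fin d → ℝ) (O : Set (Fin d → ℝ)) (Ω : Set G),
      IsFamilyIn Γ P ∧ (∀ j s, P (Pi.single j s) = σ j s) ∧
      (∀ U : Set M, IsOpen U → ∀ z ∈ U, ∀ᶠ t in 𝓝 (0 : Fin d → ℝ), ∀ a : G, 𝒢.tgt a = z →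
        Relation.ReflTransGen (MoveIn σ U) a (act (P t) a)) ∧
      IsFiberChart y P T O Ω := by
  obtain ⟨P, hP, hPs, hPm⟩ := exists_family Γ σ hσ
  obtain ⟨T, O, Ω, hC⟩ := exists_isFiberChart hr hd hσ hli hP.smooth hP.zero hPs
  exact ⟨P, T, O, Ω, hP, hPs, hPm, hC⟩

theorem FiberwiseTransitive.exists_chart (hr : 1 ≤ r) {Γ : Subgroup 𝒢.Bisection}
    (hT : FiberwiseTransitive Γ) (y : M) {d : ℕ} (hd : 𝒢.fiberDim y = d) :
    ∃ (P : (Fin d → ℝ) → 𝒢.Bisection) (T : G → Fin d → ℝ) (O : Set (Fin d → ℝ)) (Ω : Set G),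
      IsFamilyIn Γ P ∧ IsFiberChart y P T O Ω := by
  obtain ⟨σ, hσ, hli⟩ := hT.exists_isotopies y hd
  obtain ⟨P, T, O, Ω, hP, -, -, hC⟩ := exists_chart_of_isotopies hr hd hσ hli
  exact ⟨P, T, O, Ω, hP, hC⟩

/-- A fiberwise transitive group acts transitively on the components of the units. -/
theorem FiberwiseTransitive.exists_act_eq (hr : 1 ≤ r) {Γ : Subgroup 𝒢.Bisection}
    (hT : FiberwiseTransitive Γ) {x : M} {g : G} (hg : g ∈ 𝒢.fiberComponent x) :
    ∃ σ ∈ Γ, σ x = g := by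
  have h : ∃ σ ∈ Γ, act σ (𝒢.unit x) = g := by
    refine (isPreconnected_connectedComponentIn (x := 𝒢.unit x)
      (F := 𝒢.src ⁻¹' {x})).induction₂ (fun a b => ∃ σ ∈ Γ, act σ a = b) ?_ ?_ ?_
      (unit_mem_fiberComponent x) hg
    -- Orbits are open in the fibre, by the translated chart; a connected component is then a single
    -- orbit.
    · intro a ha
      obtain ⟨P, T, O, Ω, hP, hC⟩ := hT.exists_chart hr (𝒢.tgt a) rfl
      have h1 := (hC.translate hP.zero rfl).2
      have ha' : 𝒢.src a = x := src_eq_of_mem_fiberComponent ha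
      rw [ha'] at h1
      filter_upwards [nhdsWithin_mono _ (connectedComponentIn_subset _ _) h1] with b hb
      exact ⟨_, hP.mem _, hb⟩
    · rintro a b c - - - ⟨σ, hσ, rfl⟩ ⟨τ, hτ, rfl⟩
      exact ⟨τ * σ, Γ.mul_mem hτ hσ, act_mul _ _ _⟩
    · rintro a b - - ⟨σ, hσ, rfl⟩
      exact ⟨σ⁻¹, Γ.inv_mem hσ, act_inv_act _ _⟩
  obtain ⟨σ, hσ, h⟩ := h
  exact ⟨σ, hσ, by rw [← act_unit, h]⟩

/-- The components of the units are open in the source fibres. -/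
theorem FiberwiseTransitive.fiberComponent_mem_nhdsWithin (hr : 1 ≤ r) {Γ : Subgroup 𝒢.Bisection}
    (hT : FiberwiseTransitive Γ) {x : M} {g : G} (hg : g ∈ 𝒢.fiberComponent x) :
    𝒢.fiberComponent x ∈ 𝓝[𝒢.src ⁻¹' {x}] g := by
  obtain ⟨P, T, O, Ω, hP, hC⟩ := hT.exists_chart hr (𝒢.tgt g) rfl
  have h1 := (hC.translate hP.zero rfl).2
  rw [src_eq_of_mem_fiberComponent hg] at h1
  have hc : Continuous (fun t => act (P t) g) :=
    hP.smooth.continuous_act.comp (Continuous.prodMk_left g)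
  -- The image of the full parameter space is connected and contains `g`, so it stays in the
  -- component.
  have h2 : range (fun t => act (P t) g) ⊆ 𝒢.fiberComponent x := by
    have h3 := (isPreconnected_range hc).subset_connectedComponentIn (x := g)
      ⟨0, by beta_reduce; rw [hP.zero, act_one]⟩ (F := 𝒢.src ⁻¹' {x}) (by
        rintro _ ⟨t, rfl⟩
        change 𝒢.src (act (P t) g) = x
        rw [src_act, src_eq_of_mem_fiberComponent hg])
    rwa [← connectedComponentIn_eq hg] at h3
  filter_upwards [h1] with h hh
  exact h2 ⟨_, hh⟩

end

/-! ### The dimension of the leaves -/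

/-- The velocity at `x`, in the chart at `x`, of the isotopy of the base. -/
def baseVelocity (ρ : ℝ → 𝒢.Bisection) (x : M) : E :=
  fderiv ℝ (fun s => extChartAt 𝓘(ℝ, E) x (𝒢.tgt (ρ s x))) 0 1

theorem IsFamilyIn.contDiffAt_tgt (hr : 1 ≤ r) {V : Type*} [NormedAddCommGroup V] [NormedSpace ℝ V]
    {Γ : Subgroup 𝒢.Bisection} {P : V → 𝒢.Bisection} (hP : IsFamilyIn Γ P) (x : M) :
    ContDiffAt ℝ 1 (fun v => extChartAt 𝓘(ℝ, E) x (𝒢.tgt (P v x))) 0 := by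
  refine ContMDiffAt.contDiffAt ?_
  have h1 : ContMDiff 𝓘(ℝ, V) 𝓘(ℝ, F) r (fun v => P v x) :=
    ContMDiff.comp hP.smooth (contMDiff_id.prodMk contMDiff_const)
  have h2 : ContMDiff 𝓘(ℝ, V) 𝓘(ℝ, E) 1 (fun v => 𝒢.tgt (P v x)) :=
    (𝒢.contMDiff_tgt.comp h1).of_le hr
  refine ContMDiffAt.comp (g := extChartAt 𝓘(ℝ, E) x) 0 ?_ h2.contMDiffAt
  have h0 : 𝒢.tgt (P 0 x) = x := by
    rw [hP.zero]; exact 𝒢.tgt_unit x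
  rw [h0]
  exact contMDiffAt_extChartAt

/-- The chain rule, for both structure maps: with α it shows that velocities are tangent to the
fibres, with β it gives the motion of the base point. -/
theorem mfderiv_velocity (hr : 1 ≤ r) {Γ : Subgroup 𝒢.Bisection} {ρ : ℝ → 𝒢.Bisection}
    (hρ : IsIsotopyIn Γ ρ) (x : M) {N : Type*} [TopologicalSpace N] [ChartedSpace E N]
    {f : G → N} (hf : ContMDiff 𝓘(ℝ, F) 𝓘(ℝ, E) r f) :
    (mfderiv 𝓘(ℝ, F) 𝓘(ℝ, E) f (𝒢.unit x) (velocity ρ x) : E) =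
      fderiv ℝ (fun s => extChartAt 𝓘(ℝ, E) (f (𝒢.unit x)) (f (ρ s x))) 0 1 := by
  have hd : MDifferentiableAt 𝓘(ℝ, ℝ) 𝓘(ℝ, F) (fun t : ℝ => ρ t x) 0 := by
    have h : ContMDiff 𝓘(ℝ, ℝ) 𝓘(ℝ, F) r (fun t : ℝ => ρ t x) :=
      hρ.contMDiff.comp (contMDiff_id.prodMk contMDiff_const)
    exact (h.of_le hr).mdifferentiable one_ne_zero 0
  have h0 : ρ 0 x = 𝒢.unit x := by rw [hρ.zero]; rfl
  have hfd : HasMFDerivAt 𝓘(ℝ, F) 𝓘(ℝ, E) f (ρ 0 x) (mfderiv 𝓘(ℝ, F) 𝓘(ℝ, E) f (ρ 0 x)) :=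
    ((hf.of_le hr).mdifferentiable one_ne_zero _).hasMFDerivAt
  have hcomp := HasMFDerivAt.comp (0 : ℝ) (f := fun t : ℝ => ρ t x) hfd hd.hasMFDerivAt
  have h1 := hcomp.2
  simp only [writtenInExtChartAt, Function.comp_apply] at h1
  simp only [mfld_simps] at h1
  let L : ℝ →L[ℝ] E := (mfderiv 𝓘(ℝ, F) 𝓘(ℝ, E) f (ρ 0 x)).comp
    (mfderiv 𝓘(ℝ, ℝ) 𝓘(ℝ, F) (fun t : ℝ => ρ t x) 0)
  have h2 : HasFDerivAt (fun s => extChartAt 𝓘(ℝ, E) (f (ρ 0 x)) (f (ρ s x))) L 0 :=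
    hasFDerivWithinAt_univ.1 h1
  rw [← h0, h2.fderiv]
  rfl

theorem velocity_mem_fiberTangent (hr : 1 ≤ r) {Γ : Subgroup 𝒢.Bisection} {ρ : ℝ → 𝒢.Bisection}
    (hρ : IsIsotopyIn Γ ρ) (x : M) : velocity ρ x ∈ 𝒢.fiberTangent x := by
  have h := mfderiv_velocity hr hρ x 𝒢.contMDiff_src
  simp only [(ρ _).src_apply] at h
  rw [fderiv_fun_const] at h
  exact h

theorem fiberTangent_eq_span [FiniteDimensional ℝ F] (hr : 1 ≤ r) {Γ : Subgroup 𝒢.Bisection}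
    {d : ℕ} {x : M} (hd : 𝒢.fiberDim x = d) {σ : Fin d → ℝ → 𝒢.Bisection}
    (hσ : ∀ j, IsIsotopyIn Γ (σ j)) (hli : LinearIndependent ℝ (fun j => velocity (σ j) x)) :
    𝒢.fiberTangent x = Submodule.span ℝ (range fun j => velocity (σ j) x) := by
  have : FiniteDimensional ℝ (TangentSpace 𝓘(ℝ, F) (𝒢.unit x)) :=
    inferInstanceAs (FiniteDimensional ℝ F)
  symm
  refine Submodule.eq_of_le_of_finrank_eq ?_ ?_
  · rw [Submodule.span_le]
    rintro _ ⟨j, rfl⟩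
    exact velocity_mem_fiberTangent hr (hσ j) x
  · rw [finrank_span_eq_card hli, Fintype.card_fin]
    exact hd.symm

/-- The derivative of the target map at the unit at `x`. -/
def tgtDeriv (𝒢 : LieGroupoid E F r M G) (x : M) : F →L[ℝ] E :=
  mfderiv 𝓘(ℝ, F) 𝓘(ℝ, E) 𝒢.tgt (𝒢.unit x)

/-- The tangent space at `x` to the leaf through `x`. -/
def leafTangent (𝒢 : LieGroupoid E F r M G) (x : M) : Submodule ℝ E :=
  Submodule.map (tgtDeriv 𝒢 x).toLinearMap (𝒢.fiberTangent x : Submodule ℝ F)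

theorem leafDim_eq_finrank (x : M) : 𝒢.leafDim x = Module.finrank ℝ (leafTangent 𝒢 x) := rfl

theorem tgtDeriv_velocity (hr : 1 ≤ r) {Γ : Subgroup 𝒢.Bisection} {ρ : ℝ → 𝒢.Bisection}
    (hρ : IsIsotopyIn Γ ρ) (x : M) :
    tgtDeriv 𝒢 x (velocity ρ x : F) = baseVelocity ρ x := by
  have h := mfderiv_velocity hr hρ x 𝒢.contMDiff_tgt
  rw [𝒢.tgt_unit] at h
  exact h

theorem baseVelocity_mem_leafTangent (hr : 1 ≤ r) {Γ : Subgroup 𝒢.Bisection}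
    {ρ : ℝ → 𝒢.Bisection} (hρ : IsIsotopyIn Γ ρ) (x : M) :
    baseVelocity ρ x ∈ leafTangent 𝒢 x :=
  ⟨velocity ρ x, velocity_mem_fiberTangent hr hρ x, tgtDeriv_velocity hr hρ x⟩

/-- Describes the tangent space of the leaf by motions of the base alone, a form that can be
transported by diffeomorphisms. -/
theorem leafTangent_eq_span [FiniteDimensional ℝ F] (hr : 1 ≤ r) {Γ : Subgroup 𝒢.Bisection}
    {d : ℕ} {x : M} (hd : 𝒢.fiberDim x = d) {σ : Fin d → ℝ → 𝒢.Bisection}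
    (hσ : ∀ j, IsIsotopyIn Γ (σ j)) (hli : LinearIndependent ℝ (fun j => velocity (σ j) x)) :
    leafTangent 𝒢 x = Submodule.span ℝ (range fun j => baseVelocity (σ j) x) := by
  have h1 : leafTangent 𝒢 x = Submodule.map (tgtDeriv 𝒢 x).toLinearMap
      (Submodule.span ℝ (range fun j => (velocity (σ j) x : F))) :=
    congrArg (fun K : Submodule ℝ F => Submodule.map (tgtDeriv 𝒢 x).toLinearMap K)
      (fiberTangent_eq_span hr hd hσ hli)
  have h2 : ∀ v : Fin d → F, (∀ j, tgtDeriv 𝒢 x (v j) = baseVelocity (σ j) x) →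
      Submodule.map (tgtDeriv 𝒢 x).toLinearMap (Submodule.span ℝ (range v)) =
        Submodule.span ℝ (range fun j => baseVelocity (σ j) x) := by
    intro v hv
    rw [Submodule.map_span, ← range_comp]
    congr 2
    ext1 j
    exact hv j
  rw [h1]
  exact h2 _ fun j => tgtDeriv_velocity hr (hσ j) x

theorem Bisection.tgt_mul_apply (σ τ : 𝒢.Bisection) (z : M) :
    𝒢.tgt ((σ * τ) z) = 𝒢.tgt (σ (𝒢.tgt (τ z))) :=
  𝒢.tgt_mul _ _ (σ.src_apply _)

theorem Bisection.tgt_inv_apply (σ : 𝒢.Bisection) (z : M) :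
    𝒢.tgt (σ⁻¹ z) = σ.diffeo.symm z := by
  rw [Bisection.inv_apply, 𝒢.tgt_inv, σ.src_apply]

/-- The dimensions of the leaves do not decrease along the orbits of a fiberwise transitive
group. -/
theorem FiberwiseTransitive.leafDim_le [FiniteDimensional ℝ E] [FiniteDimensional ℝ F] (hr : 1 ≤ r)
    {Γ : Subgroup 𝒢.Bisection} (hT : FiberwiseTransitive Γ) {σ : 𝒢.Bisection} (hσ : σ ∈ Γ)
    (x : M) : 𝒢.leafDim x ≤ 𝒢.leafDim (𝒢.tgt (σ x)) := by
  obtain ⟨ρ, hρ, hli⟩ := hT x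
  rw [← σ.diffeo_apply]
  have hr0 : r ≠ 0 := (zero_lt_one.trans_le hr).ne'
  let e : E ≃L[ℝ] E := σ.diffeo.mfderivToContinuousLinearEquiv hr0 x
  -- The diffeomorphism β ∘ σ carries the base motion of an isotopy to that of its conjugate by σ,
  -- so its derivative maps one leaf tangent space into the other.
  have hle : (leafTangent 𝒢 x).map e.toLinearEquiv.toLinearMap ≤ leafTangent 𝒢 (σ.diffeo x) := by
    rw [leafTangent_eq_span hr rfl hρ hli, Submodule.map_span, Submodule.span_le]
    rintro _ ⟨_, ⟨j, rfl⟩, rfl⟩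
    have h1 := baseVelocity_mem_leafTangent hr ((hρ j).conj hσ) (σ.diffeo x)
    have h2 : baseVelocity (fun s => σ * ρ j s * σ⁻¹) (σ.diffeo x) =
        e (baseVelocity (ρ j) x) := by
      have h3 := mfderiv_velocity hr (hρ j) x (σ.diffeo.contMDiff.comp 𝒢.contMDiff_tgt)
      rw [mfderiv_comp (𝒢.unit x) ((σ.diffeo.contMDiff.of_le hr).mdifferentiable one_ne_zero _)
          ((𝒢.contMDiff_tgt.of_le hr).mdifferentiable one_ne_zero _)] at h3
      have h4 : ∀ w : E, mfderiv 𝓘(ℝ, E) 𝓘(ℝ, E) σ.diffeo (𝒢.tgt (𝒢.unit x)) w = e w := by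
        intro w
        rw [𝒢.tgt_unit]
        rfl
      have h5 : ∀ s, 𝒢.tgt ((σ * ρ j s * σ⁻¹) (σ.diffeo x)) = σ.diffeo (𝒢.tgt (ρ j s x)) := by
        intro s
        rw [Bisection.tgt_mul_apply, Bisection.tgt_mul_apply, Bisection.tgt_inv_apply,
          Diffeomorph.symm_apply_apply, σ.diffeo_apply]
      have h6 := (h4 (tgtDeriv 𝒢 x (velocity (ρ j) x : F))).symm.trans h3
      rw [tgtDeriv_velocity hr (hρ j)] at h6
      rw [h6, baseVelocity]
      simp only [h5, Function.comp_apply, 𝒢.tgt_unit]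
    rw [h2] at h1
    exact h1
  rw [leafDim_eq_finrank, leafDim_eq_finrank]
  calc Module.finrank ℝ (leafTangent 𝒢 x)
      = Module.finrank ℝ ((leafTangent 𝒢 x).map e.toLinearEquiv.toLinearMap) :=
        (LinearEquiv.finrank_eq (Submodule.equivMapOfInjective e.toLinearEquiv.toLinearMap
          e.injective _))
    _ ≤ _ := Submodule.finrank_mono hle

end LieGroupoid

namespace LieGroupoid

variable {E F : Type*} [NormedAddCommGroup E] [NormedSpace ℝ E]
  [NormedAddCommGroup F] [NormedSpace ℝ F] {r : WithTop ℕ∞}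
  {M : Type*} [TopologicalSpace M] [ChartedSpace E M]
  {G : Type*} [TopologicalSpace G] [ChartedSpace F G]
  {𝒢 : LieGroupoid E F r M G}

/-! ### Connectedness of the space of tuples with distinct targets -/

section

variable {n : ℕ}

/-- The tuples in the components of the units at `x` whose targets are distinct for the pairs of
indices in `S`. -/
def spreadTuples (𝒢 : LieGroupoid E F r M G) (x : Fin n → M) (S : Finset (Fin n × Fin n)) :
    Set (Fin n → G) :=
  {g | (∀ i, g i ∈ 𝒢.fiberComponent (x i)) ∧ ∀ p ∈ S, 𝒢.tgt (g p.1) ≠ 𝒢.tgt (g p.2)}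

theorem spreadTuples_subset_fiberTuples (x : Fin n → M) (S : Finset (Fin n × Fin n)) :
    spreadTuples 𝒢 x S ⊆ fiberTuples 𝒢 x :=
  fun _ hg i => src_eq_of_mem_fiberComponent (hg.1 i)

theorem arrowTuples_eq_spreadTuples (x : Fin n → M) :
    𝒢.arrowTuples x = spreadTuples 𝒢 x Finset.univ.offDiag := by
  ext g
  refine and_congr_right fun _ => ⟨fun h p hp => h _ _ (by simpa using hp), fun h i l hil => ?_⟩
  exact h (i, l) (by simpa using hil)

variable [IsManifold 𝓘(ℝ, E) 1 M] [IsManifold 𝓘(ℝ, F) 1 G] [FiniteDimensional ℝ E]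
  [FiniteDimensional ℝ F]

/-- The axes of the chart are isotopies whose base velocities span the tangent space of the leaf.
This is what makes the dimension of the leaf available in chart coordinates. -/
theorem FiberwiseTransitive.exists_chart_leafTangent (hr : 1 ≤ r) {Γ : Subgroup 𝒢.Bisection}
    (hT : FiberwiseTransitive Γ) (y : M) {d : ℕ} (hd : 𝒢.fiberDim y = d) :
    ∃ (P : (Fin d → ℝ) → 𝒢.Bisection) (T : G → Fin d → ℝ) (O : Set (Fin d → ℝ)) (Ω : Set G),
      IsFamilyIn Γ P ∧ IsFiberChart y P T O Ω ∧ leafTangent 𝒢 y ≤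
        (fderiv ℝ (fun t => extChartAt 𝓘(ℝ, E) y (𝒢.tgt (P t y))) 0).toLinearMap.range := by
  obtain ⟨σ, hσ, hli⟩ := hT.exists_isotopies y hd
  obtain ⟨P, T, O, Ω, hP, hPs, -, hC⟩ := exists_chart_of_isotopies hr hd hσ hli
  refine ⟨P, T, O, Ω, hP, hC, ?_⟩
  rw [leafTangent_eq_span hr hd hσ hli, Submodule.span_le]
  rintro _ ⟨j, rfl⟩
  refine ⟨Pi.single j 1, ?_⟩
  have h1 : HasDerivAt (fun s : ℝ => (Pi.single j s : Fin d → ℝ)) (Pi.single j 1) 0 :=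
    ((ContinuousLinearMap.single ℝ (fun _ => ℝ) j).hasFDerivAt (x := (0 : ℝ))).hasDerivAt
  have h2 := HasFDerivAt.comp_hasDerivAt (l := fun t => extChartAt 𝓘(ℝ, E) y (𝒢.tgt (P t y)))
    (l' := fderiv ℝ (fun t => extChartAt 𝓘(ℝ, E) y (𝒢.tgt (P t y))) 0) 0 (by
      rw [Pi.single_zero]
      exact ((hP.contDiffAt_tgt hr y).differentiableAt one_ne_zero).hasFDerivAt) h1
  have h3 : (fun t => extChartAt 𝓘(ℝ, E) y (𝒢.tgt (P t y))) ∘ (fun s : ℝ => Pi.single j s) =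
      fun s => extChartAt 𝓘(ℝ, E) y (𝒢.tgt (σ j s y)) := by
    ext s; simp only [Function.comp_apply, hPs]
  rw [h3] at h2
  change fderiv ℝ (fun t => extChartAt 𝓘(ℝ, E) y (𝒢.tgt (P t y))) 0 (Pi.single j 1) =
    fderiv ℝ (fun s => extChartAt 𝓘(ℝ, E) y (𝒢.tgt (σ j s y))) 0 1
  rw [h2.hasFDerivAt.fderiv]
  simp

/-- Local structure of the space of tuples around a tuple. -/
theorem FiberwiseTransitive.exists_tuple_chart (hr : 1 ≤ r) {Γ : Subgroup 𝒢.Bisection}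
    (hT : FiberwiseTransitive Γ) {x : Fin n → M} {g : Fin n → G} (hg : g ∈ fiberTuples 𝒢 x) :
    ∃ (d : ℕ) (P : Fin n → (Fin d → ℝ) → 𝒢.Bisection), (∀ i, IsFamilyIn Γ (P i)) ∧
      (∀ i, leafTangent 𝒢 (𝒢.tgt (g i)) ≤ (fderiv ℝ (fun t => extChartAt 𝓘(ℝ, E) (𝒢.tgt (g i))
        (𝒢.tgt (P i t (𝒢.tgt (g i))))) 0).toLinearMap.range) ∧
      Continuous (fun (p : Fin n → Fin d → ℝ) i => act (P i (p i)) (g i)) ∧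
      Filter.map (fun (p : Fin n → Fin d → ℝ) i => act (P i (p i)) (g i)) (𝓝 0) =
        𝓝[fiberTuples 𝒢 x] g := by
  have hd : ∀ y, 𝒢.fiberDim y = Module.finrank ℝ F - Module.finrank ℝ E := fun y => by
    have := finrank_add_fiberDim 𝒢 y; omega
  choose P T O Ω hP hC hl using fun i => hT.exists_chart_leafTangent hr (𝒢.tgt (g i)) (hd _)
  refine ⟨_, P, hP, hl, ?_, map_tuple_chart hg hC (fun i => (hP i).smooth) fun i => (hP i).zero⟩
  refine continuous_pi fun i => (hP i).smooth.continuous_act.comp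
    (f := fun p : Fin n → Fin (Module.finrank ℝ F - Module.finrank ℝ E) → ℝ => (p i, g i)) ?_
  fun_prop

variable [T2Space M]

/-- Components of units are open in the source fibres, and distinctness of targets is an open
condition. -/
theorem FiberwiseTransitive.spreadTuples_mem_nhdsWithin (hr : 1 ≤ r) {Γ : Subgroup 𝒢.Bisection}
    (hT : FiberwiseTransitive Γ) {x : Fin n → M} {S : Finset (Fin n × Fin n)} {g : Fin n → G}
    (hg : g ∈ spreadTuples 𝒢 x S) : spreadTuples 𝒢 x S ∈ 𝓝[fiberTuples 𝒢 x] g := by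
  have hproj : ∀ i, Filter.Tendsto (fun h : Fin n → G => h i) (𝓝[fiberTuples 𝒢 x] g)
      (𝓝[𝒢.src ⁻¹' {x i}] (g i)) := fun i =>
    tendsto_nhdsWithin_iff.2 ⟨((continuous_apply i).tendsto g).mono_left nhdsWithin_le_nhds, by
      filter_upwards [self_mem_nhdsWithin] with h hh using hh i⟩
  have h1 : ∀ᶠ h in 𝓝[fiberTuples 𝒢 x] g, ∀ i, h i ∈ 𝒢.fiberComponent (x i) :=
    Filter.eventually_all.2 fun i =>
      (hproj i).eventually (hT.fiberComponent_mem_nhdsWithin hr (hg.1 i))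
  have h2 : ∀ᶠ h in 𝓝[fiberTuples 𝒢 x] g, ∀ p ∈ S, 𝒢.tgt (h p.1) ≠ 𝒢.tgt (h p.2) := by
    refine (Filter.eventually_all_finset S).2 fun p hp => ?_
    have hc : ∀ i, Continuous (fun h : Fin n → G => 𝒢.tgt (h i)) := fun i =>
      𝒢.contMDiff_tgt.continuous.comp (continuous_apply i)
    exact nhdsWithin_le_nhds ((isOpen_ne_fun (hc p.1) (hc p.2)).mem_nhds (hg.2 p hp))
  exact h1.and h2

/-- Induction on the set of pairs: without conditions the space is a product of connected
components, and the collisions of one further pair are removed at a time. Each removal is harmless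
because a collision forces a leaf of dimension at least two. -/
theorem FiberwiseTransitive.isPreconnected_spreadTuples (hr : 1 ≤ r) {Γ : Subgroup 𝒢.Bisection}
    (hT : FiberwiseTransitive Γ) {x : Fin n → M}
    (hdim : ∀ i, 2 ≤ 𝒢.leafDim (x i) ∨ ∀ j, j ≠ i → x j ∉ 𝒢.leaf (x i))
    {S : Finset (Fin n × Fin n)} (hS : S ⊆ Finset.univ.offDiag) :
    IsPreconnected (spreadTuples 𝒢 x S) := by
  classical
  induction S using Finset.induction_on with
  | empty =>
    have h1 : spreadTuples 𝒢 x ∅ = univ.pi fun i => 𝒢.fiberComponent (x i) := by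
      ext g; simp [spreadTuples]
    rw [h1]
    exact isPreconnected_univ_pi fun i => isPreconnected_connectedComponentIn
  | insert p S hpS ih =>
    obtain ⟨i, l⟩ := p
    have hA := ih ((Finset.subset_insert _ _).trans hS)
    have hil : i ≠ l := by simpa using hS (Finset.mem_insert_self _ _)
    set A := spreadTuples 𝒢 x S with hAdef
    set Z : Set (Fin n → G) := {g | 𝒢.tgt (g i) = 𝒢.tgt (g l)} with hZ
    have hAZ : spreadTuples 𝒢 x (insert (i, l) S) = A \ Z := by
      ext g
      simp only [spreadTuples, Finset.forall_mem_insert, hAdef, hZ, mem_sdiff, mem_ofPred_eq]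
      tauto
    have hZc : IsClosed Z :=
      isClosed_eq (𝒢.contMDiff_tgt.continuous.comp (continuous_apply i))
        (𝒢.contMDiff_tgt.continuous.comp (continuous_apply l))
    rw [hAZ]
    have hlocal : ∀ g ∈ A, (∃ U ∈ 𝓝[A] g, U ⊆ A ∧ IsPreconnected (U \ Z)) ∧
        g ∈ closure (A \ Z) := by
      intro g hg
      obtain ⟨d, P, hP, hl, hec, hmap⟩ :=
        hT.exists_tuple_chart hr (spreadTuples_subset_fiberTuples x S hg)
      set e := fun (p : Fin n → Fin d → ℝ) i => act (P i (p i)) (g i) with he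
      have he0 : e 0 = g := by
        ext1 k
        simp only [he, Pi.zero_apply, (hP k).zero, act_one]
      have hAm := hT.spreadTuples_mem_nhdsWithin hr hg
      have heA : e ⁻¹' A ∈ 𝓝 0 := by rw [← Filter.mem_map, hmap]; exact hAm
      have hU : ∀ U₀ ∈ 𝓝 (0 : Fin n → Fin d → ℝ), e '' U₀ ∈ 𝓝[A] g := by
        intro U₀ hU₀
        have h1 := Filter.image_mem_map (m := e) hU₀
        rw [hmap] at h1
        exact nhdsWithin_mono _ (spreadTuples_subset_fiberTuples x S) h1
      by_cases hgZ : g ∈ Z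
      · -- a collision
        set y := 𝒢.tgt (g i) with hy
        have hyl : 𝒢.tgt (g l) = y := hgZ.symm
        -- The collision puts `x l` on the leaf of `x i`, which excludes the second alternative of
        -- `hdim`. The dimension does not drop on passing from `x i` to `y` along the orbit.
        have h2 : 2 ≤ 𝒢.leafDim y := by
          have h3 : x l ∈ 𝒢.leaf (x i) := mem_leaf_of_tgt_eq (hg.1 i) (hg.1 l) hgZ
          have h4 : 2 ≤ 𝒢.leafDim (x i) := (hdim i).resolve_right fun h => h l hil.symm h3
          obtain ⟨σ, hσ, hσx⟩ := hT.exists_act_eq hr (hg.1 i)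
          have h5 := hT.leafDim_le hr hσ (x i)
          rw [hσx] at h5
          exact h4.trans h5
        let b : Fin n → (Fin d → ℝ) → E := fun k t => extChartAt 𝓘(ℝ, E) y (𝒢.tgt (P k t y))
        have hb : ∀ k, HasStrictFDerivAt (b k) (fderiv ℝ (b k) 0) 0 := fun k =>
          ((hP k).contDiffAt_tgt hr y).hasStrictFDerivAt one_ne_zero
        let prj : Fin n → (Fin n → Fin d → ℝ) →L[ℝ] (Fin d → ℝ) := fun k =>
          ContinuousLinearMap.proj k
        -- Derivative of the difference of the two targets. Moving the `i`-th component alone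
        -- already yields all directions of the leaf.
        let D : (Fin n → Fin d → ℝ) →L[ℝ] E :=
          (fderiv ℝ (b i) 0).comp (prj i) - (fderiv ℝ (b l) 0).comp (prj l)
        have hD : HasStrictFDerivAt (fun t : Fin n → Fin d → ℝ => b i (t i) - b l (t l)) D 0 :=
          (HasStrictFDerivAt.comp (g := b i) (f := prj i) 0 (hb i) (prj i).hasStrictFDerivAt).sub
            (HasStrictFDerivAt.comp (g := b l) (f := prj l) 0 (hb l) (prj l).hasStrictFDerivAt)
        have hrange : leafTangent 𝒢 y ≤ D.toLinearMap.range := by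
          refine (hl i).trans ?_
          rintro _ ⟨v, rfl⟩
          refine ⟨Pi.single i v, ?_⟩
          change fderiv ℝ (b i) 0 ((Pi.single i v : Fin n → Fin d → ℝ) i) -
            fderiv ℝ (b l) 0 ((Pi.single i v : Fin n → Fin d → ℝ) l) = fderiv ℝ (b i) 0 v
          rw [Pi.single_eq_same, Pi.single_eq_of_ne hil.symm, map_zero, sub_zero]
        -- `D` need not map onto `E`. Projecting the difference to the range of `D` makes it a
        -- submersion, at the price that its zeros only contain the collisions.
        obtain ⟨π₀, hπ₀⟩ := LinearMap.exists_leftInverse_of_injective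
          D.toLinearMap.range.subtype (Submodule.ker_subtype _)
        let π : E →L[ℝ] D.toLinearMap.range := LinearMap.toContinuousLinearMap π₀
        have hπ : ∀ w : D.toLinearMap.range, π w = w := fun w => DFunLike.congr_fun hπ₀ w
        have hf : HasStrictFDerivAt (fun t : Fin n → Fin d → ℝ => π (b i (t i) - b l (t l)))
            (π.comp D) 0 := π.hasStrictFDerivAt.comp 0 hD
        have hsurj : (π.comp D).toLinearMap.range = ⊤ := by
          rw [LinearMap.range_eq_top]
          rintro ⟨w, v, hv⟩
          refine ⟨v, ?_⟩
          change π (D.toLinearMap v) = _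
          simp only [hv]
          exact hπ ⟨w, v, hv⟩
        have htgt : ∀ t k, 𝒢.tgt (g k) = y → 𝒢.tgt (e t k) = 𝒢.tgt (P k (t k) y) := by
          intro t k hk
          simp only [he, tgt_act, hk]
        have hCf : ∀ t, e t ∈ Z → π (b i (t i) - b l (t l)) = 0 := by
          intro t ht
          have h6 : 𝒢.tgt (e t i) = 𝒢.tgt (e t l) := ht
          rw [htgt t i rfl, htgt t l hyl] at h6
          simp only [b, h6, sub_self, map_zero]
        have h0Z : e 0 ∈ Z := by rw [he0]; exact hgZ
        have hrank : 1 < Module.rank ℝ D.toLinearMap.range := by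
          have : FiniteDimensional ℝ D.toLinearMap.range :=
            FiniteDimensional.finiteDimensional_submodule _
          rw [← Module.finrank_eq_rank]
          have h7 : 1 < Module.finrank ℝ D.toLinearMap.range :=
            (leafDim_eq_finrank (𝒢 := 𝒢) y ▸ h2).trans (Submodule.finrank_mono hrange)
          exact_mod_cast h7
        obtain ⟨U₀, hU₀A, hU₀o, h0U₀, hU₀p, hU₀c⟩ :=
          exists_isPreconnected_diff_zeros hf hsurj (hCf 0 h0Z) hrank heA
        set f := fun t : Fin n → Fin d → ℝ => π (b i (t i) - b l (t l))
        -- Removing all zeros leaves a connected dense set; removing only the collisions leaves a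
        -- set between this one and its closure, hence a connected one.
        have hsub : U₀ \ f ⁻¹' {0} ⊆ U₀ \ e ⁻¹' Z := fun t ht => ⟨ht.1, fun h => ht.2 (hCf t h)⟩
        refine ⟨⟨e '' U₀, hU _ (hU₀o.mem_nhds h0U₀), image_subset_iff.2 hU₀A, ?_⟩, ?_⟩
        · rw [← image_sdiff_preimage]
          refine IsPreconnected.image ?_ _ hec.continuousOn
          exact hU₀p.subset_closure hsub (sdiff_subset.trans hU₀c)
        · rw [← he0]
          refine closure_mono ?_ (hec.continuousAt.continuousWithinAt.mem_closure_image
            (hU₀c h0U₀))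
          rintro _ ⟨t, ht, rfl⟩
          exact ⟨hU₀A ht.1, (hsub ht).2⟩
      · have h1 : e ⁻¹' (A \ Z) ∈ 𝓝 0 := by
          refine Filter.inter_mem heA ?_
          refine hec.continuousAt.preimage_mem_nhds (t := Zᶜ) ?_
          rw [he0]
          exact hZc.isOpen_compl.mem_nhds hgZ
        obtain ⟨ε, hε, hb⟩ := Metric.mem_nhds_iff.1 h1
        refine ⟨⟨e '' Metric.ball 0 ε, hU _ (Metric.ball_mem_nhds _ hε), ?_, ?_⟩,
          subset_closure ⟨hg, hgZ⟩⟩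
        · exact (image_subset_iff.2 hb).trans sdiff_subset
        · have h3 : e '' Metric.ball 0 ε \ Z = e '' Metric.ball 0 ε := by
            refine sdiff_eq_left.2 (Set.disjoint_left.2 ?_)
            rintro _ ⟨t, ht, rfl⟩
            exact (hb ht).2
          rw [h3]
          exact (convex_ball _ _).isPreconnected.image _ hec.continuousOn
    exact isPreconnected_diff_of_locally hA (fun g hg => (hlocal g hg).1)
      fun g hg => (hlocal g hg).2

/-- Tuples with distinct targets are joined by paths of such tuples. -/
theorem FiberwiseTransitive.joinedIn_arrowTuples (hr : 1 ≤ r) {Γ : Subgroup 𝒢.Bisection}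
    (hT : FiberwiseTransitive Γ) {x : Fin n → M}
    (hdim : ∀ i, 2 ≤ 𝒢.leafDim (x i) ∨ ∀ j, j ≠ i → x j ∉ 𝒢.leaf (x i))
    {g h : Fin n → G} (hg : g ∈ 𝒢.arrowTuples x) (hh : h ∈ 𝒢.arrowTuples x) :
    JoinedIn (𝒢.arrowTuples x) g h := by
  rw [arrowTuples_eq_spreadTuples] at *
  refine joinedIn_of_locally (hT.isPreconnected_spreadTuples hr hdim subset_rfl) ?_ hg hh
  intro g hg
  obtain ⟨d, P, hP, -, hec, hmap⟩ :=
    hT.exists_tuple_chart hr (spreadTuples_subset_fiberTuples x _ hg)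
  set e := fun (p : Fin n → Fin d → ℝ) i => act (P i (p i)) (g i) with he
  have he0 : e 0 = g := by
    ext1 k
    simp only [he, Pi.zero_apply, (hP k).zero, act_one]
  have hAm := hT.spreadTuples_mem_nhdsWithin hr hg
  rw [← hmap] at hAm
  obtain ⟨ε, hε, hb⟩ := Metric.mem_nhds_iff.1 (Filter.mem_map.1 hAm)
  have h1 := Filter.image_mem_map (m := e) (Metric.ball_mem_nhds (0 : Fin n → Fin d → ℝ) hε)
  rw [hmap] at h1
  filter_upwards [nhdsWithin_mono _ (spreadTuples_subset_fiberTuples x _) h1]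
  rintro _ ⟨t, ht, rfl⟩
  have h2 := ((convex_ball (0 : Fin n → Fin d → ℝ) ε).isPathConnected
    ⟨0, Metric.mem_ball_self hε⟩).image' hec.continuousOn
  rw [← he0]
  exact (h2.joinedIn _ ⟨0, Metric.mem_ball_self hε, rfl⟩ _ ⟨t, ht, rfl⟩).mono
    (image_subset_iff.2 hb)

end

end LieGroupoid

namespace LieGroupoid

variable {E F : Type*} [NormedAddCommGroup E] [NormedSpace ℝ E]
  [NormedAddCommGroup F] [NormedSpace ℝ F] {r : WithTop ℕ∞}
  {M : Type*} [TopologicalSpace M] [ChartedSpace E M]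
  {G : Type*} [TopologicalSpace G] [ChartedSpace F G]
  {𝒢 : LieGroupoid E F r M G}

/-! ### From approximate to exact transitivity on tuples of arrows -/

section Steering

variable {n : ℕ}

/-- The tuple of arrows obtained from the units at `z` by moving only the `i`-th one, by `σ`. -/
def singleMove (σ : 𝒢.Bisection) (i : Fin n) (z : Fin n → M) : Fin n → G :=
  Function.update (fun l => 𝒢.unit (z l)) i (σ (z i))

/-- The isotopies in `Γ` can approximately move the `i`-th point of the tuple `z` along the isotopy
`ρ`, keeping the other points, up to a member of any set in the filter `𝓕`. -/
def Follows (Γ : Subgroup 𝒢.Bisection) (𝓕 : Filter 𝒢.Bisection) (ρ : ℝ → 𝒢.Bisection) (i : Fin n)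
    (z : Fin n → M) : Prop :=
  ∀ t : ℝ, ∀ B ∈ 𝓕, ∀ A N : Fin n → Set G, (∀ l, IsOpen (A l)) → (∀ l, IsOpen (N l)) →
    (∀ s ∈ uIcc 0 t, ∀ l, singleMove (ρ s) i z l ∈ A l) → (∀ l, singleMove (ρ t) i z l ∈ N l) →
    ∃ τ : ℝ → 𝒢.Bisection, IsIsotopyIn Γ τ ∧ τ t ∈ B ∧ (∀ s ∈ uIcc 0 t, ∀ l, τ s (z l) ∈ A l) ∧
      ∀ l, τ t (z l) ∈ N l

/-- Near the tuple `y`, the group `Γ'` follows isotopies in `Γ` with independent velocities. -/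
def LocallyFollows (Γ Γ' : Subgroup 𝒢.Bisection) (𝓕 : Filter 𝒢.Bisection) (y : Fin n → M) : Prop :=
  ∃ (d : ℕ) (ρ : Fin n → Fin d → ℝ → 𝒢.Bisection) (U : Fin n → Set M),
    (∀ i, 𝒢.fiberDim (y i) = d) ∧ (∀ i j, IsIsotopyIn Γ (ρ i j)) ∧
    (∀ i, LinearIndependent ℝ (fun j => velocity (ρ i j) (y i))) ∧ (∀ i, IsOpen (U i)) ∧
    (∀ i, y i ∈ U i) ∧ ∀ z : Fin n → M, (∀ i, z i ∈ U i) → ∀ i j, Follows Γ' 𝓕 (ρ i j) i z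

/-- The tuples of arrows that members of `Γ` in the sets of the filter `𝓕` nearly reach from the
units at `x`. -/
def reachable (Γ : Subgroup 𝒢.Bisection) (𝓕 : Filter 𝒢.Bisection) (x : Fin n → M) :
    Set (Fin n → G) :=
  ⋂ B ∈ 𝓕, closure ((fun σ : 𝒢.Bisection => tact σ fun i => 𝒢.unit (x i)) '' {σ | σ ∈ Γ ∧ σ ∈ B})

variable {Γ Γ' : Subgroup 𝒢.Bisection} {𝓕 : Filter 𝒢.Bisection} {x : Fin n → M}

theorem isClosed_reachable : IsClosed (reachable Γ 𝓕 x) :=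
  isClosed_biInter fun _ _ => isClosed_closure

theorem unit_mem_reachable (h1 : pure 1 ≤ 𝓕) : (fun i => 𝒢.unit (x i)) ∈ reachable Γ 𝓕 x :=
  mem_iInter₂.2 fun _ hB => subset_closure ⟨1, ⟨Γ.one_mem, h1 hB⟩, tact_one _⟩

/-- Right multiplication by `h` turns motions of the units at the targets of `h` into motions of
`h`. By continuity of `act`, first nearly reaching `h` and then approximating the move nearly
reaches the moved tuple; `hmul` keeps the product under control. -/
theorem Follows.update_mem_reachable
    (hmul : Filter.Tendsto (fun p : 𝒢.Bisection × 𝒢.Bisection => p.1 * p.2) (𝓕 ×ˢ 𝓕) 𝓕)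
    {ρ : ℝ → 𝒢.Bisection} {i : Fin n} {h : Fin n → G}
    (hf : Follows Γ 𝓕 ρ i fun l => 𝒢.tgt (h l)) (hh : h ∈ reachable Γ 𝓕 x) (t : ℝ) :
    Function.update h i (act (ρ t) (h i)) ∈ reachable Γ 𝓕 x := by
  refine mem_iInter₂.2 fun B hB => mem_closure_iff.2 fun N hNo hN => ?_
  obtain ⟨B₁, hB₁, B₂, hB₂, hB₁₂⟩ := Filter.mem_prod_iff.1 (hmul hB)
  set z : Fin n → M := fun l => 𝒢.tgt (h l) with hz
  let f : (Fin n → G) → Fin n → G := fun g l => 𝒢.mul (g l) (h l)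
  have hfc : ContinuousOn f (fiberTuples 𝒢 z) := continuousOn_pi.2 fun l =>
    𝒢.contMDiffOn_mul.continuousOn.comp (f := fun g : Fin n → G => (g l, h l)) (by fun_prop)
      fun g hg => hg l
  have hmem : singleMove (ρ t) i z ∈ fiberTuples 𝒢 z := by
    intro l
    rcases eq_or_ne l i with rfl | hl
    · rw [singleMove, Function.update_self, (ρ t).src_apply]
    · rw [singleMove, Function.update_of_ne hl, 𝒢.src_unit]
  have hfz : f (singleMove (ρ t) i z) = Function.update h i (act (ρ t) (h i)) := by
    ext1 l
    rcases eq_or_ne l i with rfl | hl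
    · simp only [f, singleMove, Function.update_self]; rfl
    · simp only [f, singleMove, Function.update_of_ne hl, hz, 𝒢.unit_mul]
  obtain ⟨O, hO, hzO, hON⟩ := mem_nhdsWithin.1
    ((hfc _ hmem).preimage_mem_nhdsWithin (hfz.symm ▸ hNo.mem_nhds hN))
  obtain ⟨u, hu, huO⟩ := isOpen_pi_iff'.1 hO _ hzO
  obtain ⟨τ, hτ, hτB, -, hτu⟩ := hf t B₁ hB₁ (fun _ => univ) u (fun _ => isOpen_univ)
    (fun l => (hu l).1) (fun _ _ _ => mem_univ _) fun l => (hu l).2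
  have hτh : tact (τ t) h ∈ N :=
    hON ⟨huO (a := fun l => τ t (z l)) fun l _ => hτu l, fun l => (τ t).src_apply _⟩
  obtain ⟨_, hσN, σ, ⟨hσ, hσB⟩, rfl⟩ := mem_closure_iff_nhds.1 (mem_iInter₂.1 hh B₂ hB₂) _
    ((continuous_tact (τ t)).continuousAt.preimage_mem_nhds (x := h)
      (hNo.mem_nhds hτh))
  exact ⟨_, hσN, τ t * σ, ⟨Γ.mul_mem (hτ.mem t) hσ, hB₁₂ (mk_mem_prod hτB hσB)⟩,
    tact_mul _ _ _⟩

variable [IsManifold 𝓘(ℝ, E) 1 M] [IsManifold 𝓘(ℝ, F) 1 G] [FiniteDimensional ℝ E]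
  [FiniteDimensional ℝ F]

theorem LocallyFollows.exists_chart (hr : 1 ≤ r) {g : Fin n → G}
    (hf : LocallyFollows Γ Γ' 𝓕 fun i => 𝒢.tgt (g i)) (hg : g ∈ fiberTuples 𝒢 x) :
    ∃ (d : ℕ) (ρ : Fin n → Fin d → ℝ → 𝒢.Bisection) (U : Fin n → Set M)
      (P : Fin n → (Fin d → ℝ) → 𝒢.Bisection) (T : Fin n → G → Fin d → ℝ)
      (O : Fin n → Set (Fin d → ℝ)) (Ω : Fin n → Set G),
      IsFiberChartTuple (fun i => 𝒢.tgt (g i)) P T O Ω ∧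
      (∀ i j s, P i (Pi.single j s) = ρ i j s) ∧
      (∀ i, IsOpen (U i)) ∧ (∀ i, 𝒢.tgt (g i) ∈ U i) ∧
      (∀ z : Fin n → M, (∀ i, z i ∈ U i) → ∀ i j, Follows Γ' 𝓕 (ρ i j) i z) ∧
      (∀ i, ∀ᶠ t in 𝓝 (0 : Fin d → ℝ),
        Relation.ReflTransGen (MoveIn (ρ i) (U i)) (g i) (act (P i t) (g i))) ∧
      Filter.map (fun (p : Fin n → Fin d → ℝ) i => act (P i (p i)) (g i)) (𝓝 0) =
        𝓝[fiberTuples 𝒢 x] g := by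
  obtain ⟨d, ρ, U, hd, hρ, hli, hU, hyU, hfol⟩ := hf
  choose P T O Ω hP hPs hPm hC using fun i => exists_chart_of_isotopies hr (hd i) (hρ i) (hli i)
  refine ⟨d, ρ, U, P, T, O, Ω, ⟨hC, fun i => (hP i).smooth, fun i => (hP i).zero⟩, hPs, hU, hyU,
    hfol, fun i => ?_, map_tuple_chart hg hC (fun i => (hP i).smooth) fun i => (hP i).zero⟩
  filter_upwards [hPm i (U i) (hU i) _ (hyU i)] with t ht
  exact ht _ rfl

/-- Every nearby tuple arises from `g` by replacing one component after the other, each through a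
chain of moves along single isotopies with targets in `U`. Each move preserves reachability. -/
theorem LocallyFollows.reachable_mem_nhdsWithin (hr : 1 ≤ r)
    (hmul : Filter.Tendsto (fun p : 𝒢.Bisection × 𝒢.Bisection => p.1 * p.2) (𝓕 ×ˢ 𝓕) 𝓕)
    {g : Fin n → G} (hf : LocallyFollows Γ Γ' 𝓕 fun i => 𝒢.tgt (g i))
    (hg : g ∈ fiberTuples 𝒢 x) (hgr : g ∈ reachable Γ' 𝓕 x) :
    reachable Γ' 𝓕 x ∈ 𝓝[fiberTuples 𝒢 x] g := by
  classical
  obtain ⟨d, ρ, U, P, T, O, Ω, hC, hPs, hU, hyU, hfol, hPm, hmap⟩ := hf.exists_chart hr hg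
  rw [← hmap, Filter.mem_map]
  have h1 : ∀ᶠ p in 𝓝 (0 : Fin n → Fin d → ℝ), ∀ i,
      Relation.ReflTransGen (MoveIn (ρ i) (U i)) (g i) (act (P i (p i)) (g i)) :=
    Filter.eventually_all.2 fun i =>
      ((continuous_apply i).tendsto (0 : Fin n → Fin d → ℝ)).eventually (hPm i)
  have h2 : ∀ᶠ p in 𝓝 (0 : Fin n → Fin d → ℝ), ∀ i, 𝒢.tgt (act (P i (p i)) (g i)) ∈ U i := by
    refine Filter.eventually_all.2 fun i => ?_
    have hc : Continuous fun p : Fin n → Fin d → ℝ => 𝒢.tgt (act (P i (p i)) (g i)) :=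
      𝒢.contMDiff_tgt.continuous.comp ((hC.smooth i).continuous_act.comp
        (f := fun p : Fin n → Fin d → ℝ => (p i, g i)) (by fun_prop))
    refine hc.continuousAt.eventually_mem ((hU i).mem_nhds ?_)
    rw [Pi.zero_apply, hC.zero, act_one]
    exact hyU i
  filter_upwards [h1, h2] with p hp hpU
  have key : ∀ S : Finset (Fin n),
      S.piecewise (fun i => act (P i (p i)) (g i)) g ∈ reachable Γ' 𝓕 x := by
    intro S
    induction S using Finset.induction_on with
    | empty => rwa [Finset.piecewise_empty]
    | insert i S hi ih =>
      rw [Finset.piecewise_insert]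
      set h := S.piecewise (fun i => act (P i (p i)) (g i)) g with hh
      have hhU : ∀ l, 𝒢.tgt (h l) ∈ U l := fun l => by
        by_cases hl : l ∈ S
        · rw [hh, Finset.piecewise_eq_of_mem _ _ _ hl]; exact hpU l
        · rw [hh, Finset.piecewise_eq_of_notMem _ _ _ hl]; exact hyU l
      have hmove : ∀ b, Relation.ReflTransGen (MoveIn (ρ i) (U i)) (g i) b →
          Function.update h i b ∈ reachable Γ' 𝓕 x := by
        intro b hb
        induction hb with
        | refl =>
          have : h i = g i := by rw [hh, Finset.piecewise_eq_of_notMem _ _ _ hi]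
          rwa [← this, Function.update_eq_self]
        | tail _ hbc ih' =>
          rename_i b c _
          obtain ⟨hbU, j, t, rfl⟩ := hbc
          have h3 := (hfol (fun l => 𝒢.tgt (Function.update h i b l)) (fun l => by
            rcases eq_or_ne l i with rfl | hl
            · rwa [Function.update_self]
            · rw [Function.update_of_ne hl]; exact hhU l) i j).update_mem_reachable hmul ih' t
          rwa [Function.update_self, Function.update_idem] at h3
      exact hmove _ (hp i)
  have h3 := key Finset.univ
  rwa [Finset.piecewise_univ] at h3

/-- If the isotopies in `Γ'` can locally be steered along a path of tuples of arrows, then a member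
of `Γ'` takes the first tuple to the last one. -/
theorem exists_mem_apply_eq (hr : 1 ≤ r) (h1 : pure 1 ≤ 𝓕)
    (hmul : Filter.Tendsto (fun p : 𝒢.Bisection × 𝒢.Bisection => p.1 * p.2) (𝓕 ×ˢ 𝓕) 𝓕)
    (hfam : ∀ (m : ℕ) (R : (Fin m → ℝ) → 𝒢.Bisection), IsFamilyIn Γ' R →
      Filter.Tendsto R (𝓝 0) 𝓕)
    {γ : Fin n → G} (c : Path (fun i => 𝒢.unit (x i)) γ) (hc : ∀ s, c s ∈ fiberTuples 𝒢 x)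
    (hf : ∀ s, LocallyFollows Γ Γ' 𝓕 fun i => 𝒢.tgt (c s i)) {B : Set 𝒢.Bisection} (hB : B ∈ 𝓕) :
    ∃ σ ∈ Γ', σ ∈ B ∧ ∀ i, σ (x i) = γ i := by
  have hAR : γ ∈ reachable Γ' 𝓕 x := by
    -- Reachability is closed by definition and open along the path by the local statement; the unit
    -- interval is connected.
    have hclopen : IsClopen (c ⁻¹' reachable Γ' 𝓕 x) := by
      refine ⟨isClosed_reachable.preimage c.continuous, isOpen_iff_mem_nhds.2 fun s hs => ?_⟩
      have h2 : Filter.Tendsto c (𝓝 s) (𝓝[fiberTuples 𝒢 x] c s) :=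
        tendsto_nhdsWithin_iff.2 ⟨c.continuous.continuousAt, Filter.Eventually.of_forall hc⟩
      exact h2 ((hf s).reachable_mem_nhdsWithin hr hmul (hc s) hs)
    have h3 := hclopen.eq_univ ⟨0, by
      rw [mem_preimage, c.source]; exact unit_mem_reachable h1⟩
    have h4 : (1 : unitInterval) ∈ c ⁻¹' reachable Γ' 𝓕 x := h3 ▸ mem_univ _
    rwa [mem_preimage, c.target] at h4
  have hγ : γ ∈ fiberTuples 𝒢 x := by simpa using hc 1
  have hfγ : LocallyFollows Γ Γ' 𝓕 fun i => 𝒢.tgt (γ i) := by simpa using hf 1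
  obtain ⟨d, ρ, U, P, T, O, Ω, hC, hPs, -, hyU, hfol, -, hmap⟩ := hfγ.exists_chart hr hγ
  have hsingle : ∀ i j s, fibPt (fun i => 𝒢.tgt (γ i)) P (Pi.single i (Pi.single j s)) =
      singleMove (ρ i j s) i fun i => 𝒢.tgt (γ i) := by
    intro i j s
    ext1 l
    rcases eq_or_ne l i with rfl | hl
    · rw [fibPt, singleMove, Function.update_self, Pi.single_eq_same, hPs]
    · rw [fibPt, singleMove, Function.update_of_ne hl, Pi.single_eq_of_ne hl, hC.zero]; rfl
  -- An axis of the chart tuple moves one component along one of the isotopies `ρ i j`, which is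
  -- what Γ' can follow.
  have happ : ApproximatesAxes Γ' (fun i => 𝒢.tgt (γ i)) P := by
    intro i j t ht A N hA hN hsA htN
    simp only [hsingle] at hsA htN
    obtain ⟨τ, hτ, -, h2, h3⟩ := hfol _ hyU i j t univ Filter.univ_mem A N hA hN
      (by rwa [uIcc_of_le ht]) htN
    exact ⟨τ, hτ, by rwa [uIcc_of_le ht] at h2, h3⟩
  obtain ⟨m, R, hR, hRe⟩ := hC.exists_family_exact hr happ
  obtain ⟨B₁, hB₁, B₂, hB₂, hB₁₂⟩ := Filter.mem_prod_iff.1 (hmul hB)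
  have h2 := Filter.image_mem_map (m := fun (p : Fin n → Fin d → ℝ) i => act (P i (p i)) (γ i))
    (hRe _ (hfam m R hR hB₁))
  rw [hmap] at h2
  obtain ⟨N, hN, hNs⟩ := mem_nhdsWithin_iff_exists_mem_nhds_inter.1 h2
  obtain ⟨_, hσN, σ, ⟨hσ, hσB⟩, rfl⟩ :=
    mem_closure_iff_nhds.1 (mem_iInter₂.1 hAR B₂ hB₂) N hN
  obtain ⟨p, ⟨t, htB, ht⟩, hp⟩ := hNs ⟨hσN, fun i => by
    change 𝒢.src (act σ (𝒢.unit (x i))) = x i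
    rw [src_act, 𝒢.src_unit]⟩
  -- The approximate solution is σ(x_i) = P_i(p_i).γ_i. The correction `R t` takes P_i(p_i), as a
  -- tuple at the targets of γ, to the units, and right multiplication by γ_i gives γ_i.
  refine ⟨R t * σ, Γ'.mul_mem (hR.mem t) hσ, hB₁₂ (mk_mem_prod htB hσB), fun i => ?_⟩
  have h3 : act (P i (p i)) (γ i) = act σ (𝒢.unit (x i)) := congrFun hp i
  have h4 : act (R t) (P i (p i) (𝒢.tgt (γ i))) = 𝒢.unit (𝒢.tgt (γ i)) := congrFun ht i
  rw [← act_unit, act_mul, ← h3, act, act_eq_mul_of_tgt (h := γ i) (P i (p i)) rfl]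
  change act (R t) (𝒢.mul (P i (p i) (𝒢.tgt (γ i))) (γ i)) = γ i
  rw [act_mul_right _ ((P i (p i)).src_apply _), h4, 𝒢.unit_mul]

end Steering

end LieGroupoid

namespace LieGroupoid

/-! ### The `C^1` topology -/

section C1Topology

variable {E F V : Type*} [NormedAddCommGroup E] [NormedSpace ℝ E]
  [NormedAddCommGroup F] [NormedSpace ℝ F] [NormedAddCommGroup V] [NormedSpace ℝ V]
  {M : Type*} [TopologicalSpace M] [ChartedSpace E M] [IsManifold 𝓘(ℝ, E) 1 M]
  {N : Type*} [TopologicalSpace N] [ChartedSpace F N] [IsManifold 𝓘(ℝ, F) 1 N]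

/-- The tangent maps of the members of a `C^1` family of maps depend continuously on the
parameter. -/
theorem continuous_tangentMap_family {f : V → M → N}
    (hf : ContMDiff (𝓘(ℝ, V).prod 𝓘(ℝ, E)) 𝓘(ℝ, F) 1 fun p : V × M => f p.1 p.2) :
    Continuous fun p : V × TangentBundle 𝓘(ℝ, E) M =>
      tangentMap 𝓘(ℝ, E) 𝓘(ℝ, F) (f p.1) p.2 := by
  -- The tangent map of a single member is the tangent map of the joint map on vectors with zero
  -- component in the parameter direction.
  let ι : V × TangentBundle 𝓘(ℝ, E) M → TangentBundle (𝓘(ℝ, V).prod 𝓘(ℝ, E)) (V × M) := fun p =>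
    (equivTangentBundleProd 𝓘(ℝ, V) V 𝓘(ℝ, E) M).symm (⟨p.1, 0⟩, p.2)
  have hz : Continuous fun v : V => (⟨v, 0⟩ : TangentBundle 𝓘(ℝ, V) V) :=
    (Bundle.contMDiff_zeroSection (n := 0) (IB := 𝓘(ℝ, V)) ℝ
      (TangentSpace 𝓘(ℝ, V) : V → Type _)).continuous
  have hι : Continuous ι :=
    (contMDiff_equivTangentBundleProd_symm (n := 0)).continuous.comp
      ((hz.comp continuous_fst).prodMk continuous_snd)
  refine ((hf.continuous_tangentMap le_rfl).comp hι).congr fun p => ?_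
  have h1 : ι p = tangentMap 𝓘(ℝ, E) (𝓘(ℝ, V).prod 𝓘(ℝ, E)) (fun y => (p.1, y)) p.2 :=
    tangentMap_prod_right.symm
  rw [Function.comp_apply, h1, ← tangentMap_comp_at]
  · rfl
  · exact hf.mdifferentiable one_ne_zero _
  · exact mdifferentiableAt_const.prodMk mdifferentiableAt_id

theorem tendsto_c1Topology {f : V → M → N}
    (hf : ContMDiff (𝓘(ℝ, V).prod 𝓘(ℝ, E)) 𝓘(ℝ, F) 1 fun p : V × M => f p.1 p.2) (A : Set M)
    (v : V) : Filter.Tendsto f (𝓝 v) (@nhds _ (c1Topology E F M N A) (f v)) := by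
  rw [TopologicalSpace.tendsto_nhds_generateFrom_iff]
  rintro S ⟨K, O, hK, -, hO, rfl⟩ hv
  exact hK.eventually_forall_of_forall_eventually fun w hw =>
    (continuous_tangentMap_family hf).continuousAt.eventually_mem (hO.mem_nhds (hv w hw))

theorem c1Topology_anti {A A' : Set M} (h : A ⊆ A') :
    c1Topology E F M N A' ≤ c1Topology E F M N A :=
  TopologicalSpace.generateFrom_anti fun _ ⟨K, O, hK, hKA, hO, hS⟩ =>
    ⟨K, O, hK, fun v hv => h (hKA v hv), hO, hS⟩

theorem mem_nhds_c1Topology {A : Set M} {f : M → N} {K : Set (TangentBundle 𝓘(ℝ, E) M)}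
    {O : Set (TangentBundle 𝓘(ℝ, F) N)} (hK : IsCompact K) (hKA : ∀ v ∈ K, v.proj ∈ A)
    (hO : IsOpen O) (hf : ∀ v ∈ K, tangentMap 𝓘(ℝ, E) 𝓘(ℝ, F) f v ∈ O) :
    {g : M → N | ∀ v ∈ K, tangentMap 𝓘(ℝ, E) 𝓘(ℝ, F) g v ∈ O} ∈
      @nhds _ (c1Topology E F M N A) f := by
  let := c1Topology E F M N A
  refine IsOpen.mem_nhds ?_ hf
  exact TopologicalSpace.isOpen_generateFrom_of_mem ⟨K, O, hK, hKA, hO, rfl⟩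

theorem mem_nhds_c1FamilyTopology {A : Set M} {f : ℝ → M → N}
    {K : Set (ℝ × TangentBundle 𝓘(ℝ, E) M)} {O : Set (TangentBundle 𝓘(ℝ, F) N)}
    (hK : IsCompact K) (hKA : ∀ p ∈ K, p.2.proj ∈ A) (hO : IsOpen O)
    (hf : ∀ p ∈ K, tangentMap 𝓘(ℝ, E) 𝓘(ℝ, F) (f p.1) p.2 ∈ O) :
    {g : ℝ → M → N | ∀ p ∈ K, tangentMap 𝓘(ℝ, E) 𝓘(ℝ, F) (g p.1) p.2 ∈ O} ∈
      @nhds _ (c1FamilyTopology E F M N A) f := by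
  let := c1FamilyTopology E F M N A
  refine IsOpen.mem_nhds ?_ hf
  exact TopologicalSpace.isOpen_generateFrom_of_mem ⟨K, O, hK, hKA, hO, rfl⟩

/-- Closeness of families in the `C^1` topology implies closeness of the curves of values at a
point. -/
theorem forall_apply_mem_nhds_c1FamilyTopology {A : Set M} {f : ℝ → M → N} {I : Set ℝ}
    (hI : IsCompact I) {z : M} (hz : z ∈ A) {O : Set N} (hO : IsOpen O)
    (hf : ∀ s ∈ I, f s z ∈ O) :
    {g : ℝ → M → N | ∀ s ∈ I, g s z ∈ O} ∈ @nhds _ (c1FamilyTopology E F M N A) f := by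
  have hπ : Continuous (fun v : TangentBundle 𝓘(ℝ, F) N => v.proj) :=
    FiberBundle.continuous_proj F (TangentSpace 𝓘(ℝ, F) : N → Type _)
  have h := mem_nhds_c1FamilyTopology (A := A) (f := f)
    (K := I ×ˢ {(⟨z, 0⟩ : TangentBundle 𝓘(ℝ, E) M)}) (hI.prod isCompact_singleton)
    (by rintro ⟨s, w⟩ ⟨-, hw⟩; rw [mem_singleton_iff.1 hw]; exact hz) (hO.preimage hπ)
    (by rintro ⟨s, w⟩ ⟨hs, hw⟩; rw [mem_singleton_iff.1 hw]; exact hf s hs)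
  refine Filter.mem_of_superset h fun g hg s hs => ?_
  exact hg (s, ⟨z, 0⟩) ⟨hs, rfl⟩

end C1Topology

variable {E F : Type*} [NormedAddCommGroup E] [NormedSpace ℝ E]
  [NormedAddCommGroup F] [NormedSpace ℝ F] {r : WithTop ℕ∞}
  {M : Type*} [TopologicalSpace M] [ChartedSpace E M]
  {G : Type*} [TopologicalSpace G] [ChartedSpace F G]
  {𝒢 : LieGroupoid E F r M G}

theorem tgt_one_apply : (fun z => 𝒢.tgt ((1 : 𝒢.Bisection) z)) = id :=
  funext 𝒢.tgt_unit

theorem Bisection.mdifferentiable_tgt (hr : 1 ≤ r) (σ : 𝒢.Bisection) :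
    MDifferentiable 𝓘(ℝ, E) 𝓘(ℝ, E) fun z => 𝒢.tgt (σ z) :=
  ((𝒢.contMDiff_tgt.comp σ.contMDiff).of_le hr).mdifferentiable one_ne_zero

variable [IsManifold 𝓘(ℝ, E) 1 M]

/-- The filter of the bisections that move the points of `A` little, in the `C^1` topology. -/
def nearIdentityOn (𝒢 : LieGroupoid E F r M G) (A : Set M) : Filter 𝒢.Bisection :=
  Filter.comap (fun σ z => 𝒢.tgt (σ z)) (@nhds _ (c1Topology E E M M A) id)

theorem pure_one_le_nearIdentityOn (A : Set M) : pure 1 ≤ nearIdentityOn 𝒢 A := by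
  rw [nearIdentityOn, ← Filter.map_le_iff_le_comap, Filter.map_pure, tgt_one_apply]
  exact @pure_le_nhds _ (c1Topology E E M M A) _

/-- The second factor may move tangent vectors out of the compact set `K`, so the first one is
controlled on a larger compact `L` with `K` in its interior. Openness of `A` leaves room for `L`
over `A`. -/
theorem tendsto_mul_nearIdentityOn [FiniteDimensional ℝ E] [T2Space M] (hr : 1 ≤ r) {A : Set M}
    (hA : IsOpen A) :
    Filter.Tendsto (fun p : 𝒢.Bisection × 𝒢.Bisection => p.1 * p.2)
      (nearIdentityOn 𝒢 A ×ˢ nearIdentityOn 𝒢 A) (nearIdentityOn 𝒢 A) := by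
  have hπ : Continuous (fun v : TangentBundle 𝓘(ℝ, E) M => v.proj) :=
    FiberBundle.continuous_proj E (TangentSpace 𝓘(ℝ, E) : M → Type _)
  have : LocallyCompactSpace (ModelProd E E) := inferInstanceAs (LocallyCompactSpace (E × E))
  have : LocallyCompactSpace (TangentBundle 𝓘(ℝ, E) M) :=
    ChartedSpace.locallyCompactSpace (ModelProd E E) _
  refine Filter.tendsto_comap_iff.2 (TopologicalSpace.tendsto_nhds_generateFrom_iff.2 ?_)
  rintro S ⟨K, O, hK, hKA, hO, rfl⟩ hid
  simp only [mem_ofPred_eq, tangentMap_id, id] at hid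
  obtain ⟨L, hL, hKL, hLO⟩ := exists_compact_between hK (hO.inter (hA.preimage hπ))
    fun v hv => ⟨hid v hv, hKA v hv⟩
  have h1 := Filter.preimage_mem_comap (m := fun (σ : 𝒢.Bisection) z => 𝒢.tgt (σ z))
    (mem_nhds_c1Topology (A := A) (f := (id : M → M)) hL (fun v hv => (hLO hv).2) hO
      fun v hv => by rw [tangentMap_id]; exact (hLO hv).1)
  have h2 := Filter.preimage_mem_comap (m := fun (σ : 𝒢.Bisection) z => 𝒢.tgt (σ z))
    (mem_nhds_c1Topology (A := A) (f := (id : M → M)) hK hKA (isOpen_interior (s := L))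
      fun v hv => by rw [tangentMap_id]; exact hKL hv)
  filter_upwards [Filter.prod_mem_prod h1 h2]
  rintro ⟨σ, τ⟩ ⟨hσ, hτ⟩ v hv
  have h3 : (fun z => 𝒢.tgt ((σ * τ) z)) = (fun z => 𝒢.tgt (σ z)) ∘ fun z => 𝒢.tgt (τ z) :=
    funext fun z => Bisection.tgt_mul_apply _ _ _
  change tangentMap 𝓘(ℝ, E) 𝓘(ℝ, E) (fun z => 𝒢.tgt ((σ * τ) z)) v ∈ O
  rw [h3, tangentMap_comp_at _ (σ.mdifferentiable_tgt hr _) (τ.mdifferentiable_tgt hr _)]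
  exact hσ _ (interior_subset (hτ v hv))

theorem IsFamilyIn.tendsto_nearIdentityOn {V : Type*} [NormedAddCommGroup V] [NormedSpace ℝ V]
    (hr : 1 ≤ r) {Γ : Subgroup 𝒢.Bisection} {R : V → 𝒢.Bisection} (hR : IsFamilyIn Γ R)
    (A : Set M) : Filter.Tendsto R (𝓝 0) (nearIdentityOn 𝒢 A) := by
  refine Filter.tendsto_comap_iff.2 ?_
  have h := tendsto_c1Topology (f := fun v z => 𝒢.tgt (R v z))
    ((𝒢.contMDiff_tgt.comp hR.smooth).of_le hr) A 0
  beta_reduce at h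
  rw [hR.zero, tgt_one_apply] at h
  exact h

variable [IsManifold 𝓘(ℝ, F) 1 G]

/-- Isotopies that are `C^1` close to the constant isotopy over `A` consist of bisections that move
the points of `A` little. -/
theorem tendsto_nearIdentityOn (hr : 1 ≤ r) {A A' : Set M} (hA : A ⊆ A') (t : ℝ) :
    Filter.Tendsto (fun τ : ℝ → 𝒢.Bisection => τ t)
      (Filter.comap (fun τ t => (τ t).toFun)
        (@nhds (ℝ → M → G) (c1FamilyTopology E F M G A') fun _ => 𝒢.unit))
      (nearIdentityOn 𝒢 A) := by
  have hT : Continuous (tangentMap 𝓘(ℝ, F) 𝓘(ℝ, E) 𝒢.tgt) :=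
    (𝒢.contMDiff_tgt.of_le hr).continuous_tangentMap le_rfl
  have hcomp : ∀ (σ : 𝒢.Bisection) v, tangentMap 𝓘(ℝ, E) 𝓘(ℝ, E) (fun z => 𝒢.tgt (σ z)) v =
      tangentMap 𝓘(ℝ, F) 𝓘(ℝ, E) 𝒢.tgt (tangentMap 𝓘(ℝ, E) 𝓘(ℝ, F) σ.toFun v) := fun σ v =>
    tangentMap_comp_at v ((𝒢.contMDiff_tgt.of_le hr).mdifferentiable one_ne_zero _)
      ((σ.contMDiff.of_le hr).mdifferentiable one_ne_zero _)
  refine Filter.tendsto_comap_iff.2 (TopologicalSpace.tendsto_nhds_generateFrom_iff.2 ?_)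
  rintro S ⟨K, O, hK, hKA, hO, rfl⟩ hid
  have h1 := mem_nhds_c1FamilyTopology (A := A') (f := fun _ => 𝒢.unit)
    (isCompact_singleton (x := t) |>.prod hK) (fun p hp => hA (hKA _ hp.2)) (hO.preimage hT)
    (by
      rintro ⟨s, v⟩ ⟨-, hv⟩
      have h2 := hcomp 1 v
      rw [tgt_one_apply] at h2
      change tangentMap 𝓘(ℝ, F) 𝓘(ℝ, E) 𝒢.tgt (tangentMap 𝓘(ℝ, E) 𝓘(ℝ, F) 𝒢.unit v) ∈ O
      exact h2 ▸ hid v hv)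
  filter_upwards [Filter.preimage_mem_comap h1] with τ hτ v hv
  change tangentMap 𝓘(ℝ, E) 𝓘(ℝ, E) (fun z => 𝒢.tgt (τ t z)) v ∈ O
  rw [hcomp]
  exact hτ (t, v) ⟨rfl, hv⟩

end LieGroupoid

namespace LieGroupoid

variable {E F : Type*} [NormedAddCommGroup E] [NormedSpace ℝ E]
  [NormedAddCommGroup F] [NormedSpace ℝ F] {r : WithTop ℕ∞}
  {M : Type*} [TopologicalSpace M] [ChartedSpace E M]
  {G : Type*} [TopologicalSpace G] [ChartedSpace F G]
  {𝒢 : LieGroupoid E F r M G}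

/-! ### Bisections supported in an open set -/

theorem Bisection.baseSupp_subset_supp (σ : 𝒢.Bisection) : σ.baseSupp ⊆ σ.supp :=
  closure_mono fun z hz h => hz (by rw [h, 𝒢.tgt_unit])

theorem Bisection.baseSupp_one : (1 : 𝒢.Bisection).baseSupp = ∅ := by
  have h : {z | 𝒢.tgt ((1 : 𝒢.Bisection) z) ≠ z} = ∅ :=
    eq_empty_of_forall_notMem fun z hz => hz (𝒢.tgt_unit z)
  rw [Bisection.baseSupp, h, closure_empty]

theorem Bisection.baseSupp_mul_subset (σ τ : 𝒢.Bisection) :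
    (σ * τ).baseSupp ⊆ σ.baseSupp ∪ τ.baseSupp := by
  rw [Bisection.baseSupp, Bisection.baseSupp, Bisection.baseSupp, ← closure_union]
  refine closure_mono fun z hz => ?_
  by_contra h
  simp only [mem_union, mem_ofPred_eq, not_or, not_not] at h
  exact hz (by rw [Bisection.tgt_mul_apply, h.2, h.1])

theorem Bisection.baseSupp_inv_subset (σ : 𝒢.Bisection) : (σ⁻¹).baseSupp ⊆ σ.baseSupp := by
  refine closure_mono fun z hz h => hz ?_
  have h' : σ.diffeo z = z := (σ.diffeo_apply z).trans h
  rw [Bisection.tgt_inv_apply]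
  calc σ.diffeo.symm z = σ.diffeo.symm (σ.diffeo z) := by rw [h']
    _ = z := σ.diffeo.symm_apply_apply z

/-- The members of `Γ` whose diffeomorphisms of the base are supported in `O`. -/
def supportedIn (Γ : Subgroup 𝒢.Bisection) (O : Set M) : Subgroup 𝒢.Bisection where
  carrier := {σ | σ ∈ Γ ∧ σ.baseSupp ⊆ O}
  mul_mem' hσ hτ := ⟨Γ.mul_mem hσ.1 hτ.1,
    (Bisection.baseSupp_mul_subset _ _).trans (union_subset hσ.2 hτ.2)⟩
  one_mem' := ⟨Γ.one_mem, by rw [Bisection.baseSupp_one]; exact empty_subset _⟩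
  inv_mem' hσ := ⟨Γ.inv_mem hσ.1, (Bisection.baseSupp_inv_subset _).trans hσ.2⟩

/-- Distinct points in an open set have relatively compact neighbourhoods inside pairwise disjoint
ones. -/
theorem exists_separating_nhds {X : Type*} [TopologicalSpace X] [T2Space X]
    [LocallyCompactSpace X] {n : ℕ} {y : Fin n → X} (hy : Function.Injective y) {O : Set X} (hO : IsOpen O) (hyO : ∀ i, y i ∈ O) :
    ∃ U V : Fin n → Set X, (∀ i, IsOpen (U i)) ∧ (∀ i, IsOpen (V i)) ∧ (∀ i, y i ∈ U i) ∧
      (∀ i, IsCompact (closure (U i))) ∧ (∀ i, IsCompact (closure (V i))) ∧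
      (∀ i, closure (U i) ⊆ V i) ∧ (∀ i, V i ⊆ O) ∧ ∀ i l, l ≠ i → Disjoint (V l) (V i) := by
  obtain ⟨D, hD, hDd⟩ := (finite_range y).t2_separation
  choose V hVo hyV hVD hVc using fun i => exists_open_between_and_isCompact_closure
    (isCompact_singleton (x := y i)) ((hD (y i)).2.inter hO)
    (singleton_subset_iff.2 ⟨(hD (y i)).1, hyO i⟩)
  choose U hUo hyU hUV hUc using fun i => exists_open_between_and_isCompact_closure
    (isCompact_singleton (x := y i)) (hVo i) (hyV i)
  refine ⟨U, V, hUo, hVo, fun i => hyU i rfl, hUc, hVc, hUV,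
    fun i => (subset_closure.trans (hVD i)).trans inter_subset_right, fun i l hil => ?_⟩
  exact (hDd (mem_range_self l) (mem_range_self i) (hy.ne hil)).mono
    ((subset_closure.trans (hVD l)).trans inter_subset_left)
    ((subset_closure.trans (hVD i)).trans inter_subset_left)

/-! ### Consequences of the locality condition -/

variable [IsManifold 𝓘(ℝ, F) 1 G]

theorem IsIsotopyIn.velocity_reparam (hr : 1 ≤ r) {Γ : Subgroup 𝒢.Bisection}
    {ρ : ℝ → 𝒢.Bisection} (hρ : IsIsotopyIn Γ ρ) {f : ℝ → ℝ} (hf : ContDiff ℝ r f) (h0 : f 0 = 0)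
    {a : ℝ} (ha : HasDerivAt f a 0) (y : M) :
    velocity (fun s => ρ (f s)) y = a • velocity ρ y := by
  have h1 : ContDiffAt ℝ 1 (fun s => extChartAt 𝓘(ℝ, F) (𝒢.unit y) (ρ s y)) 0 := by
    refine ContMDiffAt.contDiffAt ?_
    have h2 : ContMDiff 𝓘(ℝ, ℝ) 𝓘(ℝ, F) r (fun s => ρ s y) :=
      hρ.contMDiff.comp (contMDiff_id.prodMk contMDiff_const)
    refine ContMDiffAt.comp (g := extChartAt 𝓘(ℝ, F) (𝒢.unit y)) 0 ?_
      (h2.of_le hr).contMDiffAt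
    rw [hρ.zero]
    exact contMDiffAt_extChartAt
  have h3 := (h1.differentiableAt one_ne_zero).hasDerivAt
  rw [← h0] at h3
  have h4 := HasDerivAt.scomp (0 : ℝ) h3 ha
  have h5 : (velocity (fun s => ρ (f s)) y : F) = a • (velocity ρ y : F) := by
    rw [velocity_eq_fderiv hr (hρ.reparam hf h0), velocity_eq_fderiv hr hρ, fderiv_apply_one_eq_deriv,
      fderiv_apply_one_eq_deriv]
    rw [h0] at h4
    exact h4.deriv
  exact h5

variable [IsManifold 𝓘(ℝ, E) 1 M]

/-- Fiberwise transitivity holds with isotopies that stay close to `1`. -/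
theorem FiberwiseTransitive.exists_small_isotopies (hr : 1 ≤ r) {Γ : Subgroup 𝒢.Bisection}
    (hT : FiberwiseTransitive Γ) (y : M) {d : ℕ} (hd : 𝒢.fiberDim y = d) {W : Set (M → G)}
    (hW : W ∈ @nhds (M → G) (c1Topology E F M G univ) 𝒢.unit) :
    ∃ ρ : Fin d → ℝ → 𝒢.Bisection, (∀ j, IsIsotopyIn Γ (ρ j)) ∧
      LinearIndependent ℝ (fun j => velocity (ρ j) y) ∧ ∀ j t, (ρ j t).toFun ∈ W := by
  obtain ⟨σ, hσ, hli⟩ := hT.exists_isotopies y hd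
  have hε : ∀ j, ∃ ε : ℝ, 0 < ε ∧ ∀ u, |u| ≤ ε → (σ j u).toFun ∈ W := by
    intro j
    have h1 := tendsto_c1Topology (f := fun u => (σ j u).toFun) ((hσ j).contMDiff.of_le hr) univ 0
    beta_reduce at h1
    rw [(hσ j).zero] at h1
    obtain ⟨ε, hε, hb⟩ := Metric.mem_nhds_iff.1 (h1 hW)
    refine ⟨ε / 2, half_pos hε, fun u hu => hb ?_⟩
    rw [mem_ball_zero_iff, Real.norm_eq_abs]
    linarith
  choose ε hε hW' using hε
  -- The reparametrization ε sin t keeps the isotopy at parameters in [-ε, ε] for all times, has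
  -- nonzero derivative at 0, and is analytic, so it also serves for r = ω.
  have hf : ∀ j, ContDiff ℝ r fun t => ε j * Real.sin t := fun j =>
    contDiff_const.mul Real.contDiff_sin
  have hf0 : ∀ j, ε j * Real.sin 0 = 0 := fun j => by simp
  refine ⟨fun j t => σ j (ε j * Real.sin t), fun j => (hσ j).reparam (hf j) (hf0 j), ?_, ?_⟩
  · have h1 : ∀ j, HasDerivAt (fun t => ε j * Real.sin t) (ε j) 0 := fun j => by
      simpa using (Real.hasDerivAt_sin 0).const_mul (ε j)
    have h2 := hli.units_smul fun j => Units.mk0 (ε j) (hε j).ne'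
    convert h2 using 2 with j
    exact (hσ j).velocity_reparam hr (hf j) (hf0 j) (h1 j) y
  · intro j t
    refine hW' j _ ?_
    rw [abs_mul, abs_of_pos (hε j)]
    exact mul_le_of_le_one_right (hε j).le (Real.abs_sin_le_one t)

variable [FiniteDimensional ℝ E] [FiniteDimensional ℝ F] [T2Space M] {n : ℕ}

variable {Γ : Subgroup 𝒢.Bisection} {y : Fin n → M} {O : Set M}

/-- Here following is exact: the cut-off isotopy agrees with ρ on `U i`, and the other points lie in
the sets `V l`, disjoint from its support. The support lies in `V i`, hence in `O`. -/
theorem LCondition.locallyFollows_supportedIn (hr : 1 ≤ r) (hω : r ≠ ω) (hL : LCondition Γ)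
    (hT : FiberwiseTransitive Γ) (hy : Function.Injective y) (hO : IsOpen O)
    (hyO : ∀ i, y i ∈ O) : LocallyFollows Γ (supportedIn Γ O) ⊤ y := by
  have : LocallyCompactSpace M := ChartedSpace.locallyCompactSpace E M
  obtain ⟨U, V, hUo, hVo, hyU, hUc, hVc, hUV, hVO, hV⟩ := exists_separating_nhds hy hO hyO
  choose W hW hWL using fun i => hL (U i) (V i) (hUo i) (hVo i) (hUc i) (hVc i) (hUV i)
  have hd : ∀ z, 𝒢.fiberDim z = Module.finrank ℝ F - Module.finrank ℝ E := fun z => by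
    have := finrank_add_fiberDim 𝒢 z; omega
  choose ρ hρ hli hρW using fun i => hT.exists_small_isotopies hr (y i) (hd _) (hW i)
  refine ⟨_, ρ, U, fun _ => hd _, hρ, hli, hUo, hyU, fun z hz i j => ?_⟩
  obtain ⟨τ, hτ, hτs⟩ := (hWL i (ρ i j) (hρ i j) (hρW i j)).1 hω
  have hzl : ∀ s l, τ s (z l) = singleMove (ρ i j s) i z l := by
    intro s l
    rcases eq_or_ne l i with rfl | hl
    · rw [singleMove, Function.update_self, (hτs s).1 _ (hz l)]
    · rw [singleMove, Function.update_of_ne hl]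
      by_contra h
      exact Set.disjoint_left.1 (hV i l hl) (hUV l (subset_closure (hz l)))
        ((hτs s).2 (subset_closure h))
  have hτ' : IsIsotopyIn (supportedIn Γ O) τ :=
    { contMDiff := hτ.contMDiff
      mem := fun s => ⟨hτ.mem s, ((τ s).baseSupp_subset_supp.trans (hτs s).2).trans (hVO i)⟩
      zero := hτ.zero }
  intro t B hB A N _ _ hA hN
  simp only [← hzl] at hA hN
  exact ⟨τ, hτ', by rw [Filter.mem_top.1 hB]; exact mem_univ _, hA, hN⟩

/-- The complement of `V i` contains both the other points of the tuple and the complement of the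
closure of `O`. A single closeness condition there keeps those points nearly fixed and gives the
control off `O`; closeness on `U i` moves the `i`-th point. -/
theorem LCondition.locallyFollows_nearIdentityOn (hr : 1 ≤ r) (hω : r = ω) (hL : LCondition Γ)
    (hT : FiberwiseTransitive Γ) (hy : Function.Injective y) (hO : IsOpen O)
    (hyO : ∀ i, y i ∈ O) : LocallyFollows Γ Γ (nearIdentityOn 𝒢 (closure O)ᶜ) y := by
  have : LocallyCompactSpace M := ChartedSpace.locallyCompactSpace E M
  obtain ⟨U, V, hUo, hVo, hyU, hUc, hVc, hUV, hVO, hV⟩ := exists_separating_nhds hy hO hyO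
  choose W hW hWL using fun i => hL (U i) (V i) (hUo i) (hVo i) (hUc i) (hVc i) (hUV i)
  have hd : ∀ z, 𝒢.fiberDim z = Module.finrank ℝ F - Module.finrank ℝ E := fun z => by
    have := finrank_add_fiberDim 𝒢 z; omega
  choose ρ hρ hli hρW using fun i => hT.exists_small_isotopies hr (y i) (hd _) (hW i)
  refine ⟨_, ρ, U, fun _ => hd _, hρ, hli, hUo, hyU, fun z hz i j => ?_⟩
  intro t B hB A N hAo hNo hA hN
  have hsub : (closure O)ᶜ ⊆ (V i)ᶜ := compl_subset_compl.2 ((hVO i).trans subset_closure)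
  obtain ⟨Q, hQ, hQB⟩ := Filter.mem_comap.1 (tendsto_nearIdentityOn (𝒢 := 𝒢) hr hsub t hB)
  have hP := Filter.inter_mem
    (forall_apply_mem_nhds_c1FamilyTopology (E := E) (F := F) (f := fun s => (ρ i j s).toFun)
      isCompact_uIcc (hz i) (hAo i) fun s hs => by
        have h := hA s hs i
        rwa [singleMove, Function.update_self] at h)
    (forall_apply_mem_nhds_c1FamilyTopology (E := E) (F := F) (f := fun s => (ρ i j s).toFun)
      (isCompact_singleton (x := t)) (hz i) (hNo i) fun s hs => by
        have h := hN i
        rw [mem_singleton_iff.1 hs]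
        rwa [singleMove, Function.update_self] at h)
  have hQ' : {g : ℝ → M → G | ∀ l, l ≠ i → (∀ s ∈ uIcc 0 t, g s (z l) ∈ A l) ∧
      ∀ s ∈ ({t} : Set ℝ), g s (z l) ∈ N l} ∈
      @nhds (ℝ → M → G) (c1FamilyTopology E F M G (V i)ᶜ) (fun _ => 𝒢.unit) := by
    refine Filter.eventually_all.2 fun l => Filter.eventually_imp_distrib_left.2 fun hl => ?_
    have hzl : z l ∈ (V i)ᶜ := fun h =>
      Set.disjoint_left.1 (hV i l hl) (hUV l (subset_closure (hz l))) h
    refine Filter.inter_mem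
      (forall_apply_mem_nhds_c1FamilyTopology (E := E) (F := F) (f := fun _ => 𝒢.unit)
        isCompact_uIcc hzl (hAo l) fun s hs => ?_)
      (forall_apply_mem_nhds_c1FamilyTopology (E := E) (F := F) (f := fun _ => 𝒢.unit)
        isCompact_singleton hzl (hNo l) fun s _ => ?_)
    · have h := hA s hs l
      rwa [singleMove, Function.update_of_ne hl] at h
    · have h := hN l
      rwa [singleMove, Function.update_of_ne hl] at h
  obtain ⟨τ, hτ, hτP, hτQ⟩ :=
    (hWL i (ρ i j) (hρ i j) (hρW i j)).2 hω _ hP _ (Filter.inter_mem hQ hQ')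
  refine ⟨τ, hτ, hQB hτQ.1, fun s hs l => ?_, fun l => ?_⟩
  · rcases eq_or_ne l i with rfl | hl
    · exact hτP.1 s hs
    · exact (hτQ.2 l hl).1 s hs
  · rcases eq_or_ne l i with rfl | hl
    · exact hτP.2 t rfl
    · exact (hτQ.2 l hl).2 t rfl

end LieGroupoid

end

/-! ### The transitivity theorem -/

theorem theorem1p3
    {E F : Type*} [NormedAddCommGroup E] [NormedSpace ℝ E] [FiniteDimensional ℝ E]
    [NormedAddCommGroup F] [NormedSpace ℝ F] [FiniteDimensional ℝ F]
    (r : WithTop ℕ∞) (hr : 1 ≤ r)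
    {M : Type*} [TopologicalSpace M] [T2Space M] [SecondCountableTopology M] [ChartedSpace E M]
    [IsManifold 𝓘(ℝ, E) 1 M] [IsManifold 𝓘(ℝ, E) r M]
    {G : Type*} [TopologicalSpace G] [T2Space G] [SecondCountableTopology G] [ChartedSpace F G]
    [IsManifold 𝓘(ℝ, F) 1 G] [IsManifold 𝓘(ℝ, F) r G]
    (𝒢 : LieGroupoid E F r M G) (Γ : Subgroup 𝒢.Bisection)
    (hL : LieGroupoid.LCondition Γ) (hT : LieGroupoid.FiberwiseTransitive Γ)
    {n : ℕ} (x : Fin n → M) (hx : Function.Injective x)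
    (hdim : ∀ i, 2 ≤ 𝒢.leafDim (x i) ∨ ∀ j, j ≠ i → x j ∉ 𝒢.leaf (x i))
    (γ : Fin n → G) (hγ : γ ∈ 𝒢.arrowTuples x)
    (V : Fin n → Set M) (hV : ∀ i, IsOpen (V i)) (hLV : ∀ i, 𝒢.leaf (x i) ⊆ V i) :
    (r ≠ ω → ∃ σ ∈ Γ, (∀ i, σ (x i) = γ i) ∧ σ.baseSupp ⊆ ⋃ i, V i) ∧
    (r = ω → ∀ W ∈ @nhds (M → M) (c1Topology E E M M (⋃ i, V i)ᶜ) id,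
      ∃ σ ∈ Γ, (∀ i, σ (x i) = γ i) ∧ (fun y => 𝒢.tgt (σ y)) ∈ W) := by
  have hunit : (fun i => 𝒢.unit (x i)) ∈ 𝒢.arrowTuples x :=
    ⟨fun i => LieGroupoid.unit_mem_fiberComponent _, fun i j hij => by
      rw [𝒢.tgt_unit, 𝒢.tgt_unit]; exact hx.ne hij⟩
  have hjoin := hT.joinedIn_arrowTuples hr hdim hunit hγ
  set c := hjoin.somePath
  have hc : ∀ s, c s ∈ 𝒢.arrowTuples x := hjoin.somePath_mem
  have hcF : ∀ s, c s ∈ LieGroupoid.fiberTuples 𝒢 x := fun s i =>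
    LieGroupoid.src_eq_of_mem_fiberComponent ((hc s).1 i)
  have hcy : ∀ s, Function.Injective fun i => 𝒢.tgt (c s i) := fun s i j hij =>
    not_not.1 fun hne => (hc s).2 i j hne hij
  have : LocallyCompactSpace M := ChartedSpace.locallyCompactSpace E M
  -- The targets along the path form a compact subset of the leaves, so there is room for `O` with
  -- closure inside the union of the `V i`.
  obtain ⟨O, hO, hcO, hOV, -⟩ := exists_open_between_and_isCompact_closure
    (K := ⋃ i, range fun s => 𝒢.tgt (c s i)) (U := ⋃ i, V i)
    (isCompact_iUnion fun i => isCompact_range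
      (𝒢.contMDiff_tgt.continuous.comp ((continuous_apply i).comp c.continuous)))
    (isOpen_iUnion hV) (iUnion_mono fun i => by
      rintro _ ⟨s, rfl⟩
      exact hLV i ⟨_, (hc s).1 i, rfl⟩)
  have hcO' : ∀ s i, 𝒢.tgt (c s i) ∈ O := fun s i => hcO (mem_iUnion.2 ⟨i, s, rfl⟩)
  refine ⟨fun hω => ?_, fun hω W hW => ?_⟩
  · obtain ⟨σ, hσ, -, h⟩ := LieGroupoid.exists_mem_apply_eq hr le_top Filter.tendsto_top
      (fun _ _ _ => Filter.tendsto_top) c hcF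
      (fun s => hL.locallyFollows_supportedIn hr hω hT (hcy s) hO (hcO' s)) Filter.univ_mem
    exact ⟨σ, hσ.1, h, hσ.2.trans (subset_closure.trans hOV)⟩
  -- The complement of the union of the `V i` is closed, whereas composition of near-identities is
  -- controlled on open sets; the complement of the closure of `O` is an open set containing it.
  · have hW' : W ∈ @nhds (M → M) (c1Topology E E M M (closure O)ᶜ) id :=
      nhds_mono (LieGroupoid.c1Topology_anti (compl_subset_compl.2 hOV)) hW
    obtain ⟨σ, hσ, hσW, h⟩ := LieGroupoid.exists_mem_apply_eq hr
      (LieGroupoid.pure_one_le_nearIdentityOn _)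
      (LieGroupoid.tendsto_mul_nearIdentityOn hr isClosed_closure.isOpen_compl)
      (fun _ _ hR => hR.tendsto_nearIdentityOn hr _) c hcF
      (fun s => hL.locallyFollows_nearIdentityOn hr hω hT (hcy s) hO (hcO' s))
      (Filter.preimage_mem_comap hW')
    exact ⟨σ, hσ, h, hσW⟩
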